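/- Let $\Sigma$ be a finite, linearly ordered alphabet, and let $<_L$ be the length-lexicographic order on $\Sigma^*$ (shorter words first, words of equal length lexicographically). **Automata.** A PDFA is a tuple $\mathcal A=\langle Q,\Sigma,\delta,q_0,O,\succeq,\lambda\rangle$ with a finite set $Q$ of states, a transition function $\delta:Q\times\Sigma\to Q$ (extended to words), an initial state $q_0$, a finite set $O$ of ranks with a partial order $\succeq$, and a surjective ranking $\lambda:Q\to O$. Words $w,w'$ satisfy $w\sim w'$, $w\succ w'$, or are incomparable, when the ranks $\lambda(\delta(q_0,w))$ and $\lambda(\delta(q_0,w'))$ are equal, in the relation $\succ$, or incomparable. Two PDFAs are equivalent if they induce the same preorder on $\Sigma^*$; $\mathcal A$ is canonical if no equivalent PDFA has fewer states. A PNFA has a set-valued transition function and a partial ranking ($\varnothing$ means undefined). **Samples.** A sample is a finite set $S\subseteq\Sigma^*\times\Sigma^*\times\{0,1,\bot\}$; $W_S$ is the set of words occurring in it, $\mathrm{Pref}(W_S)$ the set of their prefixes, and $m=\sum_{w\in W_S}|w|$. It is drawn from $\mathcal A$ if $w\sim w'$, $w\succ w'$, or $w,w'$ are incomparable, for each $(w,w',b)\in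 S$ with $b=0$, $b=1$, $b=\bot$, respectively. The closure $S^\circ$ is the least set containing $S$ and all $(w,w,0)$ with $w\in W_S$ that is symmetric for $b\in\{0,\bot\}$, transitive for $b\in\{0,1\}$, and closed under composing, on either side, a triple with label $b\in\{1,\bot\}$ with a triple with label $0$ (the result has label $b$). For $q\in Q$ let $\mathrm{SP}(q)$ be the $<_L$-least word reaching $q$; let $\mathrm{SP}(\mathcal A)=\{\mathrm{SP}(q) : q\in Q\}$ and $\mathrm{NU}(\mathcal A)=\{ua : u\in \mathrm{SP}(\mathcal A),a\in\Sigma\}\cup\{\epsilon\}$. A sample $S$ drawn from $\mathcal A$ is characteristic if (1) $\mathrm{NU}(\mathcal A)\subseteq\mathrm{Pref}(W_S)$; (2) for all $w\in\mathrm{SP}(\mathcal A)$, $u\in\mathrm{NU}(\mathcal A)$ with $\delta(q_0,w)\ne\delta(q_0,u)$ there is $y\in\Sigma^*$ with $wy,uy\in W_S$ and $\{(wy,uy,1),(uy,wy,1),(wy,uy,\bot)\}\cap S^\circ\neq\emptyset$; (3) every $q\in Q$ equals $\delta(q_0,w)$ for some $w\in W_S$; (4) for all $w,u\in W_S$: $w\sim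 u$ implies $(w,u,0)\in S^\circ$, $w\succ u$ implies $(w,u,1)\in S^\circ$, and if $w,u$ are incomparable then none of $(w,u,0),(w,u,1),(u,w,1)$ is in $S^\circ$. **The algorithm LearnPDFA.** Let $S\neq\emptyset$. The prefix tree automaton $\mathrm{PT}_S$ is the PNFA with state set $\mathrm{Pref}(W_S)$, initial state $\epsilon$ and transitions $u\xrightarrow{a}ua$ (where $ua\in \mathrm{Pref}(W_S)$). Its ranks are the connected components of the graph on $W_S$ whose edges are the pairs $\{w,u\}$ with $(w,u,0)\in S$ or $(u,w,0)\in S$; the relation $\succeq_S$ on ranks is the reflexive transitive closure of $\{(C,C') : \exists w\in C, w'\in C', (w,w',1)\in S\}$; a state in $W_S$ has its component as rank, and the other states are unranked. For a partition $\pi$ of the states, the quotient $\mathrm{PT}_S/\pi$ has the blocks as states, a transition $B\xrightarrow{a}B'$ whenever $q\xrightarrow{a}q'$ for some $q\in B$, $q'\in B'$, and the rank of $B$ is that of its ranked elements, if any. Two ranks are compatible if they are equal or one of them is undefined. The determinization $D(\mathrm{PT}_S/\pi)$ is computed recursively: if there are blocks $B_i\ne B_j$ reached from the same block by the same letter, pick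 such a pair; if their ranks are compatible, continue with the partition in which $B_i,B_j$ are joined, and otherwise the result is $\varnothing$; if there is no such pair, the result is $\mathrm{PT}_S/\pi$. Let $u_0=\epsilon<_Lu_1<_L\dots<_Lu_n$ be the elements of $\mathrm{Pref}(W_S)$, and order the blocks of a partition by their $<_L$-least elements. LearnPDFA starts with the partition into singletons and, for $i=1,\dots,n$, proceeds as follows: if $u_i$ is the least element of its block $B_i$, it goes through the blocks $B<_LB_i$ in ascending order, and at the first $B$ whose rank is compatible with that of $B_i$ and for which joining $B$ and $B_i$ followed by determinization does not give $\varnothing$, it replaces the partition by the resulting one. It returns the final partition $\pi_r$ and the automaton $\mathcal A_r=\mathrm{PT}_S/\pi_r$. **Theorem.** Let $\mathcal A$ be a canonical PDFA, and let $S$ be a sample that is drawn from $\mathcal A$ and characteristic. Then LearnPDFA terminates on $S$ and, whatever choices are made in the determinizations, the returned automaton $\mathcal A_r$ is isomorphic to $\mathcal A$: there are a bijection $g$ from its states onto $Q$ and a bijection $h$ from its ranks onto $O$ such that $g$ maps the initial state to $q_0$; $B\xrightarrow{a}B'$ holds if and only if $\delta(g(B),a)=g(B')$; the rank of each $B$ is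 defined and $h$ maps it to $\lambda(g(B))$; and $o\succeq_S o'$ holds if and only if $h(o)\succeq h(o')$. Moreover, LearnPDFA can be implemented to run in time $O(m^3|\Sigma|^2+|S|^3)$ on such samples: there are a program for the random access machine (unit-cost addition, subtraction, tests and array accesses on natural numbers) and a constant $C$, both independent of $\Sigma$, $S$ and $\mathcal A$, such that the program, given $|\Sigma|$ and a list of the triples of any nonempty sample $S$, halts with the partition and the automaton returned by LearnPDFA on $S$, and it takes at most $C\,(m^3|\Sigma|^2+|S|^3)$ steps if $S$ is drawn from some canonical PDFA and is characteristic for it. -/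

import Mathlib

/-! ### Words -/

/-- The ordering `<_L` of words: shorter words come first, words of equal length are compared
lexicographically. -/
def WordLT {σ : Type*} [LinearOrder σ] (u v : List σ) : Prop :=
  List.Shortlex (· < ·) u v

/-! ### Preference automata -/

/-- A preference deterministic finite automaton with states `Q` and ranks `O`; the partial order
`⪰` on the ranks is `≥`. Finiteness of `Q` is assumed where it is used; that of `O` follows from
the surjectivity of the ranking. -/
structure PDFA (σ : Type*) (Q : Type*) (O : Type*) [PartialOrder O] where
  step : Q → σ → Q
  start : Q
  rank : Q → O
  rank_surjective : Function.Surjective rank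

namespace PDFA

variable {σ Q O : Type*} [PartialOrder O]

/-- The state reached from the initial state by reading a word. -/
def eval (A : PDFA σ Q O) (w : List σ) : Q :=
  w.foldl A.step A.start

/-- The rank of a word. -/
def wordRank (A : PDFA σ Q O) (w : List σ) : O :=
  A.rank (A.eval w)

/-- `w ∼ w'`. -/
def Indifferent (A : PDFA σ Q O) (w w' : List σ) : Prop :=
  A.wordRank w = A.wordRank w'

/-- `w ≻ w'`. -/
def StrictlyPrefers (A : PDFA σ Q O) (w w' : List σ) : Prop :=
  A.wordRank w > A.wordRank w'

/-- Neither word is weakly preferred to the other one. -/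
def Incomparable (A : PDFA σ Q O) (w w' : List σ) : Prop :=
  ¬ A.wordRank w ≥ A.wordRank w' ∧ ¬ A.wordRank w' ≥ A.wordRank w

/-- Two automata are equivalent if they encode the same preorder on words. -/
def Equivalent {Q' O' : Type*} [PartialOrder O'] (A : PDFA σ Q O) (A' : PDFA σ Q' O') : Prop :=
  ∀ w₁ w₂ : List σ,
    (A.Indifferent w₁ w₂ ↔ A'.Indifferent w₁ w₂) ∧
    (A.StrictlyPrefers w₁ w₂ ↔ A'.StrictlyPrefers w₁ w₂) ∧
    (A.StrictlyPrefers w₂ w₁ ↔ A'.StrictlyPrefers w₂ w₁)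

/-- A finite automaton is canonical if no equivalent finite automaton has fewer states. -/
def IsCanonical (A : PDFA σ Q O) : Prop :=
  Finite Q ∧
    ∀ (Q' O' : Type) [Finite Q'] [PartialOrder O'] (A' : PDFA σ Q' O'),
      A.Equivalent A' → Nat.card Q ≤ Nat.card Q'

end PDFA

/-! ### Samples -/

/-- The labels `0`, `1` and `⊥` of a comparison. -/
inductive Comparison
  | indifferent
  | strict
  | incomparable
  deriving DecidableEq

/-- A preference sample. -/
abbrev Sample (σ : Type*) := Finset (List σ × List σ × Comparison)

namespace Sample

variable {σ : Type*} [LinearOrder σ]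

/-- The set `W_S` of the words that appear in the sample. -/
def words (S : Sample σ) : Finset (List σ) :=
  S.image (fun x => x.1) ∪ S.image (fun x => x.2.1)

/-- The total length `m` of the words that appear in the sample. -/
def totalLength (S : Sample σ) : ℕ :=
  ∑ w ∈ S.words, w.length

/-- `Pref(W_S)`. -/
def prefixes (S : Sample σ) : Set (List σ) :=
  {u | ∃ w ∈ S.words, u <+: w}

/-- The automaton and the sample are consistent with each other. -/
def Consistent {Q O : Type*} [PartialOrder O] (S : Sample σ) (A : PDFA σ Q O) : Prop :=
  ∀ w w' : List σ,
    ((w, w', Comparison.indifferent) ∈ S → A.Indifferent w w') ∧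
    ((w, w', Comparison.strict) ∈ S → A.StrictlyPrefers w w') ∧
    ((w, w', Comparison.incomparable) ∈ S → A.Incomparable w w')

/-- The transitive closure `S°` of a sample: `S.Closure w w' b` says `(w, w', b) ∈ S°`. -/
inductive Closure (S : Sample σ) : List σ → List σ → Comparison → Prop
  | base {w w' b} : (w, w', b) ∈ S → Closure S w w' b
  | refl {w} : w ∈ S.words → Closure S w w .indifferent
  | symm {w w' b} : b = .indifferent ∨ b = .incomparable →
      Closure S w w' b → Closure S w' w b
  | trans {w w' w'' b} : b = .indifferent ∨ b = .strict →
      Closure S w w' b → Closure S w' w'' b → Closure S w w'' b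
  | left {w w' w'' b} : b = .strict ∨ b = .incomparable →
      Closure S w w' .indifferent → Closure S w' w'' b → Closure S w w'' b
  | right {w w' w'' b} : b = .strict ∨ b = .incomparable →
      Closure S w w' b → Closure S w' w'' .indifferent → Closure S w w'' b

end Sample

namespace PDFA

variable {σ Q O : Type*} [LinearOrder σ] [PartialOrder O]

/-- `w` is the `<_L`-least word that reaches the state `q`. -/
def IsShortestPrefix (A : PDFA σ Q O) (q : Q) (w : List σ) : Prop :=
  A.eval w = q ∧ ∀ w' : List σ, A.eval w' = q → w' ≠ w → WordLT w w'

/-- The shortest prefixes of the states. -/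
def shortestPrefixes (A : PDFA σ Q O) : Set (List σ) :=
  {w | ∃ q, A.IsShortestPrefix q w}

/-- The nucleus. -/
def nucleus (A : PDFA σ Q O) : Set (List σ) :=
  {v | ∃ u ∈ A.shortestPrefixes, ∃ a : σ, v = u ++ [a]} ∪ {[]}

end PDFA

/-- The sample `S`, drawn from the automaton `A`, is characteristic. -/
structure Sample.IsCharacteristic {σ Q O : Type*} [LinearOrder σ] [PartialOrder O]
    (S : Sample σ) (A : PDFA σ Q O) : Prop where
  nucleus_subset : A.nucleus ⊆ S.prefixes
  distinguish : ∀ w ∈ A.shortestPrefixes, ∀ u ∈ A.nucleus, A.eval w ≠ A.eval u →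
    ∃ y : List σ, w ++ y ∈ S.words ∧ u ++ y ∈ S.words ∧
      (S.Closure (w ++ y) (u ++ y) .strict ∨ S.Closure (u ++ y) (w ++ y) .strict ∨
        S.Closure (w ++ y) (u ++ y) .incomparable)
  states_visited : ∀ q : Q, ∃ w ∈ S.words, A.eval w = q
  indifferent_mem : ∀ w ∈ S.words, ∀ u ∈ S.words,
    A.Indifferent w u → S.Closure w u .indifferent
  strict_mem : ∀ w ∈ S.words, ∀ u ∈ S.words,
    A.StrictlyPrefers w u → S.Closure w u .strict
  incomparable_not_mem : ∀ w ∈ S.words, ∀ u ∈ S.words, A.Incomparable w u →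
    ¬ S.Closure w u .indifferent ∧ ¬ S.Closure w u .strict ∧ ¬ S.Closure u w .strict

/-! ### Nondeterministic preference automata, quotients and determinization -/

/-- A preference nondeterministic finite automaton: the transition function is set-valued and the
ranking is partial (`none` is "undefined"). `ge` is the relation `⪰` on the ranks. -/
structure PNFA (σ : Type*) (Q : Type*) (O : Type*) where
  step : Q → σ → Set Q
  start : Q
  ge : O → O → Prop
  rank : Q → Option O

/-- Two ranks agree, or one of them is undefined. -/
def RankCompatible {O : Type*} (o o' : Option O) : Prop :=
  o = o' ∨ o = none ∨ o' = none

/-- The partition that arises from the partition `π` by joining the blocks `B` and `B'`. Partitions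
of `Q` are given by equivalence relations on `Q`, and their blocks are the elements of the
quotient. -/
def joinBlocks {Q : Type*} (π : Setoid Q) (B B' : Quotient π) : Setoid Q where
  r x y := π x y ∨
    ((Quotient.mk π x = B ∨ Quotient.mk π x = B') ∧ (Quotient.mk π y = B ∨ Quotient.mk π y = B'))
  iseqv := by
    refine ⟨fun x => Or.inl (π.refl x), ?_, ?_⟩
    · rintro x y (h | ⟨h, h'⟩)
      · exact Or.inl (π.symm h)
      · exact Or.inr ⟨h', h⟩
    · rintro x y z (h | ⟨h, h'⟩) (k | ⟨k, k'⟩)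
      · exact Or.inl (π.trans h k)
      · have e : Quotient.mk π x = Quotient.mk π y := Quotient.sound h
        exact Or.inr ⟨by rw [e]; exact k, k'⟩
      · have e : Quotient.mk π y = Quotient.mk π z := Quotient.sound k
        exact Or.inr ⟨h, by rw [← e]; exact h'⟩
      · exact Or.inr ⟨h, k'⟩

namespace PNFA

variable {σ Q O : Type*}

open Classical in
/-- The quotient of an automaton under a partition of its states. The rank of a block is the rank of
any of its ranked states; this is unambiguous if the partition is ranking-consistent. -/
noncomputable def quotient (M : PNFA σ Q O) (π : Setoid Q) : PNFA σ (Quotient π) O where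
  step B a := {B' | ∃ q q' : Q, Quotient.mk π q = B ∧ Quotient.mk π q' = B' ∧ q' ∈ M.step q a}
  start := Quotient.mk π M.start
  ge := M.ge
  rank B := if h : ∃ o : O, ∃ q : Q, Quotient.mk π q = B ∧ M.rank q = some o
    then some h.choose else none

/-- No state has two successors under the same letter. -/
def IsDeterministic (M : PNFA σ Q O) : Prop :=
  ∀ q a, (M.step q a).Subsingleton

/-- The recursive determinization of a quotient. `M.Determinizes π r` says that `D(M / π)` may
evaluate to `r`, where `none` is "undefined" and `some π'` stands for the automaton `M / π'`. The
order in which nondeterministic transitions are picked is left open. -/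
inductive Determinizes (M : PNFA σ Q O) : Setoid Q → Option (Setoid Q) → Prop
  | join {π : Setoid Q} {r : Option (Setoid Q)} (Bk Bi Bj : Quotient π) (a : σ) :
      Bi ∈ (M.quotient π).step Bk a → Bj ∈ (M.quotient π).step Bk a → Bi ≠ Bj →
      RankCompatible ((M.quotient π).rank Bi) ((M.quotient π).rank Bj) →
      Determinizes M (joinBlocks π Bi Bj) r → Determinizes M π r
  | conflict {π : Setoid Q} (Bk Bi Bj : Quotient π) (a : σ) :
      Bi ∈ (M.quotient π).step Bk a → Bj ∈ (M.quotient π).step Bk a → Bi ≠ Bj →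
      ¬ RankCompatible ((M.quotient π).rank Bi) ((M.quotient π).rank Bj) →
      Determinizes M π none
  | done {π : Setoid Q} : (M.quotient π).IsDeterministic → Determinizes M π (some π)

/-- The automaton `M` is isomorphic to the deterministic automaton `A`: the states, the transitions,
the ranking and the order of the ranks match. -/
def IsIsomorphic {Q' O' : Type*} [PartialOrder O'] (M : PNFA σ Q O) (A : PDFA σ Q' O') : Prop :=
  ∃ (g : Q ≃ Q') (h : O ≃ O'),
    g M.start = A.start ∧
    (∀ B a B', B' ∈ M.step B a ↔ A.step (g B) a = g B') ∧
    (∀ B, (M.rank B).map h = some (A.rank (g B))) ∧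
    (∀ o o', M.ge o o' ↔ h o ≥ h o')

end PNFA

/-! ### The prefix tree automaton -/

namespace Sample

variable {σ : Type*} [LinearOrder σ]

/-- The indifference graph on the words of the sample (loops do not matter for its components). -/
def indifferenceGraph (S : Sample σ) : SimpleGraph S.words :=
  SimpleGraph.fromRel fun w u => (w.1, u.1, Comparison.indifferent) ∈ S

/-- The ranks of the prefix tree automaton: the connected components of the indifference graph. -/
abbrev Ranks (S : Sample σ) := S.indifferenceGraph.ConnectedComponent

/-- The relation `R_S` on the components. -/
def rankRel (S : Sample σ) (c c' : S.Ranks) : Prop :=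
  ∃ w w' : S.words, S.indifferenceGraph.connectedComponentMk w = c ∧
    S.indifferenceGraph.connectedComponentMk w' = c' ∧ (w.1, w'.1, Comparison.strict) ∈ S

/-- The prefix tree automaton; a nonempty sample is needed for `ε` to be one of its states. -/
def prefixTree (S : Sample σ) (hS : S.Nonempty) : PNFA σ S.prefixes S.Ranks where
  step u a := {v | v.1 = u.1 ++ [a]}
  start := ⟨[], by
    obtain ⟨x, hx⟩ := hS
    exact ⟨x.1, Finset.mem_union_left _ (Finset.mem_image_of_mem _ hx), List.nil_prefix⟩⟩
  ge := Relation.ReflTransGen S.rankRel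
  rank u := if h : u.1 ∈ S.words then some (S.indifferenceGraph.connectedComponentMk ⟨u.1, h⟩)
    else none

/-! ### The algorithm `LearnPDFA` -/

/-- `u = η(B)`: the word `u` is the `<_L`-least element of the block `B`. -/
def IsBlockName (S : Sample σ) {π : Setoid S.prefixes} (B : Quotient π) (u : S.prefixes) : Prop :=
  Quotient.mk π u = B ∧ ∀ v : S.prefixes, Quotient.mk π v = B → ¬ WordLT v.1 u.1

/-- The ordering of blocks by their names. -/
def BlockLT (S : Sample σ) {π : Setoid S.prefixes} (B B' : Quotient π) : Prop :=
  ∃ u u' : S.prefixes, S.IsBlockName B u ∧ S.IsBlockName B' u' ∧ WordLT u.1 u'.1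

/-- The attempt to join `B` and `B'` is accepted, with the resulting partition `π'`. -/
def Accepts (S : Sample σ) (hS : S.Nonempty) (π : Setoid S.prefixes) (B B' : Quotient π)
    (π' : Setoid S.prefixes) : Prop :=
  RankCompatible (((S.prefixTree hS).quotient π).rank B) (((S.prefixTree hS).quotient π).rank B') ∧
    (S.prefixTree hS).Determinizes (joinBlocks π B B') (some π')

/-- The attempt to join `B` and `B'` is rejected. -/
def Rejects (S : Sample σ) (hS : S.Nonempty) (π : Setoid S.prefixes) (B B' : Quotient π) : Prop :=
  RankCompatible (((S.prefixTree hS).quotient π).rank B) (((S.prefixTree hS).quotient π).rank B') →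
    (S.prefixTree hS).Determinizes (joinBlocks π B B') none

/-- One iteration of the outer loop, for the prefix `u`: if `u` is the name of its block `B`, then
the blocks below `B` are tried in ascending order and the first successful join is carried out. -/
inductive LearnStep (S : Sample σ) (hS : S.Nonempty) (u : S.prefixes) (π : Setoid S.prefixes) :
    Setoid S.prefixes → Prop
  | not_name : ¬ S.IsBlockName (Quotient.mk π u) u → LearnStep S hS u π π
  | merged (B : Quotient π) (π' : Setoid S.prefixes) :
      S.IsBlockName (Quotient.mk π u) u → S.BlockLT B (Quotient.mk π u) →
      (∀ B' : Quotient π, S.BlockLT B' B → S.Rejects hS π B' (Quotient.mk π u)) →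
      S.Accepts hS π B (Quotient.mk π u) π' → LearnStep S hS u π π'
  | not_merged : S.IsBlockName (Quotient.mk π u) u →
      (∀ B' : Quotient π, S.BlockLT B' (Quotient.mk π u) →
        S.Rejects hS π B' (Quotient.mk π u)) → LearnStep S hS u π π

/-- The outer loop over a list of prefixes. -/
inductive LearnLoop (S : Sample σ) (hS : S.Nonempty) :
    List S.prefixes → Setoid S.prefixes → Setoid S.prefixes → Prop
  | nil {π} : LearnLoop S hS [] π π
  | cons {u us π π' π''} : S.LearnStep hS u π π' → LearnLoop S hS us π' π'' →
      LearnLoop S hS (u :: us) π π''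

/-- `LearnPDFA` can return the partition `π`, and with it the quotient of the prefix tree automaton
under `π`: starting with the partition into singletons, the outer loop runs through the prefixes
`u₁ <_L u₂ <_L ⋯` other than `u₀ = ε`. -/
def LearnPDFA (S : Sample σ) (hS : S.Nonempty) (π : Setoid S.prefixes) : Prop :=
  ∃ us : List S.prefixes, us.Pairwise (fun u v => WordLT u.1 v.1) ∧ (∀ u, u ∈ us) ∧
    S.LearnLoop hS us.tail ⊥ π

end Sample

/-! ### A random access machine

Programs of a structured random access machine with finitely many registers and arrays of natural
numbers. The arithmetic operations are addition and truncated subtraction; every operation, every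
register access, every array access and every test takes one step. -/

namespace RAM

/-- `reg x` is the register `x`, and `mem a i` is the cell `i` of the array `a`. -/
structure State where
  reg : ℕ → ℕ
  mem : ℕ → ℕ → ℕ

inductive Expr
  | lit (n : ℕ)
  | reg (x : ℕ)
  | get (a : ℕ) (i : Expr)
  | add (e f : Expr)
  | sub (e f : Expr)

def Expr.eval (s : State) : Expr → ℕ
  | .lit n => n
  | .reg x => s.reg x
  | .get a i => s.mem a (i.eval s)
  | .add e f => e.eval s + f.eval s
  | .sub e f => e.eval s - f.eval s

def Expr.cost : Expr → ℕ
  | .lit _ => 1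
  | .reg _ => 1
  | .get _ i => i.cost + 1
  | .add e f => e.cost + f.cost + 1
  | .sub e f => e.cost + f.cost + 1

/-- Programs. A test succeeds if the value of the expression is not `0`. -/
inductive Program
  | skip
  | set (x : ℕ) (e : Expr)
  | put (a : ℕ) (i e : Expr)
  | seq (p q : Program)
  | cond (e : Expr) (p q : Program)
  | loop (e : Expr) (p : Program)

def State.setReg (s : State) (x v : ℕ) : State :=
  { s with reg := Function.update s.reg x v }

def State.setMem (s : State) (a i v : ℕ) : State :=
  { s with mem := Function.update s.mem a (Function.update (s.mem a) i v) }

/-- `Exec p s s' t`: the program `p`, started in the state `s`, halts in the state `s'` after `t`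
steps. -/
inductive Exec : Program → State → State → ℕ → Prop
  | skip {s} : Exec .skip s s 1
  | set {x e s} : Exec (.set x e) s (s.setReg x (e.eval s)) (e.cost + 1)
  | put {a i e s} : Exec (.put a i e) s (s.setMem a (i.eval s) (e.eval s)) (i.cost + e.cost + 1)
  | seq {p q s s' s'' t t'} : Exec p s s' t → Exec q s' s'' t' → Exec (.seq p q) s s'' (t + t')
  | cond_true {e p q s s' t} : e.eval s ≠ 0 → Exec p s s' t →
      Exec (.cond e p q) s s' (e.cost + 1 + t)
  | cond_false {e p q s s' t} : e.eval s = 0 → Exec q s s' t →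
      Exec (.cond e p q) s s' (e.cost + 1 + t)
  | loop_true {e p s s' s'' t t'} : e.eval s ≠ 0 → Exec p s s' t → Exec (.loop e p) s' s'' t' →
      Exec (.loop e p) s s'' (e.cost + 1 + t + t')
  | loop_false {e p s} : e.eval s = 0 → Exec (.loop e p) s s (e.cost + 1)

/-- The initial state: the input stands in the array `0`, everything else is `0`. -/
def State.init (input : List ℕ) : State where
  reg _ := 0
  mem a i := if a = 0 then input.getD i 0 else 0

end RAM

/-! ### Input and output of the machine -/

/-- The letters are numbered `0, 1, …` in ascending order. -/
def letterCode {σ : Type*} [Fintype σ] [LinearOrder σ] (a : σ) : ℕ :=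
  (Finset.univ.filter (· < a)).card

/-- A word is written as its length followed by its letters. -/
def wordCode {σ : Type*} [Fintype σ] [LinearOrder σ] (w : List σ) : List ℕ :=
  w.length :: w.map letterCode

def Comparison.code : Comparison → ℕ
  | .indifferent => 0
  | .strict => 1
  | .incomparable => 2

/-- The input for a sample that is given as a list of triples: the size of the alphabet, the number
of triples, and the triples one after the other. -/
def sampleCode {σ : Type*} [Fintype σ] [LinearOrder σ]
    (l : List (List σ × List σ × Comparison)) : List ℕ :=
  Fintype.card σ :: l.length ::
    l.flatMap fun x => x.2.2.code :: (wordCode x.1 ++ wordCode x.2.1)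

/-- The final state `s` of the machine contains the partition `π` of the prefixes and the quotient of
the prefix tree automaton under `π`, with respect to some numbering of the blocks and the ranks:
registers `0`, `1` and `2` hold the number of states, the number of ranks and the initial state;
arrays `1`, `2` and `3` are the tables of the transitions, of the ranking (in both tables `0` is
"undefined" and other entries are shifted by one) and of the order of the ranks; and array `4` maps
the position of a prefix in the ordering `<_L` of all prefixes to the number of its block. -/
def OutputsLearned {σ : Type*} [Fintype σ] [LinearOrder σ] (S : Sample σ) (hS : S.Nonempty)
    (π : Setoid S.prefixes) (s : RAM.State) : Prop :=
  ∃ (e : Quotient π ≃ Fin (s.reg 0)) (f : S.Ranks ≃ Fin (s.reg 1)),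
    s.reg 2 = e ((S.prefixTree hS).quotient π).start ∧
    (∀ (B : Quotient π) (a : σ),
      (∀ B' ∈ ((S.prefixTree hS).quotient π).step B a,
        s.mem 1 ((e B : ℕ) * Fintype.card σ + letterCode a) = (e B' : ℕ) + 1) ∧
      (((S.prefixTree hS).quotient π).step B a = ∅ →
        s.mem 1 ((e B : ℕ) * Fintype.card σ + letterCode a) = 0)) ∧
    (∀ B : Quotient π,
      (∀ o, ((S.prefixTree hS).quotient π).rank B = some o → s.mem 2 (e B) = (f o : ℕ) + 1) ∧
      (((S.prefixTree hS).quotient π).rank B = none → s.mem 2 (e B) = 0)) ∧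
    (∀ o o' : S.Ranks,
      ((S.prefixTree hS).ge o o' → s.mem 3 ((f o : ℕ) * s.reg 1 + f o') = 1) ∧
      (¬ (S.prefixTree hS).ge o o' → s.mem 3 ((f o : ℕ) * s.reg 1 + f o') = 0)) ∧
    (∀ u : S.prefixes,
      s.mem 4 (Set.ncard {v : S.prefixes | WordLT v.1 u.1}) = e (Quotient.mk π u))

/-! ### The ordering of words -/

section WordOrder

variable {σ : Type*} [LinearOrder σ]

/-! Correctness. Two properties of a partition of the prefixes matter: `DetCongr` (the quotient is
deterministic) and `RankCons` (no block contains two ranks). Every join made by a determinization is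
forced in each deterministic partition above the current one. Hence, whatever the choices, it ends
with the least deterministic partition above its starting point, or with a clash that shows that no
deterministic partition above is rank-consistent (`Determinizes.spec`). Acceptance and rejection of
a join thereby become statements about the lattice of partitions (`accepts_iff`, `rejects_iff`), in
which the choices no longer occur.

Let `evalSetoid` relate the prefixes that lead to the same state of the automaton. On a
characteristic sample it is deterministic and rank-consistent. The outer loop maintains a
deterministic partition below `evalSetoid` in which every prefix dealt with lies in the block of the
shortest prefix of its state (`LoopInv`). If the current prefix `u` is the name of its block, it
belongs to the nucleus, and the blocks tried for it are named by shortest prefixes. A wrong join is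
never accepted, because a distinguishing continuation carries it to two words of different rank
(`IsCharacteristic.not_rankCons`). The right join is never rejected, because `evalSetoid` itself is
a rank-consistent deterministic partition above it; and its result stays below `evalSetoid` by
minimality (`LoopInv.step`). At the end the partition is `evalSetoid`, and its quotient is the
automaton (`isIsomorphic_evalSetoid`).

Running time. The machine does not imitate the joins. It recomputes a partition from scratch by a
run: the prefixes are scanned along `<_L`, each one follows a transition that is already known, and
otherwise goes into the block prescribed by its target, or into a new one. The partition of a run is
the least deterministic one with the prescribed coincidences (`RunAt.ker_le`), so a run with one
additional target `q` for the prefix `i` yields what determinization aims at after joining `i` with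
block `q` (`RunAt.isLeast`). Trying `q = 0, 1, …` until the ranks agree is one iteration of the
outer loop (`RunAt.learnStep`).

With `N ≤ m + 1` prefixes and `k` letters a run costs `O(N k)`. There are `N` prefixes and at most
`N + 1` targets for each, which gives `O(N³ k)`. The order of the at most `2|S|` ranks is maintained
as a reflexive and transitive relation under insertion of edges, in `O(|S|²)` per triple. Reading
the input and finding the components take `O(|S| m)` and `O(|S| N)`, which is absorbed by `m³ +
|S|³` apart from the degenerate case `m = 0`, where a characteristic sample forces the alphabet to
be empty. -/

theorem WordLT.irrefl (u : List σ) : ¬ WordLT u u := by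
  intro h
  exact Std.Asymm.asymm (r := List.Shortlex ((· < ·) : σ → σ → Prop)) _ _ h h

theorem WordLT.asymm {u v : List σ} (h : WordLT u v) : ¬ WordLT v u :=
  Std.Asymm.asymm (r := List.Shortlex ((· < ·) : σ → σ → Prop)) _ _ h

theorem WordLT.trans {u v w : List σ} (h : WordLT u v) (h' : WordLT v w) : WordLT u w := by
  rw [WordLT, List.shortlex_def] at *
  rcases h with h | ⟨h, k⟩ <;> rcases h' with h' | ⟨h', k'⟩
  · left; omega
  · left; omega
  · left; omega
  · exact Or.inr ⟨by omega, lt_trans (α := List σ) k k'⟩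

theorem WordLT.trichotomy (u v : List σ) : WordLT u v ∨ u = v ∨ WordLT v u := by
  by_contra! h
  exact h.2.1 (Std.Trichotomous.trichotomous (r := List.Shortlex ((· < ·) : σ → σ → Prop))
    u v h.1 h.2.2)

theorem WordLT.ne {u v : List σ} (h : WordLT u v) : u ≠ v := by
  rintro rfl
  exact WordLT.irrefl _ h

theorem WordLT.wellFounded [Finite σ] : WellFounded (WordLT (σ := σ)) :=
  List.Shortlex.wf wellFounded_lt

theorem List.Lex.append_append {α : Type*} {r : α → α → Prop} {u v : List α}
    (h : List.Lex r u v) (hl : u.length = v.length) (x y : List α) :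
    List.Lex r (u ++ x) (v ++ y) := by
  induction h with
  | nil => simp at hl
  | rel h => exact List.Lex.rel h
  | cons h ih => exact List.Lex.cons (ih (by simpa using hl))

/-- This monotonicity is what makes shortest prefixes closed under prefixes, and what lets a
breadth-first search produce the words in the order `<_L`. -/
theorem WordLT.snoc_snoc {u v : List σ} (h : WordLT u v) (a b : σ) :
    WordLT (u ++ [a]) (v ++ [b]) := by
  rw [WordLT, List.shortlex_def] at *
  rcases h with h | ⟨h, k⟩
  · left; simpa using h
  · exact Or.inr ⟨by simpa using h, k.append_append h _ _⟩

theorem WordLT.snoc_letter {a b : σ} (h : a < b) (u : List σ) : WordLT (u ++ [a]) (u ++ [b]) :=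
  List.Shortlex.append_left ((List.shortlex_singleton_iff a b).2 h) u

theorem WordLT.nil_snoc (u : List σ) (a : σ) : WordLT [] (u ++ [a]) :=
  List.Shortlex.of_length_lt (by simp)

theorem WordLT.not_nil (u : List σ) : ¬ WordLT u [] := List.not_shortlex_nil_right

theorem WordLT.self_snoc (u : List σ) (a : σ) : WordLT u (u ++ [a]) :=
  List.Shortlex.of_length_lt (by simp)

theorem WordLT.of_snoc_snoc {u v : List σ} {a b : σ} (h : WordLT (u ++ [a]) (v ++ [b])) :
    WordLT u v ∨ u = v ∧ a < b := by
  rcases WordLT.trichotomy u v with k | rfl | k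
  · exact Or.inl k
  · refine Or.inr ⟨rfl, ?_⟩
    rcases lt_trichotomy a b with l | rfl | l
    · exact l
    · exact absurd h (WordLT.irrefl _)
    · exact absurd h (WordLT.snoc_letter l u).asymm
  · exact absurd h (k.snoc_snoc b a).asymm

end WordOrder

/-! ### Determinization -/

namespace PNFA

variable {σ Q O : Type*} (M : PNFA σ Q O)

/-- The quotient under the partition is deterministic. -/
def DetCongr (π : Setoid Q) : Prop :=
  ∀ x y z v a, π x y → z ∈ M.step x a → v ∈ M.step y a → π z v

/-- All ranked states of a block have the same rank. -/
def RankCons (π : Setoid Q) : Prop :=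
  ∀ x y o o', π x y → M.rank x = some o → M.rank y = some o' → o = o'

variable {M}

theorem RankCons.mono {π ρ : Setoid Q} (h : M.RankCons ρ) (hle : π ≤ ρ) : M.RankCons π :=
  fun x y o o' hxy => h x y o o' (hle hxy)

theorem isDeterministic_quotient {π : Setoid Q} :
    (M.quotient π).IsDeterministic ↔ M.DetCongr π := by
  constructor
  · intro h x y x' y' a hxy hx hy
    have e : Quotient.mk π x = Quotient.mk π y := Quotient.sound hxy
    exact Quotient.exact (h (Quotient.mk π x) a ⟨x, x', rfl, rfl, hx⟩ ⟨y, y', e.symm, rfl, hy⟩)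
  · rintro h B a _ ⟨x, x', rfl, rfl, hx⟩ _ ⟨y, y', e, rfl, hy⟩
    exact Quotient.sound (h x y x' y' a (Quotient.exact e.symm) hx hy)

/-- The rank of a block in the quotient is chosen among the ranks of its elements; consistency makes
the choice irrelevant. -/
theorem RankCons.rank_quotient {π : Setoid Q} (h : M.RankCons π) {x : Q} {o : O} :
    (M.quotient π).rank (Quotient.mk π x) = some o ↔ ∃ y, π x y ∧ M.rank y = some o := by
  classical
  unfold quotient
  simp only
  constructor
  · intro k
    split_ifs at k with hk
    obtain ⟨y, hy, hy'⟩ := hk.choose_spec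
    exact ⟨y, Quotient.exact hy.symm, by rw [hy', ← k]⟩
  · rintro ⟨y, hy, hy'⟩
    have hk : ∃ o, ∃ q, Quotient.mk π q = Quotient.mk π x ∧ M.rank q = some o :=
      ⟨o, y, (Quotient.sound hy).symm, hy'⟩
    rw [dif_pos hk]
    obtain ⟨z, hz, hz'⟩ := hk.choose_spec
    exact congrArg some (h z y _ _ (π.trans (Quotient.exact hz) hy) hz' hy')

theorem RankCons.rank_quotient_eq_none {π : Setoid Q} (h : M.RankCons π) {x : Q} :
    (M.quotient π).rank (Quotient.mk π x) = none ↔ ∀ y, π x y → M.rank y = none := by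
  rw [Option.eq_none_iff_forall_ne_some]
  simp only [ne_eq, h.rank_quotient, not_exists, not_and]
  constructor
  · intro k y hy
    exact Option.eq_none_iff_forall_ne_some.2 fun o ho => k o y hy ho
  · intro k o y hy
    simp [k y hy]

theorem le_joinBlocks (π : Setoid Q) (B B' : Quotient π) : π ≤ joinBlocks π B B' :=
  fun _ _ h => Or.inl h

theorem joinBlocks_le_iff {π ρ : Setoid Q} {x y : Q} :
    joinBlocks π (Quotient.mk π x) (Quotient.mk π y) ≤ ρ ↔ π ≤ ρ ∧ ρ x y := by
  constructor
  · intro h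
    exact ⟨(le_joinBlocks _ _ _).trans h, h (Or.inr ⟨Or.inl rfl, Or.inr rfl⟩)⟩
  · rintro ⟨h, hxy⟩ u v (k | ⟨k, k'⟩)
    · exact h k
    · have key : ∀ w, Quotient.mk π w = Quotient.mk π x ∨ Quotient.mk π w = Quotient.mk π y →
          ρ w x := by
        rintro w (e | e)
        · exact h (Quotient.exact e)
        · exact ρ.trans (h (Quotient.exact e)) (ρ.symm hxy)
      exact ρ.trans (key u k) (ρ.symm (key v k'))

/-- The only pairs that a join newly relates run between the two blocks, so the test on two ranks
decides whether consistency survives. -/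
theorem RankCons.compatible_iff {π : Setoid Q} (h : M.RankCons π) (B B' : Quotient π) :
    RankCompatible ((M.quotient π).rank B) ((M.quotient π).rank B') ↔
      M.RankCons (joinBlocks π B B') := by
  obtain ⟨x, rfl⟩ := Quotient.exists_rep B
  obtain ⟨y, rfl⟩ := Quotient.exists_rep B'
  constructor
  · intro hc u v o o' huv hu hv
    have key : ∀ u v o o', Quotient.mk π u = Quotient.mk π x → Quotient.mk π v = Quotient.mk π y →
        M.rank u = some o → M.rank v = some o' → o = o' := by
      intro u v o o' eu ev hu hv
      have h1 := h.rank_quotient.2 ⟨u, π.symm (Quotient.exact eu), hu⟩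
      have h2 := h.rank_quotient.2 ⟨v, π.symm (Quotient.exact ev), hv⟩
      rw [RankCompatible] at hc
      rw [show (⟦x⟧ : Quotient π) = Quotient.mk π x from rfl,
        show (⟦y⟧ : Quotient π) = Quotient.mk π y from rfl, h1, h2] at hc
      simpa using hc
    rcases huv with k | ⟨k | k, k' | k'⟩
    · exact h u v o o' k hu hv
    · exact h u v o o' (Quotient.exact (k.trans k'.symm)) hu hv
    · exact key u v o o' k k' hu hv
    · exact (key v u o' o k' k hv hu).symm
    · exact h u v o o' (Quotient.exact (k.trans k'.symm)) hu hv
  · intro hc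
    by_contra hn
    rw [RankCompatible] at hn
    push Not at hn
    obtain ⟨h0, h1, h2⟩ := hn
    obtain ⟨o, ho⟩ := Option.ne_none_iff_exists'.1 h1
    obtain ⟨o', ho'⟩ := Option.ne_none_iff_exists'.1 h2
    obtain ⟨u, hu, hu'⟩ := h.rank_quotient.1 ho
    obtain ⟨v, hv, hv'⟩ := h.rank_quotient.1 ho'
    refine h0 ?_
    rw [ho, ho', hc u v o o' (Or.inr ⟨Or.inl (Quotient.sound hu).symm,
      Or.inr (Quotient.sound hv).symm⟩) hu' hv']

/-- What the determinization of a partition may evaluate to. -/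
theorem Determinizes.spec {π : Setoid Q} {r : Option (Setoid Q)} (h : M.Determinizes π r)
    (hπ : M.RankCons π) :
    (∀ π', r = some π' → IsLeast {ρ | π ≤ ρ ∧ M.DetCongr ρ} π' ∧ M.RankCons π') ∧
      (r = none → ∀ ρ, π ≤ ρ → M.DetCongr ρ → ¬ M.RankCons ρ) := by
  -- Joins are forced: the two blocks contain successors of related states under the same letter,
  -- and a deterministic partition above must relate these.
  have key : ∀ {π : Setoid Q} {Bk Bi Bj : Quotient π} {a : σ},
      Bi ∈ (M.quotient π).step Bk a → Bj ∈ (M.quotient π).step Bk a →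
      ∀ ρ, π ≤ ρ → M.DetCongr ρ → joinBlocks π Bi Bj ≤ ρ := by
    rintro π Bk Bi Bj a ⟨x, x', rfl, rfl, hx⟩ ⟨y, y', e, rfl, hy⟩ ρ hρ hd
    exact joinBlocks_le_iff.2 ⟨hρ, hd x y x' y' a (hρ (Quotient.exact e.symm)) hx hy⟩
  induction h with
  | join Bk Bi Bj a hi hj hne hc _ ih =>
    obtain ⟨h1, h2⟩ := ih ((hπ.compatible_iff Bi Bj).1 hc)
    refine ⟨fun π' e => ?_, fun e ρ hρ hd => h2 e ρ (key hi hj ρ hρ hd) hd⟩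
    obtain ⟨⟨⟨k1, k2⟩, k3⟩, k4⟩ := h1 π' e
    exact ⟨⟨⟨(le_joinBlocks _ _ _).trans k1, k2⟩,
      fun ρ hρ => k3 ⟨key hi hj ρ hρ.1 hρ.2, hρ.2⟩⟩, k4⟩
  -- A rank-consistent deterministic partition above would contain the forced join, so its
  -- consistency would pass down to the join and make the two ranks compatible.
  | conflict Bk Bi Bj a hi hj hne hc =>
    refine ⟨by simp, fun _ ρ hρ hd hcons => hc ?_⟩
    exact (hπ.compatible_iff Bi Bj).2 (hcons.mono (key hi hj ρ hρ hd))
  | done hdet =>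
    refine ⟨fun π' e => ?_, by simp⟩
    cases e
    exact ⟨⟨⟨le_rfl, isDeterministic_quotient.1 hdet⟩, fun ρ hρ => hρ.1⟩, hπ⟩

/-- Each join makes the partition strictly coarser, and there are only finitely many partitions, so
the recursion ends. -/
theorem Determinizes.exists [Finite Q] (π : Setoid Q) : ∃ r, M.Determinizes π r := by
  have : Finite (Setoid Q) := Finite.of_injective (fun π : Setoid Q => (fun x y => π x y))
    fun π ρ h => Setoid.ext fun x y => iff_of_eq (congrFun (congrFun h x) y)
  induction π using (wellFounded_gt (α := Setoid Q)).induction with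
  | _ π ih =>
    by_cases hd : (M.quotient π).IsDeterministic
    · exact ⟨_, .done hd⟩
    · unfold IsDeterministic Set.Subsingleton at hd
      push Not at hd
      obtain ⟨Bk, a, Bi, hi, Bj, hj, hne⟩ := hd
      by_cases hc : RankCompatible ((M.quotient π).rank Bi) ((M.quotient π).rank Bj)
      · obtain ⟨x, rfl⟩ := Quotient.exists_rep Bi
        obtain ⟨y, rfl⟩ := Quotient.exists_rep Bj
        have hlt : π < joinBlocks π ⟦x⟧ ⟦y⟧ := by
          refine lt_of_le_of_ne (le_joinBlocks _ _ _) fun e => hne (Quotient.sound ?_)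
          have : joinBlocks π ⟦x⟧ ⟦y⟧ x y := Or.inr ⟨Or.inl rfl, Or.inr rfl⟩
          rwa [← e] at this
        obtain ⟨r, hr⟩ := ih _ hlt
        exact ⟨r, .join Bk _ _ a hi hj hne hc hr⟩
      · exact ⟨_, .conflict Bk _ _ a hi hj hne hc⟩

end PNFA

/-! ### Prefixes of a sample, and the outcome of a join -/

namespace Sample

variable {σ : Type*} [LinearOrder σ] (S : Sample σ)

/-- The set of prefixes as a `Finset`. -/
def prefixFinset : Finset (List σ) := S.words.biUnion fun w => w.inits.toFinset

variable {S}

theorem mem_prefixFinset {u : List σ} : u ∈ S.prefixFinset ↔ u ∈ S.prefixes := by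
  simp [prefixFinset, prefixes]

instance : Finite S.prefixes :=
  (S.prefixFinset.finite_toSet.subset fun _ h => mem_prefixFinset.2 h).to_subtype

theorem words_subset_prefixes {w : List σ} (h : w ∈ S.words) : w ∈ S.prefixes :=
  ⟨w, h, List.prefix_rfl⟩

theorem prefixes_of_append {u v : List σ} (h : u ++ v ∈ S.prefixes) : u ∈ S.prefixes := by
  obtain ⟨w, hw, h⟩ := h
  exact ⟨w, hw, (List.prefix_append u v).trans h⟩

theorem nil_mem_prefixes (hS : S.Nonempty) : [] ∈ S.prefixes := (S.prefixTree hS).start.2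

theorem mem_words_left {w w' : List σ} {b : Comparison} (h : (w, w', b) ∈ S) : w ∈ S.words :=
  Finset.mem_union_left _ (Finset.mem_image_of_mem _ h)

theorem mem_words_right {w w' : List σ} {b : Comparison} (h : (w, w', b) ∈ S) : w' ∈ S.words :=
  Finset.mem_union_right _ (Finset.mem_image_of_mem (fun x => x.2.1) h)

variable {hS : S.Nonempty}

/-- The right-hand side does not mention the determinization, so the accepted partition is unique
and independent of the choices made. -/
theorem accepts_iff {π π' : Setoid S.prefixes} (hπ : (S.prefixTree hS).RankCons π)
    {x y : S.prefixes} :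
    S.Accepts hS π (Quotient.mk π x) (Quotient.mk π y) π' ↔
      IsLeast {ρ | (π ≤ ρ ∧ ρ x y) ∧ (S.prefixTree hS).DetCongr ρ} π' ∧
        (S.prefixTree hS).RankCons π' := by
  simp only [← PNFA.joinBlocks_le_iff]
  constructor
  · rintro ⟨h1, h2⟩
    exact (h2.spec ((hπ.compatible_iff _ _).1 h1)).1 _ rfl
  · rintro ⟨h1, h2⟩
    have hj := h2.mono h1.1.1
    refine ⟨(hπ.compatible_iff _ _).2 hj, ?_⟩
    obtain ⟨r, hr⟩ := PNFA.Determinizes.exists (M := S.prefixTree hS)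
      (joinBlocks π (Quotient.mk π x) (Quotient.mk π y))
    cases r with
    | none => exact absurd h2 ((hr.spec hj).2 rfl _ h1.1.1 h1.1.2)
    | some ρ => rwa [h1.unique ((hr.spec hj).1 _ rfl).1]

/-- Consistency passes to finer partitions, so the failure of the least candidate is the failure of
all candidates. In this form a single consistent candidate refutes a rejection. -/
theorem rejects_iff {π : Setoid S.prefixes} (hπ : (S.prefixTree hS).RankCons π)
    {x y : S.prefixes} :
    S.Rejects hS π (Quotient.mk π x) (Quotient.mk π y) ↔
      ∀ ρ, π ≤ ρ → ρ x y → (S.prefixTree hS).DetCongr ρ → ¬ (S.prefixTree hS).RankCons ρ := by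
  constructor
  · intro h ρ h1 h2 hd hc
    have hle := PNFA.joinBlocks_le_iff.2 ⟨h1, h2⟩
    have hj := hc.mono hle
    exact ((h ((hπ.compatible_iff _ _).2 hj)).spec hj).2 rfl ρ hle hd hc
  · intro h hc
    have hj := (hπ.compatible_iff _ _).1 hc
    obtain ⟨r, hr⟩ := PNFA.Determinizes.exists (M := S.prefixTree hS)
      (joinBlocks π (Quotient.mk π x) (Quotient.mk π y))
    cases r with
    | none => exact hr
    | some ρ =>
      obtain ⟨k1, k2⟩ := (hr.spec hj).1 _ rfl
      obtain ⟨l1, l2⟩ := PNFA.joinBlocks_le_iff.1 k1.1.1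
      exact absurd k2 (h ρ l1 l2 k1.1.2)

theorem rankCons_bot : (S.prefixTree hS).RankCons ⊥ := by
  intro x y o o' h hx hy
  obtain rfl : x = y := h
  exact Option.some_injective _ (hx.symm.trans hy)

theorem rank_eq_some_iff {x : S.prefixes} {o : S.Ranks} :
    (S.prefixTree hS).rank x = some o ↔
      ∃ h : x.1 ∈ S.words, S.indifferenceGraph.connectedComponentMk ⟨x.1, h⟩ = o := by
  simp [prefixTree]

theorem detCongr_bot : (S.prefixTree hS).DetCongr ⊥ := by
  intro x y x' y' a h hx hy
  obtain rfl : x = y := h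
  exact Subtype.ext (Eq.trans (b := x.1 ++ [a]) hx (Eq.symm hy))

/-- A join propagates along a common continuation, as long as the extended words are still prefixes
of the sample. -/
theorem DetCongr.append {π : Setoid S.prefixes} (h : (S.prefixTree hS).DetCongr π)
    (y : List σ) : ∀ (u v u' v' : S.prefixes), π u v → u'.1 = u.1 ++ y → v'.1 = v.1 ++ y →
      π u' v' := by
  induction y using List.reverseRecOn with
  | nil =>
    intro u v u' v' huv hu hv
    obtain rfl : u' = u := Subtype.ext (by simpa using hu)
    obtain rfl : v' = v := Subtype.ext (by simpa using hv)
    exact huv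
  | append_singleton y a ih =>
    intro u v u' v' huv hu hv
    rw [← List.append_assoc] at hu hv
    exact h ⟨u.1 ++ y, prefixes_of_append (hu ▸ u'.2)⟩ ⟨v.1 ++ y, prefixes_of_append (hv ▸ v'.2)⟩
      u' v' a (ih u v _ _ huv rfl rfl) hu hv

/-! ### The closure of a sample and its components -/

theorem Closure.mem_words {w w' : List σ} {b : Comparison} (h : S.Closure w w' b) :
    w ∈ S.words ∧ w' ∈ S.words := by
  induction h with
  | base h => exact ⟨mem_words_left h, mem_words_right h⟩
  | refl h => exact ⟨h, h⟩
  | symm _ _ ih => exact ih.symm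
  | trans _ _ _ ih ih' => exact ⟨ih.1, ih'.2⟩
  | left _ _ _ ih ih' => exact ⟨ih.1, ih'.2⟩
  | right _ _ _ ih ih' => exact ⟨ih.1, ih'.2⟩

/-- The component of a word of the sample. -/
def comp (S : Sample σ) (w : S.words) : S.Ranks := S.indifferenceGraph.connectedComponentMk w

theorem comp_eq_of_mem {w w' : S.words} (h : (w.1, w'.1, Comparison.indifferent) ∈ S) :
    S.comp w = S.comp w' := by
  by_cases e : w = w'
  · rw [e]
  · exact SimpleGraph.ConnectedComponent.sound
      (SimpleGraph.Adj.reachable ((SimpleGraph.fromRel_adj _ _ _).2 ⟨e, Or.inl h⟩))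

/-- A function on the words that is constant on indifferent pairs is constant on components. -/
theorem eq_of_comp_eq {α : Type*} (f : S.words → α)
    (hf : ∀ w w' : S.words, (w.1, w'.1, Comparison.indifferent) ∈ S → f w = f w')
    {w w' : S.words} (h : S.comp w = S.comp w') : f w = f w' := by
  obtain ⟨p⟩ := SimpleGraph.ConnectedComponent.exact h
  induction p with
  | nil => rfl
  | cons hadj p ih =>
    rw [← ih (SimpleGraph.ConnectedComponent.sound ⟨p⟩)]
    rcases ((SimpleGraph.fromRel_adj _ _ _).1 hadj).2 with k | k
    · exact hf _ _ k
    · exact (hf _ _ k).symm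

/-- What a triple of the closure says about the ranks of the prefix tree automaton. -/
theorem Closure.comp {w w' : List σ} {b : Comparison} (h : S.Closure w w' b)
    (hw : w ∈ S.words) (hw' : w' ∈ S.words) :
    (b = .indifferent → S.comp ⟨w, hw⟩ = S.comp ⟨w', hw'⟩) ∧
    (b = .strict → Relation.TransGen S.rankRel (S.comp ⟨w, hw⟩) (S.comp ⟨w', hw'⟩)) := by
  induction h with
  | base h =>
    refine ⟨?_, ?_⟩
    · rintro rfl
      exact comp_eq_of_mem h
    · rintro rfl
      exact .single ⟨⟨_, hw⟩, ⟨_, hw'⟩, rfl, rfl, h⟩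
  | refl h => exact ⟨fun _ => rfl, by simp⟩
  | symm hb h ih =>
    refine ⟨fun e => ((ih hw' hw).1 e).symm, ?_⟩
    rintro rfl
    simp at hb
  | trans hb h h' ih ih' =>
    have hm := h.mem_words.2
    exact ⟨fun e => ((ih hw hm).1 e).trans ((ih' hm hw').1 e),
      fun e => ((ih hw hm).2 e).trans ((ih' hm hw').2 e)⟩
  | left hb h h' ih ih' =>
    have hm := h.mem_words.2
    refine ⟨?_, fun e => ?_⟩
    · rintro rfl
      simp at hb
    · rw [(ih hw hm).1 rfl]
      exact (ih' hm hw').2 e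
  | right hb h h' ih ih' =>
    have hm := h.mem_words.2
    refine ⟨?_, fun e => ?_⟩
    · rintro rfl
      simp at hb
    · rw [← (ih' hm hw').1 rfl]
      exact (ih hw hm).2 e

end Sample

/-! ### Characteristic samples -/

namespace PDFA

variable {σ Q O : Type*} [PartialOrder O] {A : PDFA σ Q O}

theorem eval_snoc (w : List σ) (a : σ) : A.eval (w ++ [a]) = A.step (A.eval w) a := by
  simp [eval]

theorem eval_append_congr {u v : List σ} (h : A.eval u = A.eval v) (y : List σ) :
    A.eval (u ++ y) = A.eval (v ++ y) := by
  unfold eval at *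
  rw [List.foldl_append, List.foldl_append, h]

variable [LinearOrder σ]

theorem IsShortestPrefix.eq {q : Q} {u v : List σ} (hu : A.IsShortestPrefix q u)
    (hv : A.IsShortestPrefix q v) : u = v := by
  by_contra hne
  exact (hu.2 v hv.1 (Ne.symm hne)).asymm (hv.2 u hu.1 hne)

/-- Over a finite alphabet `<_L` is well-founded, so the words reaching the state of `u` have a
least one. -/
theorem exists_shortestPrefix [Finite σ] (u : List σ) :
    ∃ w, A.IsShortestPrefix (A.eval u) w ∧ (w = u ∨ WordLT w u) := by
  obtain ⟨w, hw, hmin⟩ := WordLT.wellFounded.has_min {w | A.eval w = A.eval u} ⟨u, rfl⟩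
  have key : ∀ w', A.eval w' = A.eval u → w' ≠ w → WordLT w w' := by
    intro w' hw' hne
    rcases WordLT.trichotomy w w' with h | h | h
    · exact h
    · exact absurd h.symm hne
    · exact absurd h (hmin w' hw')
  refine ⟨w, ⟨hw, key⟩, ?_⟩
  by_cases e : u = w
  · exact Or.inl e.symm
  · exact Or.inr (key u rfl e)

theorem nil_mem_shortestPrefixes : [] ∈ A.shortestPrefixes :=
  ⟨A.eval [], rfl, fun w' _ hne => (List.shortlex_nil_or_eq_nil w').resolve_right hne⟩

/-- A smaller word reaching the state of `u` could be extended by `a` and would beat `ua`. Thus the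
parent of a shortest prefix is again one, and shortest prefixes lie in the nucleus. -/
theorem IsShortestPrefix.of_snoc {q : Q} {u : List σ} {a : σ}
    (h : A.IsShortestPrefix q (u ++ [a])) : A.IsShortestPrefix (A.eval u) u := by
  refine ⟨rfl, fun w' hw' hne => ?_⟩
  rcases WordLT.trichotomy u w' with k | k | k
  · exact k
  · exact absurd k.symm hne
  · have h1 : A.eval (w' ++ [a]) = q := by rw [eval_append_congr hw', h.1]
    exact absurd (h.2 _ h1 (by simpa using hne)) (k.snoc_snoc a a).asymm

theorem shortestPrefixes_subset_nucleus : A.shortestPrefixes ⊆ A.nucleus := by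
  rintro w ⟨q, hw⟩
  rcases List.eq_nil_or_concat w with rfl | ⟨u, a, rfl⟩
  · exact Or.inr rfl
  · exact Or.inl ⟨u, ⟨_, IsShortestPrefix.of_snoc (by simpa using hw)⟩, a, by simp⟩

end PDFA

/-! ### The outer loop on a characteristic sample -/

namespace Sample

variable {σ Q O : Type*} [LinearOrder σ] [PartialOrder O] {S : Sample σ} {A : PDFA σ Q O}
  {hS : S.Nonempty}

/-- The closure rules are valid for equality, strict order and incomparability of ranks in any
partial order. -/
theorem Consistent.closure (hc : S.Consistent A) {w w' : List σ} {b : Comparison}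
    (h : S.Closure w w' b) :
    (b = .indifferent → A.Indifferent w w') ∧ (b = .strict → A.StrictlyPrefers w w') ∧
      (b = .incomparable → A.Incomparable w w') := by
  unfold PDFA.Indifferent PDFA.StrictlyPrefers PDFA.Incomparable
  induction h with
  | base h =>
    refine ⟨?_, ?_, ?_⟩
    · rintro rfl; exact (hc _ _).1 h
    · rintro rfl; exact (hc _ _).2.1 h
    · rintro rfl; exact (hc _ _).2.2 h
  | refl h => simp
  | symm hb h ih =>
    refine ⟨fun e => (ih.1 e).symm, ?_, fun e => (ih.2.2 e).symm⟩
    rintro rfl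
    simp at hb
  | trans hb h h' ih ih' =>
    refine ⟨fun e => (ih.1 e).trans (ih'.1 e), fun e => lt_trans (ih'.2.1 e) (ih.2.1 e), ?_⟩
    rintro rfl
    simp at hb
  | left hb h h' ih ih' =>
    rw [ih.1 rfl]
    exact ih'
  | right hb h h' ih ih' =>
    rw [← ih'.1 rfl]
    exact ih

theorem Consistent.wordRank_eq (hc : S.Consistent A) {w w' : S.words} (h : S.comp w = S.comp w') :
    A.wordRank w.1 = A.wordRank w'.1 :=
  eq_of_comp_eq (fun w => A.wordRank w.1) (fun w w' hm => (hc w.1 w'.1).1 hm) h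

/-- With `Consistent.wordRank_eq` this shows that the components of the indifference graph are
exactly the fibres of the word ranks on the sample. -/
theorem IsCharacteristic.comp_eq (h : S.IsCharacteristic A) {w w' : S.words}
    (e : A.wordRank w.1 = A.wordRank w'.1) : S.comp w = S.comp w' :=
  ((h.indifferent_mem _ w.2 _ w'.2 e).comp w.2 w'.2).1 rfl

/-- Two prefixes are equivalent if they lead to the same state of the automaton. -/
def evalSetoid (S : Sample σ) (A : PDFA σ Q O) : Setoid S.prefixes :=
  Setoid.ker fun u => A.eval u.1

theorem detCongr_evalSetoid : (S.prefixTree hS).DetCongr (S.evalSetoid A) := by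
  intro x y x' y' a hxy hx hy
  change x'.1 = x.1 ++ [a] at hx
  change y'.1 = y.1 ++ [a] at hy
  change A.eval x'.1 = A.eval y'.1
  rw [hx, hy]
  exact PDFA.eval_append_congr hxy _

theorem IsCharacteristic.rankCons_evalSetoid (h : S.IsCharacteristic A) :
    (S.prefixTree hS).RankCons (S.evalSetoid A) := by
  intro x y o o' hxy hx hy
  obtain ⟨kx, rfl⟩ := rank_eq_some_iff.1 hx
  obtain ⟨ky, rfl⟩ := rank_eq_some_iff.1 hy
  exact h.comp_eq (w := ⟨_, kx⟩) (w' := ⟨_, ky⟩) (congrArg A.rank hxy)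

/-- Determinism carries the join of `w` and `u` along the distinguishing word `y` to `wy` and `uy`.
Both are ranked, so consistency would give them the same rank in the automaton, against the triple
in the closure. -/
theorem IsCharacteristic.not_rankCons (h : S.IsCharacteristic A) (hc : S.Consistent A)
    {w u : S.prefixes} (hw : w.1 ∈ A.shortestPrefixes) (hu : u.1 ∈ A.nucleus)
    (hne : A.eval w.1 ≠ A.eval u.1) {ρ : Setoid S.prefixes} (hρ : ρ w u)
    (hd : (S.prefixTree hS).DetCongr ρ) : ¬ (S.prefixTree hS).RankCons ρ := by
  intro hcons
  obtain ⟨y, h1, h2, h3⟩ := h.distinguish _ hw _ hu hne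
  have hr : A.wordRank (w.1 ++ y) = A.wordRank (u.1 ++ y) := by
    refine hc.wordRank_eq (w := ⟨_, h1⟩) (w' := ⟨_, h2⟩) ?_
    exact hcons ⟨_, words_subset_prefixes h1⟩ ⟨_, words_subset_prefixes h2⟩ _ _
      (DetCongr.append hd y w u _ _ hρ rfl rfl) (rank_eq_some_iff.2 ⟨h1, rfl⟩)
      (rank_eq_some_iff.2 ⟨h2, rfl⟩)
  rcases h3 with k | k | k
  · have := (hc.closure k).2.1 rfl
    unfold PDFA.StrictlyPrefers at this
    rw [hr] at this
    exact lt_irrefl _ this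
  · have := (hc.closure k).2.1 rfl
    unfold PDFA.StrictlyPrefers at this
    rw [hr] at this
    exact lt_irrefl _ this
  · have := (hc.closure k).2.2 rfl
    unfold PDFA.Incomparable at this
    rw [hr] at this
    exact this.1 le_rfl

/-- The invariant of the outer loop, after all prefixes in `D` have been dealt with. -/
structure LoopInv (S : Sample σ) (hS : S.Nonempty) (A : PDFA σ Q O) (D : Set S.prefixes)
    (π : Setoid S.prefixes) : Prop where
  det : (S.prefixTree hS).DetCongr π
  le : π ≤ S.evalSetoid A
  red : ∀ u ∈ D, ∀ w : S.prefixes, A.IsShortestPrefix (A.eval u.1) w.1 → π u w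

/-- The prefix `z` has been dealt with, so its block contains the shortest prefix of its state;
being the least element of the block, `z` must be that shortest prefix. -/
theorem LoopInv.name {D : Set S.prefixes} {π : Setoid S.prefixes} [Finite σ]
    (hchar : S.IsCharacteristic A)
    (h : LoopInv S hS A D π) {u z : S.prefixes} (hD : ∀ v : S.prefixes, WordLT v.1 u.1 → v ∈ D)
    (hz : S.IsBlockName (Quotient.mk π z) z) (hzu : WordLT z.1 u.1) :
    A.IsShortestPrefix (A.eval z.1) z.1 := by
  obtain ⟨w, hw, hwz⟩ := A.exists_shortestPrefix z.1
  have hwp : w ∈ S.prefixes :=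
    hchar.nucleus_subset (PDFA.shortestPrefixes_subset_nucleus ⟨_, hw⟩)
  have := h.red z (hD z hzu) ⟨w, hwp⟩ hw
  rcases hwz with e | hlt
  · rwa [e] at hw
  · exact absurd hlt (hz.2 ⟨w, hwp⟩ (Quotient.sound (π.symm this)))

/-- In each of the three outcomes, `u` has to end up in the block of the shortest prefix `w` of its
state: through an earlier element of its block, through the accepted join, or because `u = w`. -/
theorem LoopInv.step [Finite σ] {D : Set S.prefixes} {π π' : Setoid S.prefixes}
    (hc : S.Consistent A) (hchar : S.IsCharacteristic A) (h : LoopInv S hS A D π) {u : S.prefixes}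
    (hu0 : u.1 ≠ []) (hD : ∀ v : S.prefixes, WordLT v.1 u.1 → v ∈ D)
    (hst : S.LearnStep hS u π π') : LoopInv S hS A (insert u D) π' := by
  have hcons : (S.prefixTree hS).RankCons π := hchar.rankCons_evalSetoid.mono h.le
  obtain ⟨w, hw, hwu⟩ := A.exists_shortestPrefix u.1
  have hsub := PDFA.shortestPrefixes_subset_nucleus (A := A)
  have hwp : w ∈ S.prefixes := hchar.nucleus_subset (hsub ⟨_, hw⟩)
  -- it is enough that the new partition is a correct coarsening that joins `u` and `w`
  have finish : ∀ ρ : Setoid S.prefixes, π ≤ ρ → (S.prefixTree hS).DetCongr ρ →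
      ρ ≤ S.evalSetoid A → ρ u ⟨w, hwp⟩ → LoopInv S hS A (insert u D) ρ := by
    intro ρ h1 h2 h3 h4
    refine ⟨h2, h3, ?_⟩
    rintro v (rfl | hv) x hx
    · have : x = ⟨w, hwp⟩ := Subtype.ext (hx.eq hw)
      rwa [this]
    · exact h1 (h.red v hv x hx)
  -- the name of a block lies in the nucleus
  have nuc : S.IsBlockName (Quotient.mk π u) u → u.1 ∈ A.nucleus := by
    intro hname
    obtain ⟨v, a, hva⟩ := (List.eq_nil_or_concat u.1).resolve_left hu0
    rw [List.concat_eq_append] at hva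
    have hvp : v ∈ S.prefixes := prefixes_of_append (hva ▸ u.2)
    obtain ⟨v', hv', hlt⟩ := A.exists_shortestPrefix v
    have hvn : v' ++ [a] ∈ A.nucleus := Or.inl ⟨v', ⟨_, hv'⟩, a, rfl⟩
    have hvp' := hchar.nucleus_subset hvn
    have hvlt : WordLT v u.1 := by rw [hva]; exact WordLT.self_snoc _ _
    have h1 := h.red ⟨v, hvp⟩ (hD ⟨v, hvp⟩ hvlt) ⟨v', prefixes_of_append hvp'⟩ hv'
    have h2 : π u ⟨_, hvp'⟩ := h.det _ _ u ⟨_, hvp'⟩ a h1 hva rfl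
    rcases hlt with e | hlt
    · rw [hva, ← e]; exact hvn
    -- The parent `v` is in the block of its shortest prefix `v'`, hence `u = va` is in the block of
    -- `v'a`; if `v' <_L v`, then `v'a` is smaller than the name `u`.
    · refine absurd ?_ (hname.2 ⟨_, hvp'⟩ (Quotient.sound (π.symm h2)))
      rw [hva]
      exact hlt.snoc_snoc a a
  cases hst with
  | not_name hn =>
    refine finish π le_rfl h.det h.le ?_
    unfold IsBlockName at hn
    push Not at hn
    obtain ⟨v, hv, hlt⟩ := hn rfl
    have hvu : π v u := Quotient.exact hv
    have he : A.eval v.1 = A.eval u.1 := h.le hvu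
    exact π.trans (π.symm hvu) (h.red v (hD v hlt) ⟨w, hwp⟩ (he ▸ hw))
  | merged B _ hname hlt hrej hacc =>
    obtain ⟨z, u', hz, hu', hzu⟩ := hlt
    obtain rfl := hz.1
    have eu : ¬ WordLT u'.1 u.1 := hname.2 _ hu'.1
    have hzlt : WordLT z.1 u.1 := by
      rcases WordLT.trichotomy u.1 u'.1 with k | k | k
      · exact absurd k (hu'.2 u rfl)
      · rwa [k]
      · exact absurd k eu
    have hzs := h.name hchar hD hz hzlt
    obtain ⟨⟨⟨⟨k1, k2⟩, k3⟩, k4⟩, k5⟩ := (accepts_iff hcons).1 hacc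
    -- If the two states differed, the distinguishing continuation would make the accepted partition
    -- inconsistent.
    have hez : A.eval z.1 = A.eval u.1 := by
      by_contra hne
      exact hchar.not_rankCons hc ⟨_, hzs⟩ (nuc hname) hne k2 k3 k5
    have hzw : z = ⟨w, hwp⟩ := Subtype.ext ((hez ▸ hzs).eq hw)
    -- The accepted partition is the least candidate, and `evalSetoid` is a candidate because `z`
    -- and `u` reach the same state.
    refine finish π' k1 k3 (k4 ⟨⟨h.le, hez⟩, detCongr_evalSetoid⟩) ?_
    rw [← hzw]
    exact π'.symm k2
  | not_merged hname hrej =>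
    refine finish π le_rfl h.det h.le ?_
    rcases hwu with e | hlt
    · have : u = ⟨w, hwp⟩ := Subtype.ext e.symm
      rw [← this]
    -- If `w <_L u`, then the block of `w` was among those tried. It is named by `w` because the
    -- partition is below `evalSetoid`, and `evalSetoid` witnesses that joining it with `u` could
    -- not be rejected.
    · exfalso
      have hwn : S.IsBlockName (Quotient.mk π ⟨w, hwp⟩) ⟨w, hwp⟩ := by
        refine ⟨rfl, fun v hv hvw => ?_⟩
        have he : A.eval v.1 = A.eval w := h.le (Quotient.exact hv)
        exact hvw.asymm (hw.2 _ (he.trans hw.1) hvw.ne)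
      have := (rejects_iff hcons).1 (hrej _ ⟨_, _, hwn, hname, hlt⟩) (S.evalSetoid A) h.le hw.1
        detCongr_evalSetoid
      exact this hchar.rankCons_evalSetoid

theorem LoopInv.loop [Finite σ] (hc : S.Consistent A) (hchar : S.IsCharacteristic A)
    {us : List S.prefixes} {π π' : Setoid S.prefixes} (hl : S.LearnLoop hS us π π') :
    ∀ {D : Set S.prefixes}, LoopInv S hS A D π →
      us.Pairwise (fun u v => WordLT u.1 v.1) → (∀ u ∈ us, u.1 ≠ []) →
      (∀ v, v ∈ D ∨ v ∈ us) → LoopInv S hS A Set.univ π' := by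
  induction hl with
  | nil =>
    intro D h _ _ hall
    have : D = Set.univ := Set.eq_univ_of_forall fun v => by simpa using hall v
    rwa [← this]
  | @cons u us π π' π'' hst _ ih =>
    intro D h hpw hne hall
    rw [List.pairwise_cons] at hpw
    refine ih (h.step hc hchar (hne u (by simp)) ?_ hst) hpw.2 (fun v hv => hne v (by simp [hv])) ?_
    -- The list is sorted, so everything below its head has left the list and is in `D`.
    · intro v hv
      refine (hall v).resolve_right fun hm => ?_
      rcases List.mem_cons.1 hm with rfl | hm
      · exact WordLT.irrefl _ hv
      · exact (hpw.1 v hm).asymm hv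
    · intro v
      rcases hall v with k | k
      · exact Or.inl (Or.inr k)
      · rcases List.mem_cons.1 k with rfl | k
        · exact Or.inl (Or.inl rfl)
        · exact Or.inr k

/-- When all prefixes have been dealt with, two prefixes with the same state are both in the block
of its shortest prefix, so the partition is not only below `evalSetoid` but equal to it. -/
theorem LearnPDFA.eq_evalSetoid [Finite σ] (hc : S.Consistent A) (hchar : S.IsCharacteristic A)
    {π : Setoid S.prefixes} (hl : S.LearnPDFA hS π) : π = S.evalSetoid A := by
  obtain ⟨us, hpw, hall, hl⟩ := hl
  have hnil := nil_mem_prefixes hS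
  cases us with
  | nil => exact absurd (hall ⟨[], hnil⟩) (by simp)
  | cons u us =>
    rw [List.pairwise_cons] at hpw
    have hne : ∀ v ∈ us, v.1 ≠ [] := by
      intro v hv e
      have := hpw.1 v hv
      rw [e] at this
      exact WordLT.not_nil _ this
    have hu : u.1 = [] := by
      rcases List.mem_cons.1 (hall ⟨[], hnil⟩) with k | k
      · rw [← k]
      · exact absurd rfl (hne _ k)
    -- The word `ε` is the shortest prefix of its state, so it needs no iteration of its own.
    have h0 : LoopInv S hS A {u} ⊥ := by
      refine ⟨detCongr_bot, bot_le, ?_⟩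
      rintro _ rfl w hw
      refine Subtype.ext ?_
      rw [hu] at hw ⊢
      by_contra hne
      exact WordLT.not_nil _ (hw.2 [] rfl hne)
    have h := h0.loop hc hchar hl hpw.2 hne fun v => by
      rcases List.mem_cons.1 (hall v) with k | k
      · exact Or.inl k
      · exact Or.inr k
    refine le_antisymm h.le fun x y hxy => ?_
    change A.eval x.1 = A.eval y.1 at hxy
    obtain ⟨w, hw, -⟩ := A.exists_shortestPrefix x.1
    have hwp : w ∈ S.prefixes :=
      hchar.nucleus_subset (PDFA.shortestPrefixes_subset_nucleus ⟨_, hw⟩)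
    exact π.trans (h.red x trivial ⟨w, hwp⟩ hw)
      (π.symm (h.red y trivial ⟨w, hwp⟩ (hxy ▸ hw)))

/-- Each condition on the sample provides one part of the isomorphism: visited states make the map
on states surjective, the nucleus supplies all transitions, and complete information on indifference
and strict preference makes the map on ranks injective and order-reflecting. -/
theorem isIsomorphic_evalSetoid [Finite σ] (hc : S.Consistent A) (hchar : S.IsCharacteristic A) :
    ((S.prefixTree hS).quotient (S.evalSetoid A)).IsIsomorphic A := by
  have hcons : (S.prefixTree hS).RankCons (S.evalSetoid A) := hchar.rankCons_evalSetoid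
  let g : Quotient (S.evalSetoid A) → Q := Quotient.lift (fun u => A.eval u.1) fun _ _ h => h
  have hg : Function.Bijective g := by
    constructor
    · rintro ⟨x⟩ ⟨y⟩ h
      exact Quotient.sound h
    · intro q
      obtain ⟨w, hw, rfl⟩ := hchar.states_visited q
      exact ⟨Quotient.mk _ ⟨w, words_subset_prefixes hw⟩, rfl⟩
  -- The rank of an arbitrary representative; consistency makes it the rank of every word of the
  -- component.
  let h : S.Ranks → O := fun c => A.wordRank (Quot.out c).1
  have hh : ∀ w : S.words, h (S.comp w) = A.wordRank w.1 := fun w =>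
    hc.wordRank_eq (Quot.out_eq (S.comp w))
  have hbij : Function.Bijective h := by
    constructor
    · intro c c' e
      induction c using SimpleGraph.ConnectedComponent.ind with | _ w =>
      induction c' using SimpleGraph.ConnectedComponent.ind with | _ w' =>
      exact hchar.comp_eq ((hh w).symm.trans (e.trans (hh w')))
    · intro o
      obtain ⟨q, rfl⟩ := A.rank_surjective o
      obtain ⟨w, hw, rfl⟩ := hchar.states_visited q
      exact ⟨S.comp ⟨w, hw⟩, hh ⟨w, hw⟩⟩
  refine ⟨Equiv.ofBijective g hg, Equiv.ofBijective h hbij, rfl, ?_, ?_, ?_⟩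
  · rintro ⟨x⟩ a ⟨y⟩
    change _ ↔ A.step (A.eval x.1) a = A.eval y.1
    constructor
    · rintro ⟨u, v, hu, hv, huv⟩
      have hu' : A.eval u.1 = A.eval x.1 := Quotient.exact hu
      have hv' : A.eval v.1 = A.eval y.1 := Quotient.exact hv
      have huv' : v.1 = u.1 ++ [a] := huv
      rw [← hu', ← hv', huv', PDFA.eval_snoc]
    · intro e
      -- The prefix `x` itself need not have a child in the tree, but the shortest prefix in its
      -- block does, since the nucleus consists of prefixes of the sample.
      obtain ⟨w, hw, -⟩ := A.exists_shortestPrefix x.1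
      have hwa : w ++ [a] ∈ S.prefixes :=
        hchar.nucleus_subset (Or.inl ⟨w, ⟨_, hw⟩, a, rfl⟩)
      refine ⟨⟨w, prefixes_of_append hwa⟩, ⟨_, hwa⟩, Quotient.sound hw.1, Quotient.sound ?_, rfl⟩
      change A.eval (w ++ [a]) = A.eval y.1
      rw [PDFA.eval_snoc, hw.1, e]
  · rintro ⟨x⟩
    obtain ⟨w, hw, e⟩ := hchar.states_visited (A.eval x.1)
    have := hcons.rank_quotient.2 ⟨⟨w, words_subset_prefixes hw⟩, e.symm,
      rank_eq_some_iff.2 ⟨hw, rfl⟩⟩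
    change Option.map h (((S.prefixTree hS).quotient (S.evalSetoid A)).rank
      (Quotient.mk _ x)) = some (A.rank (A.eval x.1))
    rw [this, Option.map_some]
    exact congrArg some ((hh ⟨w, hw⟩).trans (congrArg A.rank e))
  · intro c c'
    change Relation.ReflTransGen S.rankRel c c' ↔ h c ≥ h c'
    constructor
    · intro k
      induction k with
      | refl => exact le_rfl
      | tail _ hr ih =>
        obtain ⟨w, w', rfl, rfl, hm⟩ := hr
        refine le_trans ?_ ih
        have := (hc w.1 w'.1).2.1 hm
        have e := hh w
        have e' := hh w'
        unfold comp at e e'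
        rw [e, e']
        exact this.le
    · intro k
      rcases eq_or_lt_of_le k with e | e
      · rw [hbij.1 e]
      · induction c using SimpleGraph.ConnectedComponent.ind with | _ w =>
        induction c' using SimpleGraph.ConnectedComponent.ind with | _ w' =>
        change h (S.comp w') < h (S.comp w) at e
        rw [hh, hh] at e
        exact ((hchar.strict_mem _ w.2 _ w'.2 e).comp w.2 w'.2).2 rfl |>.to_reflTransGen

end Sample

namespace Sample

variable {σ : Type*} [LinearOrder σ] {S : Sample σ} {hS : S.Nonempty}

/-! ### Positions of prefixes -/

/-- The position of a prefix in the ordering `<_L` of all prefixes. -/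
noncomputable def pos (u : S.prefixes) : ℕ := Set.ncard {v : S.prefixes | WordLT v.1 u.1}

theorem pos_lt_pos {u v : S.prefixes} (h : WordLT u.1 v.1) : pos u < pos v := by
  refine Set.ncard_lt_ncard ?_ (Set.toFinite _)
  refine ⟨fun w hw => WordLT.trans hw h, fun hsub => WordLT.irrefl _ (hsub (a := u) h)⟩

theorem pos_lt_pos_iff {u v : S.prefixes} : pos u < pos v ↔ WordLT u.1 v.1 := by
  refine ⟨fun h => ?_, pos_lt_pos⟩
  rcases WordLT.trichotomy u.1 v.1 with k | k | k
  · exact k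
  · rw [Subtype.ext k] at h
    exact absurd h (lt_irrefl _)
  · exact absurd h (pos_lt_pos k).not_gt

theorem pos_injective : Function.Injective (pos (S := S)) := by
  intro u v h
  rcases WordLT.trichotomy u.1 v.1 with k | k | k
  · exact absurd h (pos_lt_pos k).ne
  · exact Subtype.ext k
  · exact absurd h (pos_lt_pos k).ne'

theorem pos_lt_card (u : S.prefixes) : pos u < Nat.card S.prefixes := by
  rw [← Set.ncard_univ]
  exact Set.ncard_lt_ncard ⟨Set.subset_univ _, fun h => WordLT.irrefl _ (h (Set.mem_univ u))⟩
    (Set.toFinite _)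

theorem exists_pos_eq {i : ℕ} (h : i < Nat.card S.prefixes) : ∃ u : S.prefixes, pos u = i := by
  have := Fintype.ofFinite S.prefixes
  let f : S.prefixes → Fin (Nat.card S.prefixes) := fun u => ⟨pos u, pos_lt_card u⟩
  have hf : Function.Injective f := fun u v e => pos_injective (congrArg Fin.val e)
  have hb := (Fintype.bijective_iff_injective_and_card f).2 ⟨hf, by simp⟩
  obtain ⟨u, hu⟩ := hb.2 ⟨i, h⟩
  exact ⟨u, congrArg Fin.val hu⟩

theorem pos_nil (h : [] ∈ S.prefixes) : pos ⟨[], h⟩ = 0 := by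
  unfold pos
  rw [Set.ncard_eq_zero]
  exact Set.eq_empty_of_forall_notMem fun v => WordLT.not_nil _

theorem pos_eq_zero_iff {u : S.prefixes} : pos u = 0 ↔ u.1 = [] := by
  constructor
  · intro h
    by_contra hne
    have h0 : [] ∈ S.prefixes := prefixes_of_append (v := u.1) u.2
    have := pos_lt_pos (u := ⟨[], h0⟩) (v := u)
      ((List.shortlex_nil_or_eq_nil u.1).resolve_right hne)
    omega
  · intro h
    obtain ⟨u, hu⟩ := u
    subst h
    exact pos_nil hu

theorem snoc_inj {x y : S.prefixes} {a b : σ} (h : x.1 ++ [a] = y.1 ++ [b]) : x = y ∧ a = b := by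
  obtain ⟨h1, h2⟩ := List.append_inj' h rfl
  exact ⟨Subtype.ext h1, by simpa using h2⟩

theorem pos_lt_of_snoc {u x : S.prefixes} {a : σ} (h : u.1 = x.1 ++ [a]) : pos x < pos u :=
  pos_lt_pos (h ▸ WordLT.self_snoc _ _)

theorem exists_sorted_prefixes : ∃ us : List S.prefixes,
    us.Pairwise (fun u v => WordLT u.1 v.1) ∧ (∀ u, u ∈ us) ∧ us.length = Nat.card S.prefixes ∧
      ∀ i (h : i < us.length), pos us[i] = i := by
  choose f hf using fun i : Fin (Nat.card S.prefixes) => exists_pos_eq i.2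
  refine ⟨List.ofFn f, ?_, ?_, List.length_ofFn, ?_⟩
  · rw [List.pairwise_ofFn]
    intro i j hij
    rw [← pos_lt_pos_iff, hf, hf]
    exact hij
  · intro u
    rw [List.mem_ofFn]
    exact ⟨⟨pos u, pos_lt_card u⟩, pos_injective (hf _)⟩
  · intro i h
    rw [List.getElem_ofFn, hf]

theorem LearnLoop.snoc {us : List S.prefixes} {π π' π'' : Setoid S.prefixes} {u : S.prefixes}
    (h : S.LearnLoop hS us π π') (hst : S.LearnStep hS u π' π'') :
    S.LearnLoop hS (us ++ [u]) π π'' := by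
  induction h with
  | nil => exact .cons hst .nil
  | cons h1 _ ih => exact .cons h1 (ih hst)

theorem card_prefixFinset : S.prefixFinset.card = Nat.card S.prefixes := by
  rw [Nat.card_coe_set_eq, ← Set.ncard_coe_finset]
  congr 1
  ext u
  exact mem_prefixFinset

theorem mem_iff_of_toFinset {l : List (List σ × List σ × Comparison)} (hl : l.toFinset = S)
    {x : List σ × List σ × Comparison} : x ∈ S ↔ x ∈ l := by
  rw [← hl, List.mem_toFinset]

theorem getElem_mem_words {l : List (List σ × List σ × Comparison)} (hl : l.toFinset = S) {j : ℕ}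
    (h : j < l.length) : l[j].1 ∈ S.words ∧ l[j].2.1 ∈ S.words := by
  have : l[j] ∈ S := (mem_iff_of_toFinset hl).2 (List.getElem_mem h)
  exact ⟨mem_words_left (w' := l[j].2.1) (b := l[j].2.2) this,
    mem_words_right (w := l[j].1) (b := l[j].2.2) this⟩

theorem words_mem_prefixFinset {w : List σ} (h : w ∈ S.words) : w ∈ S.prefixFinset :=
  mem_prefixFinset.2 (words_subset_prefixes h)

/-! ### Runs

A run numbers the blocks of a partition along the ordering `<_L`. A prefix `xa` goes into the block
that an earlier prefix `ya` with `x` and `y` in the same block has gone into; if there is none, then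
the number of its block is prescribed by a target function, which may depend on the number `n`
of blocks so far, the number `n` standing for a new block. -/

/-- The prefixes are entered from the same block by the same letter. -/
def SameEdge (c : S.prefixes → ℕ) (v u : S.prefixes) : Prop :=
  ∃ (x y : S.prefixes) (a : σ), v.1 = x.1 ++ [a] ∧ u.1 = y.1 ++ [a] ∧ c x = c y

/-- The prefixes below `u` lie in the blocks `0, …, n - 1`. -/
def BlocksBelow (c : S.prefixes → ℕ) (u : S.prefixes) (n : ℕ) : Prop :=
  (∀ v : S.prefixes, WordLT v.1 u.1 → c v < n) ∧ ∀ b < n, ∃ v : S.prefixes, WordLT v.1 u.1 ∧ c v = b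

/-- There is no earlier prefix that determines the block of `u`. -/
def Fresh (c : S.prefixes → ℕ) (u : S.prefixes) : Prop :=
  ∀ v : S.prefixes, WordLT v.1 u.1 → ¬ SameEdge c v u

/-- The prefix `u` goes into the right block, for the target function `g`. -/
def RunAt (g : S.prefixes → ℕ → ℕ) (c : S.prefixes → ℕ) (u : S.prefixes) : Prop :=
  (∃ v : S.prefixes, WordLT v.1 u.1 ∧ SameEdge c v u ∧ c u = c v) ∨
    (Fresh c u ∧ ∃ n, BlocksBelow c u n ∧ c u = g u n)

theorem BlocksBelow.unique {c : S.prefixes → ℕ} {u : S.prefixes} {n n' : ℕ}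
    (h : BlocksBelow c u n) (h' : BlocksBelow c u n') : n = n' := by
  rcases lt_trichotomy n n' with k | k | k
  · obtain ⟨v, hv, e⟩ := h'.2 n k
    exact absurd (h.1 v hv) (by omega)
  · exact k
  · obtain ⟨v, hv, e⟩ := h.2 n' k
    exact absurd (h'.1 v hv) (by omega)

theorem SameEdge.lt {c : S.prefixes → ℕ} {v u : S.prefixes} (h : SameEdge c v u) :
    ∃ (x y : S.prefixes) (a : σ), WordLT x.1 v.1 ∧ WordLT y.1 u.1 ∧ v.1 = x.1 ++ [a] ∧
      u.1 = y.1 ++ [a] ∧ c x = c y := by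
  obtain ⟨x, y, a, h1, h2, h3⟩ := h
  exact ⟨x, y, a, h1 ▸ WordLT.self_snoc _ _, h2 ▸ WordLT.self_snoc _ _, h1, h2, h3⟩

theorem SameEdge.congr {c c' : S.prefixes → ℕ} {v u : S.prefixes} (h : SameEdge c v u)
    (hvu : WordLT v.1 u.1) (hc : ∀ w : S.prefixes, WordLT w.1 u.1 → c w = c' w) :
    SameEdge c' v u := by
  obtain ⟨x, y, a, hx, hy, h1, h2, h3⟩ := h.lt
  exact ⟨x, y, a, h1, h2, by rw [← hc x (hx.trans hvu), ← hc y hy, h3]⟩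

theorem BlocksBelow.congr {c c' : S.prefixes → ℕ} {u : S.prefixes} {n : ℕ}
    (h : BlocksBelow c u n) (hc : ∀ w : S.prefixes, WordLT w.1 u.1 → c w = c' w) :
    BlocksBelow c' u n := by
  refine ⟨fun v hv => hc v hv ▸ h.1 v hv, fun b hb => ?_⟩
  obtain ⟨v, hv, e⟩ := h.2 b hb
  exact ⟨v, hv, by rw [← hc v hv, e]⟩

theorem Fresh.congr {c c' : S.prefixes → ℕ} {u : S.prefixes} (h : Fresh c u)
    (hc : ∀ w : S.prefixes, WordLT w.1 u.1 → c w = c' w) : Fresh c' u :=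
  fun v hv hs => h v hv (hs.congr hv fun w hw => (hc w hw).symm)

/-- The condition at `u` looks at `c` only up to `u`, because parents precede their children. This
lets a program extend a run one position at a time. -/
theorem RunAt.congr_of_pos {g : S.prefixes → ℕ → ℕ} {c c' : S.prefixes → ℕ} {u : S.prefixes}
    (h : RunAt g c u) (hc : ∀ w : S.prefixes, pos w ≤ pos u → c w = c' w) : RunAt g c' u := by
  have hlt : ∀ w : S.prefixes, WordLT w.1 u.1 → c w = c' w := fun w hw => hc w (pos_lt_pos hw).le
  rcases h with ⟨v, hv, hs, e⟩ | ⟨hf, n, hn, e⟩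
  · exact Or.inl ⟨v, hv, hs.congr hv hlt, by rw [← hc u le_rfl, e, hlt v hv]⟩
  · exact Or.inr ⟨hf.congr hlt, n, hn.congr hlt, by rw [← hc u le_rfl, e]⟩

/-- The targets `min (t u) n` are used for the prefixes `u` in `D` only; other prefixes open
new blocks. -/
noncomputable def target (t : S.prefixes → ℕ) (D : Set S.prefixes) (u : S.prefixes) (n : ℕ) : ℕ :=
  open Classical in if u ∈ D then min (t u) n else n

theorem target_le (t : S.prefixes → ℕ) (D : Set S.prefixes) (u : S.prefixes) (n : ℕ) :
    target t D u n ≤ n := by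
  unfold target
  split_ifs
  · exact min_le_right _ _
  · exact le_rfl

/-! ### The partition of a run -/

section Run

variable {g g' : S.prefixes → ℕ → ℕ} {c c' : S.prefixes → ℕ}

/-- The least element of a block opens the block. -/
theorem RunAt.blocksBelow_of_isBlockName (h : ∀ u, RunAt g c u) (hg : ∀ u n, g u n ≤ n)
    {u : S.prefixes} (hu : S.IsBlockName (Quotient.mk (Setoid.ker c) u) u) :
    Fresh c u ∧ BlocksBelow c u (c u) := by
  have hne : ∀ v : S.prefixes, WordLT v.1 u.1 → c v ≠ c u := fun v hv e =>
    hu.2 v (Quotient.sound (s := Setoid.ker c) e) hv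
  rcases h u with ⟨v, hv, -, e⟩ | ⟨hf, n, hn, e⟩
  · exact absurd e.symm (hne v hv)
  · have hle : c u ≤ n := e ▸ hg u n
    -- A target below `n` would be a block that already has an earlier element, so `u` would not be
    -- the least one.
    rcases hle.eq_or_lt with k | k
    · rw [← k] at hn
      exact ⟨hf, hn⟩
    · obtain ⟨v, hv, ev⟩ := hn.2 _ k
      exact absurd ev (hne v hv)

theorem IsBlockName.eq {π : Setoid S.prefixes} {B : Quotient π} {u v : S.prefixes}
    (hu : S.IsBlockName B u) (hv : S.IsBlockName B v) : u = v := by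
  rcases WordLT.trichotomy u.1 v.1 with k | k | k
  · exact absurd k (hv.2 u hu.1)
  · exact Subtype.ext k
  · exact absurd k (hu.2 v hv.1)

variable [Finite σ]

/-- The condition of a run provides only one earlier prefix with the same edge. Any other one shares
the edge with that prefix too, and induction along `<_L` compares the two. -/
theorem RunAt.sameEdge (h : ∀ u, RunAt g c u) {v u : S.prefixes} (hs : SameEdge c v u) :
    c v = c u := by
  have key : ∀ w : List σ, ∀ v u : S.prefixes, u.1 = w → WordLT v.1 u.1 → SameEdge c v u →
      c v = c u := by
    intro w
    induction w using (WordLT.wellFounded (σ := σ)).induction with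
    | _ w ih =>
      rintro v u rfl hvu hs
      rcases h u with ⟨v', hv', hs', e⟩ | ⟨hf, -⟩
      · rw [e]
        have hss : ∀ {v v' : S.prefixes}, SameEdge c v u → SameEdge c v' u → SameEdge c v v' := by
          rintro v v' ⟨x, y, a, h1, h2, h3⟩ ⟨x', y', a', h1', h2', h3'⟩
          obtain ⟨e1, e2⟩ := List.append_inj' (h2.symm.trans h2') rfl
          obtain rfl : y = y' := Subtype.ext e1
          obtain rfl : a = a' := by simpa using e2
          exact ⟨x, x', a, h1, h1', h3.trans h3'.symm⟩
        rcases WordLT.trichotomy v.1 v'.1 with k | k | k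
        · exact ih _ hv' v v' rfl k (hss hs hs')
        · rw [Subtype.ext k]
        · exact (ih _ hvu v' v rfl k (hss hs' hs)).symm
      · exact absurd hs (hf v hvu)
  rcases WordLT.trichotomy v.1 u.1 with k | k | k
  · exact key _ v u rfl k hs
  · rw [Subtype.ext k]
  · obtain ⟨x, y, a, h1, h2, h3⟩ := hs
    exact (key _ u v rfl k ⟨y, x, a, h2, h1, h3.symm⟩).symm

theorem RunAt.detCongr (h : ∀ u, RunAt g c u) : (S.prefixTree hS).DetCongr (Setoid.ker c) :=
  fun x y _ _ a hxy hx hy => RunAt.sameEdge h ⟨x, y, a, hx, hy, hxy⟩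

/-- The partition of a run is the least one with the prescribed coincidences. -/
theorem RunAt.ker_le (h : ∀ u, RunAt g c u) {ρ : Setoid S.prefixes}
    (hd : (S.prefixTree hS).DetCongr ρ)
    (hρ : ∀ u w : S.prefixes, WordLT w.1 u.1 → Fresh c u → c w = c u → ρ w u) :
    Setoid.ker c ≤ ρ := by
  have key : ∀ s : List σ, ∀ u : S.prefixes, u.1 = s → ∀ w : S.prefixes, WordLT w.1 u.1 →
      c w = c u → ρ w u := by
    intro s
    induction s using (WordLT.wellFounded (σ := σ)).induction with
    | _ s ih =>
      rintro u rfl w hw e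
      have low : ∀ x y : S.prefixes, WordLT x.1 u.1 → WordLT y.1 u.1 → c x = c y → ρ x y := by
        intro x y hx hy e
        rcases WordLT.trichotomy x.1 y.1 with k | k | k
        · exact ih _ hy y rfl x k e
        · rw [Subtype.ext k]
        · exact ρ.symm (ih _ hx x rfl y k e.symm)
      rcases h u with ⟨v, hv, hs, e'⟩ | ⟨hf, -⟩
      -- The prefix `u` copies `v`: here `w` and `v` are related by induction, and `v` and `u` by
      -- determinism of `ρ`, since their parents are related by induction.
      · refine ρ.trans (low w v hw hv (e.trans e')) ?_
        obtain ⟨x, y, a, hx, hy, h1, h2, h3⟩ := hs.lt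
        exact hd x y v u a (low x y (hx.trans hv) hy h3) h1 h2
      · exact hρ u w hw hf e
  intro x y hxy
  rcases WordLT.trichotomy x.1 y.1 with k | k | k
  · exact key _ y rfl x k hxy
  · rw [Subtype.ext k]
  · exact ρ.symm (key _ x rfl y k (Eq.symm hxy))

/-- A run is determined by its targets: freshness and the number of blocks so far depend on earlier
values only. By induction, two runs agree up to the first prefix at which their targets differ. -/
theorem RunAt.congr {u : S.prefixes} (h : ∀ v, RunAt g c v) (h' : RunAt g' c' u)
    (hg : g u = g' u) (hc : ∀ w : S.prefixes, WordLT w.1 u.1 → c w = c' w) : c u = c' u := by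
  rcases h' with ⟨v, hv, hs, e⟩ | ⟨hf, n, hn, e⟩
  · rw [e, ← hc v hv]
    exact (RunAt.sameEdge h (hs.congr hv fun w hw => (hc w hw).symm)).symm
  · have hf' : Fresh c u := hf.congr fun w hw => (hc w hw).symm
    rcases h u with ⟨v, hv, hs, -⟩ | ⟨-, n', hn', e'⟩
    · exact absurd hs (hf' v hv)
    · rw [e, e', hg, (hn'.congr hc).unique hn]

theorem RunAt.eq_of_lt {i : S.prefixes} (h : ∀ v, RunAt g c v) (h' : ∀ v, RunAt g' c' v)
    (hg : ∀ u : S.prefixes, WordLT u.1 i.1 → g u = g' u) :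
    ∀ u : S.prefixes, WordLT u.1 i.1 → c u = c' u := by
  have key : ∀ s : List σ, ∀ u : S.prefixes, u.1 = s → WordLT u.1 i.1 → c u = c' u := by
    intro s
    induction s using (WordLT.wellFounded (σ := σ)).induction with
    | _ s ih =>
      rintro u rfl hu
      exact RunAt.congr h (h' u) (hg u hu) fun w hw => ih _ hw w rfl (hw.trans hu)
  exact fun u hu => key _ u rfl hu

theorem RunAt.eq_of_le {i : S.prefixes} (h : ∀ v, RunAt g c v) (h' : ∀ v, RunAt g' c' v)
    (hg : ∀ u : S.prefixes, WordLT u.1 i.1 → g u = g' u) (hi : c i = c' i)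
    (hg' : ∀ u : S.prefixes, WordLT i.1 u.1 → g u = g' u) : c = c' := by
  have key : ∀ s : List σ, ∀ u : S.prefixes, u.1 = s → c u = c' u := by
    intro s
    induction s using (WordLT.wellFounded (σ := σ)).induction with
    | _ s ih =>
      rintro u rfl
      rcases WordLT.trichotomy u.1 i.1 with k | k | k
      · exact RunAt.congr h (h' u) (hg u k) fun w hw => ih _ hw w rfl
      · rw [Subtype.ext k, hi]
      · exact RunAt.congr h (h' u) (hg' u k) fun w hw => ih _ hw w rfl
  exact funext fun u => key _ u rfl

theorem exists_isBlockName (π : Setoid S.prefixes) (u : S.prefixes) :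
    ∃ w : S.prefixes, S.IsBlockName (Quotient.mk π u) w := by
  obtain ⟨s, ⟨w, hw, hwu⟩, hmin⟩ := WordLT.wellFounded.has_min
    {s : List σ | ∃ w : S.prefixes, w.1 = s ∧ Quotient.mk π w = Quotient.mk π u} ⟨u.1, u, rfl, rfl⟩
  exact ⟨w, hwu, fun v hv hlt => hmin v.1 ⟨v, rfl, hv⟩ (hw ▸ hlt)⟩

/-- A fresh prefix without a target opens a new block, and `ε` has no earlier prefix to be joined
with. So no coincidence is prescribed, and the prefix tree is deterministic already. -/
theorem RunAt.ker_eq_bot {t : S.prefixes → ℕ} {D : Set S.prefixes} (hS : S.Nonempty)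
    (hD : ∀ u ∈ D, u.1 = []) (h : ∀ u, RunAt (target t D) c u) : Setoid.ker c = ⊥ := by
  refine le_bot_iff.1 (RunAt.ker_le (hS := hS) h detCongr_bot fun u w hw hf e => ?_)
  exfalso
  have hu : u ∉ D := fun hu => WordLT.not_nil w.1 (hD u hu ▸ hw)
  rcases h u with ⟨v, hv, hs, -⟩ | ⟨-, n, hn, e'⟩
  · exact hf v hv hs
  · have := hn.1 w hw
    rw [target, if_neg hu] at e'
    omega

/-! ### An additional target as an iteration of the outer loop -/

section Step

variable {t t' : S.prefixes → ℕ} {i : S.prefixes}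

/-- The run with one more target, for the prefix `i`, if this target is an existing block. -/
theorem RunAt.isLeast (hc : ∀ u, RunAt (target t {u | WordLT u.1 i.1}) c u)
    (hc' : ∀ u, RunAt (target t' {u | ¬ WordLT i.1 u.1}) c' u)
    (ht : ∀ u : S.prefixes, WordLT u.1 i.1 → t u = t' u)
    (hi : S.IsBlockName (Quotient.mk (Setoid.ker c) i) i) {w : S.prefixes} (hw : WordLT w.1 i.1)
    (htw : t' i = c w) :
    IsLeast {ρ | (Setoid.ker c ≤ ρ ∧ ρ w i) ∧ (S.prefixTree hS).DetCongr ρ} (Setoid.ker c') := by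
  have hlow : ∀ u : S.prefixes, WordLT u.1 i.1 → c u = c' u := RunAt.eq_of_lt hc hc' fun u hu => by
    funext n
    have h2 : ¬ WordLT i.1 u.1 := hu.asymm
    simp [target, hu, h2, ht u hu]
  obtain ⟨hf, hn⟩ := RunAt.blocksBelow_of_isBlockName hc (target_le _ _) hi
  -- As the name of its block, `i` is fresh, so the target is consulted; it is an existing block, so
  -- the minimum with `n` does not change it.
  have hci : c' i = c w := by
    rcases hc' i with ⟨v, hv, hs, -⟩ | ⟨-, n, hn', e⟩
    · exact absurd hs ((hf.congr hlow) v hv)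
    · have e' := (hn.congr hlow).unique hn'
      have hwn := hn.1 w hw
      rw [e, target, if_pos (show i ∈ {u : S.prefixes | ¬ WordLT i.1 u.1} from WordLT.irrefl _),
        htw]
      omega
  -- Outside the set of used targets a fresh prefix opens a new block, so it shares its block with
  -- no earlier prefix and adds no coincidence to be checked.
  have high : ∀ {t : S.prefixes → ℕ} {D : Set S.prefixes} {c : S.prefixes → ℕ},
      (∀ u, RunAt (target t D) c u) → ∀ u w : S.prefixes, u ∉ D → WordLT w.1 u.1 →
      Fresh c u → c w ≠ c u := by
    intro t D c hc u w hu hwu hf e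
    rcases hc u with ⟨v, hv, hs, -⟩ | ⟨-, n, hn, e'⟩
    · exact hf v hv hs
    · have := hn.1 w hwu
      rw [target, if_neg hu] at e'
      omega
  refine ⟨⟨⟨?_, ?_⟩, RunAt.detCongr hc'⟩, ?_⟩
  · refine RunAt.ker_le (hS := hS) hc (RunAt.detCongr hc') fun u v hv hfu e => ?_
    change c' v = c' u
    by_cases hu : WordLT u.1 i.1
    · rw [← hlow u hu, ← hlow v (hv.trans hu), e]
    · exact absurd e (high hc u v hu hv hfu)
  · change c' w = c' i
    rw [← hlow w hw, hci]
  · rintro ρ ⟨⟨h1, h2⟩, h3⟩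
    refine RunAt.ker_le hc' h3 fun u v hv hfu e => ?_
    rcases WordLT.trichotomy u.1 i.1 with k | k | k
    · refine h1 ?_
      change c v = c u
      rw [hlow u k, hlow v (hv.trans k), e]
    · obtain rfl : u = i := Subtype.ext k
      refine ρ.trans (h1 ?_) h2
      change c v = c w
      rw [hlow v hv, e, hci]
    · exact absurd e (high hc' u v (by simpa using k) hv hfu)

/-- The target for the prefix `i` is not used, or it stands for a new block. -/
theorem RunAt.eq_of_not_used (hc : ∀ u, RunAt (target t {u | WordLT u.1 i.1}) c u)
    (hc' : ∀ u, RunAt (target t' {u | ¬ WordLT i.1 u.1}) c' u)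
    (ht : ∀ u : S.prefixes, WordLT u.1 i.1 → t u = t' u)
    (hi : S.IsBlockName (Quotient.mk (Setoid.ker c) i) i → c i ≤ t' i) : c = c' := by
  have hgl : ∀ u : S.prefixes, WordLT u.1 i.1 →
      target t {u | WordLT u.1 i.1} u = target t' {u | ¬ WordLT i.1 u.1} u := by
    intro u hu
    funext n
    have h2 : ¬ WordLT i.1 u.1 := hu.asymm
    simp [target, hu, h2, ht u hu]
  have hlow : ∀ u : S.prefixes, WordLT u.1 i.1 → c u = c' u := RunAt.eq_of_lt hc hc' hgl
  refine RunAt.eq_of_le hc hc' hgl ?_ fun u hu => ?_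
  · by_cases hf : Fresh c i
    -- The target of `i` is not yet used in `c`, so a fresh `i` opens a new block there, with number
    -- `c i`; a target from `c i` on does the same in `c'`.
    · have hin : S.IsBlockName (Quotient.mk (Setoid.ker c) i) i := by
        refine ⟨rfl, fun v hv hvi => ?_⟩
        have e : c v = c i := Quotient.exact (s := Setoid.ker c) hv
        rcases hc i with ⟨v, hv, hs, -⟩ | ⟨-, n, hn, e'⟩
        · exact hf v hv hs
        · have := hn.1 v hvi
          rw [target, if_neg (show i ∉ {u : S.prefixes | WordLT u.1 i.1} from WordLT.irrefl _)] at e'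
          omega
      obtain ⟨-, hn⟩ := RunAt.blocksBelow_of_isBlockName hc (target_le _ _) hin
      rcases hc' i with ⟨v, hv, hs, -⟩ | ⟨-, n, hn', e⟩
      · exact absurd hs ((hf.congr hlow) v hv)
      · rw [e, target, if_pos (show i ∈ {u : S.prefixes | ¬ WordLT i.1 u.1} from WordLT.irrefl _),
          (hn.congr hlow).unique hn']
        have := hi hin
        rw [(hn.congr hlow).unique hn'] at this
        omega
    · unfold Fresh at hf
      push Not at hf
      obtain ⟨v, hv, hs⟩ := hf
      rw [← RunAt.sameEdge hc hs, ← RunAt.sameEdge hc' (hs.congr hv hlow), hlow v hv]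
  · funext n
    have h2 : ¬ WordLT u.1 i.1 := hu.asymm
    simp [target, hu, h2]

/-- One iteration of the outer loop, in terms of runs: the least target is taken for which the run
is consistent with the ranks. -/
theorem RunAt.learnStep (hc : ∀ u, RunAt (target t {u | WordLT u.1 i.1}) c u)
    (hcons : (S.prefixTree hS).RankCons (Setoid.ker c))
    (hc' : ∀ u, RunAt (target t' {u | ¬ WordLT i.1 u.1}) c' u)
    (hcons' : (S.prefixTree hS).RankCons (Setoid.ker c'))
    (ht : ∀ u : S.prefixes, WordLT u.1 i.1 → t u = t' u)
    (hmin : ∀ q < t' i, ∃ t'' c'', (∀ u : S.prefixes, WordLT u.1 i.1 → t u = t'' u) ∧ t'' i = q ∧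
      (∀ u, RunAt (target t'' {u | ¬ WordLT i.1 u.1}) c'' u) ∧
      ¬ (S.prefixTree hS).RankCons (Setoid.ker c'')) :
    S.LearnStep hS i (Setoid.ker c) (Setoid.ker c') := by
  by_cases hi : S.IsBlockName (Quotient.mk (Setoid.ker c) i) i
  swap
  · rw [← RunAt.eq_of_not_used hc hc' ht fun k => absurd k hi]
    exact .not_name hi
  obtain ⟨-, hn⟩ := RunAt.blocksBelow_of_isBlockName hc (target_le _ _) hi
  have hrej : ∀ x : S.prefixes, WordLT x.1 i.1 → c x < t' i →
      S.Rejects hS (Setoid.ker c) (Quotient.mk _ x) (Quotient.mk _ i) := by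
    intro x hx hlt
    obtain ⟨t'', c'', h1, h2, h3, h4⟩ := hmin _ hlt
    -- A consistent candidate `ρ` would lie above the run for the target `c x`, which is the least
    -- candidate, and would make that run consistent.
    refine (rejects_iff hcons).2 fun ρ k1 k2 k3 k4 => h4 (k4.mono ?_)
    exact (RunAt.isLeast hc h3 h1 hi hx h2).2 ⟨⟨k1, k2⟩, k3⟩
  by_cases hlt : t' i < c i
  · obtain ⟨v, hv, ev⟩ := hn.2 _ hlt
    obtain ⟨w, hw⟩ := exists_isBlockName (Setoid.ker c) v
    have ew : c w = t' i := (Quotient.exact (s := Setoid.ker c) hw.1 : c w = c v).trans ev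
    have hwi : WordLT w.1 i.1 := by
      rcases WordLT.trichotomy v.1 w.1 with k | k | k
      · exact absurd k (hw.2 v rfl)
      · exact k ▸ hv
      · exact k.trans hv
    have hwn : S.IsBlockName (Quotient.mk (Setoid.ker c) w) w := ⟨rfl, hw.1 ▸ hw.2⟩
    refine .merged (Quotient.mk _ w) _ hi ⟨w, i, hwn, hi, hwi⟩ ?_
      ((accepts_iff hcons).2 ⟨RunAt.isLeast hc hc' ht hi hwi ew.symm, hcons'⟩)
    -- The prefix `w` opens its block when exactly the blocks with smaller numbers have been used,
    -- so the blocks below that of `w` have smaller numbers, and these targets have failed.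
    rintro B' ⟨x, w', hx, hw', hxw⟩
    obtain rfl := hx.1
    obtain rfl := hw'.eq hwn
    refine hrej x (hxw.trans hwi) ?_
    rw [← ew]
    exact (RunAt.blocksBelow_of_isBlockName hc (target_le _ _) hwn).2.1 x hxw
  -- From `c i` on, a target stands for a new block. The run is then unchanged, and all blocks below
  -- that of `i` have failed as targets.
  · rw [← RunAt.eq_of_not_used hc hc' ht fun _ => not_lt.1 hlt]
    refine .not_merged hi ?_
    rintro B' ⟨x, i', hx, hi', hxi⟩
    obtain rfl := hx.1
    obtain rfl := hi'.eq hi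
    exact hrej x hxi (lt_of_lt_of_le (hn.1 x hxi) (not_lt.1 hlt))

end Step

end Run

end Sample

/-! ### Reasoning about programs -/

namespace RAM

/-- The program `p`, started in the state `s`, halts after at most `c` steps in a state with the
property `Post`. -/
def Runs (p : Program) (s : State) (c : ℕ) (Post : State → Prop) : Prop :=
  ∃ u t, Exec p s u t ∧ t ≤ c ∧ Post u

/-- The registers a program may write to. -/
def Program.regs : Program → List ℕ
  | .skip => []
  | .set x _ => [x]
  | .put _ _ _ => []
  | .seq p q => p.regs ++ q.regs
  | .cond _ p q => p.regs ++ q.regs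
  | .loop _ p => p.regs

/-- The arrays a program may write to. -/
def Program.arrays : Program → List ℕ
  | .skip => []
  | .set _ _ => []
  | .put a _ _ => [a]
  | .seq p q => p.arrays ++ q.arrays
  | .cond _ p q => p.arrays ++ q.arrays
  | .loop _ p => p.arrays

/-- The program contains no loop. -/
def Program.straight : Program → Bool
  | .skip => true
  | .set _ _ => true
  | .put _ _ _ => true
  | .seq p q => p.straight && q.straight
  | .cond _ p q => p.straight && q.straight
  | .loop _ _ => false

/-- The effect of a program without loops. -/
def Program.apply : Program → State → State
  | .skip, s => s
  | .set x e, s => s.setReg x (e.eval s)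
  | .put a i e, s => s.setMem a (i.eval s) (e.eval s)
  | .seq p q, s => q.apply (p.apply s)
  | .cond e p q, s => if e.eval s = 0 then q.apply s else p.apply s
  | .loop _ _, s => s

/-- A bound for the number of steps of a program without loops. -/
def Program.bound : Program → ℕ
  | .skip => 1
  | .set _ e => e.cost + 1
  | .put _ i e => i.cost + e.cost + 1
  | .seq p q => p.bound + q.bound
  | .cond e p q => e.cost + 1 + (p.bound + q.bound)
  | .loop _ _ => 0

theorem Exec.reg_eq {p : Program} {s s' : State} {t : ℕ} (h : Exec p s s' t) {x : ℕ}
    (hx : x ∉ p.regs) : s'.reg x = s.reg x := by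
  induction h with
  | skip => rfl
  | set =>
    simp only [Program.regs, List.mem_singleton] at hx
    simp [State.setReg, Function.update_of_ne hx]
  | put => rfl
  | seq _ _ ih ih' =>
    simp only [Program.regs, List.mem_append, not_or] at hx
    rw [ih' hx.2, ih hx.1]
  | cond_true _ _ ih =>
    simp only [Program.regs, List.mem_append, not_or] at hx
    exact ih hx.1
  | cond_false _ _ ih =>
    simp only [Program.regs, List.mem_append, not_or] at hx
    exact ih hx.2
  | loop_true _ _ _ ih ih' => rw [ih' hx, ih hx]
  | loop_false _ => rfl

theorem Exec.mem_eq {p : Program} {s s' : State} {t : ℕ} (h : Exec p s s' t) {a : ℕ}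
    (ha : a ∉ p.arrays) : s'.mem a = s.mem a := by
  induction h with
  | skip => rfl
  | set => rfl
  | put =>
    simp only [Program.arrays, List.mem_singleton] at ha
    simp [State.setMem, Function.update_of_ne ha]
  | seq _ _ ih ih' =>
    simp only [Program.arrays, List.mem_append, not_or] at ha
    rw [ih' ha.2, ih ha.1]
  | cond_true _ _ ih =>
    simp only [Program.arrays, List.mem_append, not_or] at ha
    exact ih ha.1
  | cond_false _ _ ih =>
    simp only [Program.arrays, List.mem_append, not_or] at ha
    exact ih ha.2
  | loop_true _ _ _ ih ih' => rw [ih' ha, ih ha]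
  | loop_false _ => rfl

variable {p q : Program} {e : Expr} {s : State} {c c' : ℕ} {Post Post' : State → Prop}

theorem Runs.mono (h : Runs p s c Post) (hc : c ≤ c') (hp : ∀ s', Post s' → Post' s') :
    Runs p s c' Post' := by
  obtain ⟨s', t, h1, h2, h3⟩ := h
  exact ⟨s', t, h1, h2.trans hc, hp s' h3⟩

theorem Runs.frame (h : Runs p s c Post) :
    Runs p s c fun s' => Post s' ∧ (∀ x, x ∉ p.regs → s'.reg x = s.reg x) ∧
      ∀ a, a ∉ p.arrays → s'.mem a = s.mem a := by
  obtain ⟨s', t, h1, h2, h3⟩ := h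
  exact ⟨s', t, h1, h2, h3, fun x hx => h1.reg_eq hx, fun a ha => h1.mem_eq ha⟩

theorem Runs.seq (h : Runs p s c fun s' => Runs q s' c' Post) :
    Runs (.seq p q) s (c + c') Post := by
  obtain ⟨s', t, h1, h2, s'', t', h3, h4, h5⟩ := h
  exact ⟨s'', t + t', .seq h1 h3, add_le_add h2 h4, h5⟩

/-- Sequential composition, with a frame rule for the first program. -/
theorem Runs.seq_frame {Mid : State → Prop} (h : Runs p s c Mid)
    (h' : ∀ s', Mid s' → (∀ x, x ∉ p.regs → s'.reg x = s.reg x) →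
      (∀ a, a ∉ p.arrays → s'.mem a = s.mem a) → Runs q s' c' Post) :
    Runs (.seq p q) s (c + c') Post :=
  Runs.seq (h.frame.mono le_rfl fun s' k => h' s' k.1 k.2.1 k.2.2)

/-- For programs without loops, verification becomes the computation of `apply`. The bound adds up
both branches of a test, which makes it a constant of the program. -/
theorem Runs.straight (hp : p.straight = true) (h : Post (p.apply s)) :
    Runs p s p.bound Post := by
  suffices ∃ t, Exec p s (p.apply s) t ∧ t ≤ p.bound by
    obtain ⟨t, h1, h2⟩ := this
    exact ⟨_, t, h1, h2, h⟩
  clear h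
  induction p generalizing s with
  | skip => exact ⟨_, .skip, le_rfl⟩
  | set x e => exact ⟨_, .set, le_rfl⟩
  | put a i e => exact ⟨_, .put, le_rfl⟩
  | seq p q ihp ihq =>
    simp only [Program.straight, Bool.and_eq_true] at hp
    obtain ⟨t, h1, h2⟩ := ihp (s := s) hp.1
    obtain ⟨t', h1', h2'⟩ := ihq (s := p.apply s) hp.2
    exact ⟨_, .seq h1 h1', add_le_add h2 h2'⟩
  | cond e p q ihp ihq =>
    simp only [Program.straight, Bool.and_eq_true] at hp
    by_cases he : e.eval s = 0
    · obtain ⟨t, h1, h2⟩ := ihq (s := s) hp.2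
      refine ⟨e.cost + 1 + t, ?_, ?_⟩
      · simp only [Program.apply, if_pos he]
        exact .cond_false he h1
      · simp only [Program.bound]
        omega
    · obtain ⟨t, h1, h2⟩ := ihp (s := s) hp.1
      refine ⟨e.cost + 1 + t, ?_, ?_⟩
      · simp only [Program.apply, if_neg he]
        exact .cond_true he h1
      · simp only [Program.bound]
        omega
  | loop e p => simp [Program.straight] at hp

theorem Runs.cond_true (he : e.eval s ≠ 0) (h : Runs p s c Post) :
    Runs (.cond e p q) s (e.cost + 1 + c) Post := by
  obtain ⟨s', t, h1, h2, h3⟩ := h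
  exact ⟨s', _, .cond_true he h1, by omega, h3⟩

theorem Runs.cond_false (he : e.eval s = 0) (h : Runs q s c Post) :
    Runs (.cond e p q) s (e.cost + 1 + c) Post := by
  obtain ⟨s', t, h1, h2, h3⟩ := h
  exact ⟨s', _, .cond_false he h1, by omega, h3⟩

/-- A loop that makes at most `n` rounds. -/
theorem Runs.while {Inv : ℕ → State → Prop} (n : ℕ) (h0 : Inv 0 s)
    (hstep : ∀ i s, i ≤ n → Inv i s → e.eval s ≠ 0 → i < n ∧ Runs p s c (Inv (i + 1))) :
    Runs (.loop e p) s ((n + 1) * (c + e.cost + 1))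
      fun s' => e.eval s' = 0 ∧ ∃ i ≤ n, Inv i s' := by
  -- Here `m` counts the rounds that are still allowed.
  suffices ∀ m i s, i + m = n → Inv i s → Runs (.loop e p) s ((m + 1) * (c + e.cost + 1))
      fun s' => e.eval s' = 0 ∧ ∃ i ≤ n, Inv i s' from this n 0 s (by omega) h0
  intro m
  induction m with
  | zero =>
    intro i s hi h
    by_cases he : e.eval s = 0
    · exact ⟨s, _, .loop_false he, by omega, he, i, by omega, h⟩
    · have := (hstep i s (by omega) h he).1
      omega
  | succ m ih =>
    intro i s hi h
    by_cases he : e.eval s = 0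
    · refine ⟨s, _, .loop_false he, ?_, he, i, by omega, h⟩
      rw [add_mul]
      omega
    · obtain ⟨s', t, h1, h2, h3⟩ := (hstep i s (by omega) h he).2
      obtain ⟨s'', t', k1, k2, k3⟩ := ih (i + 1) s' (by omega) h3
      refine ⟨s'', _, .loop_true he h1 k1, ?_, k3⟩
      rw [add_mul (m + 1)]
      omega

/-- A loop that makes `n` rounds. -/
theorem Runs.for {Inv : ℕ → State → Prop} (n : ℕ) (h0 : Inv 0 s)
    (he : ∀ i s, i ≤ n → Inv i s → (e.eval s ≠ 0 ↔ i < n))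
    (hstep : ∀ i s, i < n → Inv i s → Runs p s c (Inv (i + 1))) :
    Runs (.loop e p) s ((n + 1) * (c + e.cost + 1)) (Inv n) := by
  refine (Runs.while (c := c) n h0 fun i s hi h k => ?_).mono le_rfl ?_
  · have := (he i s hi h).1 k
    exact ⟨this, hstep i s this h⟩
  · rintro s ⟨h1, i, hi, h2⟩
    have := (he i s hi h2).2.mt (by simp [h1])
    obtain rfl : i = n := by omega
    exact h2

@[simp] theorem State.setReg_reg (s : State) (x v y : ℕ) :
    (s.setReg x v).reg y = if y = x then v else s.reg y := by
  simp [State.setReg, Function.update_apply]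

@[simp] theorem State.setReg_mem (s : State) (x v : ℕ) : (s.setReg x v).mem = s.mem := rfl

@[simp] theorem State.setMem_reg (s : State) (a i v : ℕ) : (s.setMem a i v).reg = s.reg := rfl

@[simp] theorem State.setMem_mem (s : State) (a i v b j : ℕ) :
    (s.setMem a i v).mem b j = if b = a then (if j = i then v else s.mem b j) else s.mem b j := by
  by_cases h : b = a
  · subst h
    simp [State.setMem, Function.update_apply]
  · simp [State.setMem, h]

/-- The array `m` contains the list from the position `p` on. -/
def InputAt (m : ℕ → ℕ) : ℕ → List ℕ → Prop
  | _, [] => True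
  | p, x :: xs => m p = x ∧ InputAt m (p + 1) xs

theorem InputAt.append {m : ℕ → ℕ} {p : ℕ} {xs ys : List ℕ} :
    InputAt m p (xs ++ ys) ↔ InputAt m p xs ∧ InputAt m (p + xs.length) ys := by
  induction xs generalizing p with
  | nil => simp [InputAt]
  | cons x xs ih =>
    simp only [List.cons_append, InputAt, ih, List.length_cons, and_assoc]
    rw [show p + 1 + xs.length = p + (xs.length + 1) by omega]

/-- The part `ys` that has already been passed is there for the induction. -/
theorem inputAt_getD (xs ys : List ℕ) :
    InputAt (fun i => (ys ++ xs).getD i 0) ys.length xs := by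
  induction xs generalizing ys with
  | nil => trivial
  | cons x xs ih =>
    refine ⟨by simp, ?_⟩
    have := ih (ys ++ [x])
    simpa using this

end RAM

/-! ### The numbering of the letters -/

section LetterCode

variable {σ : Type*} [Fintype σ] [LinearOrder σ]

theorem letterCode_lt_iff {a b : σ} : letterCode a < letterCode b ↔ a < b := by
  have key : ∀ {a b : σ}, a < b → letterCode a < letterCode b := by
    intro a b h
    refine Finset.card_lt_card ⟨?_, fun hsub => ?_⟩
    · intro c hc
      simp only [Finset.mem_filter, Finset.mem_univ, true_and] at hc ⊢
      exact hc.trans h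
    · have := hsub (x := a) (by simpa using h)
      simp at this
  refine ⟨fun h => ?_, key⟩
  rcases lt_trichotomy a b with k | rfl | k
  · exact k
  · exact absurd h (lt_irrefl _)
  · exact absurd h (key k).not_gt

theorem letterCode_injective : Function.Injective (letterCode (σ := σ)) := by
  intro a b h
  rcases lt_trichotomy a b with k | k | k
  · exact absurd h (letterCode_lt_iff.2 k).ne
  · exact k
  · exact absurd h (letterCode_lt_iff.2 k).ne'

theorem letterCode_lt_card (a : σ) : letterCode a < Fintype.card σ := by
  refine Finset.card_lt_card ⟨Finset.subset_univ _, fun h => ?_⟩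
  have := h (Finset.mem_univ a)
  simp at this

theorem exists_letterCode_eq {i : ℕ} (h : i < Fintype.card σ) : ∃ a : σ, letterCode a = i := by
  let f : σ → Fin (Fintype.card σ) := fun a => ⟨letterCode a, letterCode_lt_card a⟩
  have hf : Function.Injective f := fun u v e => letterCode_injective (congrArg Fin.val e)
  obtain ⟨a, ha⟩ := ((Fintype.bijective_iff_injective_and_card f).2 ⟨hf, by simp⟩).2 ⟨i, h⟩
  exact ⟨a, congrArg Fin.val ha⟩

/-- The index of a table with rows of length `k` determines the row and the column. -/
theorem tableIndex_inj {k b b' x x' : ℕ} (hx : x < k) (hx' : x' < k)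
    (h : b * k + x = b' * k + x') : b = b' ∧ x = x' := by
  have hb : (b * k + x) / k = b := by
    rw [mul_comm, Nat.mul_add_div (by omega), Nat.div_eq_of_lt hx, add_zero]
  have hb' : (b' * k + x') / k = b' := by
    rw [mul_comm, Nat.mul_add_div (by omega), Nat.div_eq_of_lt hx', add_zero]
  have e : b = b' := by rw [← hb, ← hb', h]
  subst e
  exact ⟨rfl, by omega⟩

theorem tableIndex_lt {k b n x : ℕ} (hx : x < k) (hb : b < n) : b * k + x < n * k := by
  calc b * k + x < b * k + k := by omega
    _ = (b + 1) * k := by ring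
    _ ≤ n * k := Nat.mul_le_mul_right k hb

end LetterCode

/-! ### Reading the input

The words of the sample are read into a trie, whose nodes are numbered in the order of their
creation. Register `3` holds the size of the alphabet, register `4` the number of triples, register
`5` the reading position, register `6` the number of nodes, register `7` the current node and
register `9` the number of triples that have been read. Array `5` is the table of the children (`0`
is "undefined"), array `6` contains the beginnings of its rows, and arrays `7`, `8` and `9` contain
the nodes of the two words and the label of each triple. -/

namespace Learner

open RAM

variable {σ : Type*} [Fintype σ] [LinearOrder σ]

/-- The nodes of the trie stand for the words in `P`, numbered by `nd`. -/
structure IsTrie (P : Finset (List σ)) (nd : List σ → ℕ) (s : State) : Prop where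
  nil_mem : [] ∈ P
  closed : ∀ u a, u ++ [a] ∈ P → u ∈ P
  nd_nil : nd [] = 0
  inj : ∀ u ∈ P, ∀ v ∈ P, nd u = nd v → u = v
  lt : ∀ u ∈ P, nd u < P.card
  card : s.reg 6 = P.card
  alphabet : s.reg 3 = Fintype.card σ
  row : ∀ i < P.card, s.mem 6 i = i * Fintype.card σ
  child : ∀ u ∈ P, ∀ a, u ++ [a] ∈ P →
    s.mem 5 (nd u * Fintype.card σ + letterCode a) = nd (u ++ [a])
  no_child : ∀ u ∈ P, ∀ a, u ++ [a] ∉ P → s.mem 5 (nd u * Fintype.card σ + letterCode a) = 0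
  zero : ∀ i, P.card * Fintype.card σ ≤ i → s.mem 5 i = 0

theorem IsTrie.congr {P : Finset (List σ)} {nd : List σ → ℕ} {s s' : State} (h : IsTrie P nd s)
    (h3 : s'.reg 3 = s.reg 3) (h6 : s'.reg 6 = s.reg 6) (m5 : s'.mem 5 = s.mem 5)
    (m6 : s'.mem 6 = s.mem 6) : IsTrie P nd s' where
  nil_mem := h.nil_mem
  closed := h.closed
  nd_nil := h.nd_nil
  inj := h.inj
  lt := h.lt
  card := h6.trans h.card
  alphabet := h3.trans h.alphabet
  row := m6 ▸ h.row
  child := m5 ▸ h.child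
  no_child := m5 ▸ h.no_child
  zero := m5 ▸ h.zero

/-- The root has the number `0` and is nobody's child, so `0` is free to mean "undefined" in the
table of the children, whose entries need no shift. -/
theorem IsTrie.nd_ne_zero {P : Finset (List σ)} {nd : List σ → ℕ} {s : State} (h : IsTrie P nd s)
    {u : List σ} {a : σ} (hu : u ++ [a] ∈ P) : nd (u ++ [a]) ≠ 0 := by
  intro e
  rw [← h.nd_nil] at e
  simpa using h.inj _ hu _ h.nil_mem e

/-- There is no multiplication, so the beginning of a new row is obtained from the previous row by
adding the size of the alphabet. -/
def addNode : Program :=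
  .seq (.put 5 (.reg 10) (.reg 6)) <|
  .seq (.put 6 (.reg 6) (.add (.get 6 (.sub (.reg 6) (.lit 1))) (.reg 3))) <|
  .set 6 (.add (.reg 6) (.lit 1))

def readLetter : Program :=
  .seq (.set 10 (.add (.get 6 (.reg 7)) (.get 0 (.reg 5)))) <|
  .seq (.set 5 (.add (.reg 5) (.lit 1))) <|
  .seq (.cond (.get 5 (.reg 10)) .skip addNode) <|
  .seq (.set 7 (.get 5 (.reg 10))) <|
  .set 8 (.sub (.reg 8) (.lit 1))

/-- The body of the loop over the triples reads a word with this program, for `X = 7` and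
`X = 8`. -/
def readWord (X : ℕ) : Program :=
  .seq (.set 8 (.get 0 (.reg 5))) <|
  .seq (.set 5 (.add (.reg 5) (.lit 1))) <|
  .seq (.set 7 (.lit 0)) <|
  .seq (.loop (.reg 8) readLetter) <|
  .put X (.reg 9) (.reg 7)

def readTriple : Program :=
  .seq (.seq (.put 9 (.reg 9) (.get 0 (.reg 5))) (.set 5 (.add (.reg 5) (.lit 1)))) <|
  .seq (readWord 7) <|
  .seq (readWord 8) <|
  .set 9 (.add (.reg 9) (.lit 1))

def readSample : Program :=
  .seq (.seq (.set 3 (.get 0 (.lit 0))) <| .seq (.set 4 (.get 0 (.lit 1))) <|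
    .seq (.set 5 (.lit 2)) (.set 6 (.lit 1))) <|
  .loop (.sub (.reg 4) (.reg 9)) readTriple

/-- If the child exists, the trie is unchanged. Otherwise one new node is added; table rows of
different nodes are disjoint, so the new entry disturbs no other one. -/
theorem readLetter_spec {P : Finset (List σ)} {nd : List σ → ℕ} {s : State} (h : IsTrie P nd s)
    {u : List σ} (hu : u ∈ P) (a : σ) (h7 : s.reg 7 = nd u)
    (hin : s.mem 0 (s.reg 5) = letterCode a) :
    ∃ nd', IsTrie (insert (u ++ [a]) P) nd' (readLetter.apply s) ∧ (∀ v ∈ P, nd' v = nd v) ∧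
      (readLetter.apply s).reg 7 = nd' (u ++ [a]) ∧
      (readLetter.apply s).reg 5 = s.reg 5 + 1 ∧ (readLetter.apply s).reg 8 = s.reg 8 - 1 := by
  have hrow := h.row _ (h.lt u hu)
  by_cases hua : u ++ [a] ∈ P
  · have hch := h.child u hu a hua
    have hne := h.nd_ne_zero hua
    rw [Finset.insert_eq_of_mem hua]
    have e : readLetter.apply s = (((s.setReg 10 (nd u * Fintype.card σ + letterCode a)).setReg 5
        (s.reg 5 + 1)).setReg 7 (nd (u ++ [a]))).setReg 8 (s.reg 8 - 1) := by
      simp [readLetter, Program.apply, Expr.eval, h7, hrow, hin, hch, hne]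
    rw [e]
    exact ⟨nd, h.congr (by simp) (by simp) (by simp) (by simp), fun v _ => rfl, by simp, by simp,
      by simp⟩
  · have hch := h.no_child u hu a hua
    have hpos : 0 < P.card := Finset.card_pos.2 ⟨_, hu⟩
    have hlast := h.row (P.card - 1) (by omega)
    have e : readLetter.apply s = ((((((s.setReg 10 (nd u * Fintype.card σ + letterCode a)).setReg 5
        (s.reg 5 + 1)).setMem 5 (nd u * Fintype.card σ + letterCode a) P.card).setMem 6 P.card
        (P.card * Fintype.card σ)).setReg 6 (P.card + 1)).setReg 7 P.card).setReg 8
        (s.reg 8 - 1) := by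
      have : (P.card - 1) * Fintype.card σ + Fintype.card σ = P.card * Fintype.card σ := by
        rw [← Nat.succ_mul, Nat.succ_eq_add_one, Nat.sub_add_cancel hpos]
      simp [readLetter, addNode, Program.apply, Expr.eval, h7, hrow, hin, hch, h.card, h.alphabet,
        hlast, this]
    rw [e]
    have hcard : (insert (u ++ [a]) P).card = P.card + 1 := Finset.card_insert_of_notMem hua
    have hnew : ∀ v ∈ P, v ≠ u ++ [a] := fun v hv e => hua (e ▸ hv)
    have hk : letterCode a < Fintype.card σ := letterCode_lt_card a
    -- The nodes are numbered consecutively, so the first unused number is `P.card`.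
    refine ⟨Function.update nd (u ++ [a]) P.card, ?_, fun v hv => ?_, by simp, by simp, by simp⟩
    swap
    · rw [Function.update_of_ne (hnew v hv)]
    have old : ∀ v ∈ P, Function.update nd (u ++ [a]) P.card v = nd v := fun v hv => by
      rw [Function.update_of_ne (hnew v hv)]
    have new : Function.update nd (u ++ [a]) P.card (u ++ [a]) = P.card := Function.update_self ..
    refine ⟨by simp [h.nil_mem], ?_, ?_, ?_, ?_, by simp [hcard], by simp [h.alphabet], ?_, ?_, ?_,
      ?_⟩
    · intro v b hv
      rcases Finset.mem_insert.1 hv with k | k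
      · obtain ⟨rfl, -⟩ := List.append_inj' k rfl
        exact Finset.mem_insert_of_mem hu
      · exact Finset.mem_insert_of_mem (h.closed v b k)
    · rw [old _ h.nil_mem, h.nd_nil]
    · intro v hv w hw e
      rcases Finset.mem_insert.1 hv with rfl | kv <;> rcases Finset.mem_insert.1 hw with rfl | kw
      · rfl
      · rw [new, old w kw] at e
        have := h.lt w kw
        omega
      · rw [new, old v kv] at e
        have := h.lt v kv
        omega
      · rw [old v kv, old w kw] at e
        exact h.inj v kv w kw e
    · intro v hv
      rw [hcard]
      rcases Finset.mem_insert.1 hv with rfl | kv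
      · rw [new]; omega
      · rw [old v kv]
        have := h.lt v kv
        omega
    · intro i hi
      rw [hcard] at hi
      by_cases e : i = P.card
      · simp [e]
      · simp only [State.setReg_mem, State.setMem_mem]
        simp [e, h.row i (by omega)]
    · intro v hv b hvb
      rcases Finset.mem_insert.1 hvb with k | k
      · obtain ⟨rfl, eb⟩ := List.append_inj' k rfl
        obtain rfl : b = a := by simpa using eb
        rw [new, old v hu]
        simp
      · have hvP := h.closed v b k
        rw [old v hvP, old _ k]
        have hne : nd v * Fintype.card σ + letterCode b ≠ nd u * Fintype.card σ + letterCode a := by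
          intro e
          obtain ⟨e1, e2⟩ := tableIndex_inj (letterCode_lt_card b) hk e
          have h1 := h.inj v hvP u hu e1
          have h2 := letterCode_injective e2
          subst h1 h2
          exact hua k
        simp [hne, h.child v hvP b k]
    · intro v hv b hvb
      have hvb' : v ++ [b] ∉ P := fun k => hvb (Finset.mem_insert_of_mem k)
      rcases Finset.mem_insert.1 hv with rfl | kv
      · rw [new]
        -- The row of the new node lies behind all rows in use, where the table still contains
        -- zeros.
        have hlt := tableIndex_lt hk (h.lt u hu)
        have hz := h.zero (P.card * Fintype.card σ + letterCode b) (by omega)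
        have hne : P.card * Fintype.card σ + letterCode b ≠
            nd u * Fintype.card σ + letterCode a := by omega
        simp [hne, hz]
      · rw [old v kv]
        have hne : nd v * Fintype.card σ + letterCode b ≠ nd u * Fintype.card σ + letterCode a := by
          intro e
          obtain ⟨e1, e2⟩ := tableIndex_inj (letterCode_lt_card b) hk e
          have h1 := h.inj v kv u hu e1
          have h2 := letterCode_injective e2
          subst h1 h2
          exact hvb (Finset.mem_insert_self _ _)
        simp [hne, h.no_child v kv b hvb']
    · intro i hi
      rw [hcard, add_mul] at hi
      have hlt := tableIndex_lt hk (h.lt u hu)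
      have hne : i ≠ nd u * Fintype.card σ + letterCode a := by omega
      simp [hne, h.zero i (by omega)]

/-- The word `u` is the part that has been read; leaving it arbitrary makes the induction on the
remaining letters possible. -/
theorem readLetters_spec (w : List σ) : ∀ {P : Finset (List σ)} {nd : List σ → ℕ} {s : State},
    IsTrie P nd s → ∀ u ∈ P, s.reg 7 = nd u → s.reg 8 = w.length →
    InputAt (s.mem 0) (s.reg 5) (w.map letterCode) →
    Runs (.loop (.reg 8) readLetter) s (w.length * (readLetter.bound + 2) + 2) fun s' =>
      ∃ P' nd', IsTrie P' nd' s' ∧ (∀ v, v ∈ P' ↔ v ∈ P ∨ ∃ y, y <+: w ∧ v = u ++ y) ∧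
        (∀ v ∈ P, nd' v = nd v) ∧ s'.reg 7 = nd' (u ++ w) ∧ s'.reg 5 = s.reg 5 + w.length := by
  induction w with
  | nil =>
    intro P nd s h u hu h7 h8 hin
    refine ⟨s, _, .loop_false (by simpa [Expr.eval] using h8), by simp [Expr.cost], P, nd, h, ?_,
      fun _ _ => rfl, by simpa using h7, by simp⟩
    intro v
    simp only [List.prefix_nil, exists_eq_left, List.append_nil]
    exact ⟨Or.inl, fun k => k.elim id fun e => e ▸ hu⟩
  | cons a w ih =>
    intro P nd s h u hu h7 h8 hin
    obtain ⟨hin1, hin2⟩ := hin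
    obtain ⟨nd', k1, k2, k3, k4, k5⟩ := readLetter_spec h hu a h7 hin1
    obtain ⟨s1, t1, e1, l1, rfl⟩ := Runs.straight (p := readLetter) (s := s)
      (Post := fun s' => s' = readLetter.apply s) rfl rfl
    have m0 : (readLetter.apply s).mem 0 = s.mem 0 := e1.mem_eq (by decide)
    obtain ⟨s2, t2, e2, l2, P', nd'', q1, q2, q3, q4, q5⟩ := ih k1 (u ++ [a])
      (Finset.mem_insert_self _ _) k3 (by rw [k5, h8]; simp) (by rw [m0, k4]; exact hin2)
    refine ⟨s2, _, .loop_true (by simp [Expr.eval, h8]) e1 e2, ?_, P', nd'', q1, ?_, ?_, ?_, ?_⟩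
    · simp only [Expr.cost, List.length_cons, add_mul, one_mul]
      omega
    · intro v
      rw [q2, Finset.mem_insert]
      constructor
      · rintro ((rfl | k) | ⟨y, hy, rfl⟩)
        · exact Or.inr ⟨[a], by simp, rfl⟩
        · exact Or.inl k
        · exact Or.inr ⟨a :: y, by simpa using hy, by simp⟩
      · rintro (k | ⟨y, hy, rfl⟩)
        · exact Or.inl (Or.inr k)
        · cases y with
          | nil => exact Or.inl (Or.inr (by simpa using hu))
          | cons b y =>
            obtain ⟨rfl, hy'⟩ := List.cons_prefix_cons.1 hy
            exact Or.inr ⟨y, hy', by simp⟩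
    · intro v hv
      rw [q3 v (Finset.mem_insert_of_mem hv), k2 v hv]
    · rw [q4]; simp
    · rw [q5, k4, List.length_cons]; omega

theorem readWord_spec (X : ℕ) (hX : X = 7 ∨ X = 8) (w : List σ) {P : Finset (List σ)}
    {nd : List σ → ℕ} {s : State} (h : IsTrie P nd s)
    (hin : InputAt (s.mem 0) (s.reg 5) (wordCode w)) :
    Runs (readWord X) s (w.length * (readLetter.bound + 2) + 20) fun s' =>
      ∃ P' nd', IsTrie P' nd' s' ∧ (∀ v, v ∈ P' ↔ v ∈ P ∨ v <+: w) ∧ (∀ v ∈ P, nd' v = nd v) ∧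
        s'.reg 5 = s.reg 5 + w.length + 1 ∧
        ∀ j, s'.mem X j = if j = s.reg 9 then nd' w else s.mem X j := by
  obtain ⟨hin1, hin2⟩ := hin
  have m : ∀ {s s' : State} {t : ℕ}, Exec (.loop (.reg 8) readLetter) s s' t →
      s'.reg 9 = s.reg 9 ∧ s'.mem X = s.mem X := by
    intro s s' t e
    refine ⟨e.reg_eq (by decide), e.mem_eq ?_⟩
    rcases hX with rfl | rfl <;> decide
  let s1 := ((s.setReg 8 w.length).setReg 5 (s.reg 5 + 1)).setReg 7 0
  have hs1 : IsTrie P nd s1 := h.congr (by simp [s1]) (by simp [s1]) (by simp [s1]) (by simp [s1])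
  obtain ⟨s2, t2, e2, l2, P', nd', q1, q2, q3, q4, q5⟩ := readLetters_spec w hs1 [] h.nil_mem
    (by simp [s1, h.nd_nil]) (by simp [s1]) (by simpa [s1] using hin2)
  obtain ⟨m1, m2⟩ := m e2
  have e1 : Exec (.set 8 (.get 0 (.reg 5))) s (s.setReg 8 w.length) 3 := by
    have := Exec.set (x := 8) (e := .get 0 (.reg 5)) (s := s)
    simpa [Expr.eval, hin1, Expr.cost] using this
  have e1' : Exec (.set 5 (.add (.reg 5) (.lit 1))) (s.setReg 8 w.length)
      ((s.setReg 8 w.length).setReg 5 (s.reg 5 + 1)) 4 := by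
    have := Exec.set (x := 5) (e := .add (.reg 5) (.lit 1)) (s := s.setReg 8 w.length)
    simpa [Expr.eval, Expr.cost] using this
  refine ⟨_, _, .seq e1 (.seq e1' (.seq .set (.seq e2 .put))), ?_, P', nd', ?_, ?_, q3, ?_, ?_⟩
  · simp only [Expr.cost]
    omega
  · rcases hX with rfl | rfl <;>
    exact q1.congr (by simp) (by simp) (by funext j; simp) (by funext j; simp)
  · intro v
    rw [q2]
    simp
  · simp only [State.setMem_reg, q5]
    simp [s1]
    omega
  · intro j
    have : s1.reg 9 = s.reg 9 := by simp [s1]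
    simp only [State.setMem_mem, if_true, Expr.eval, m1, this, q4, List.nil_append, m2]
    rfl

/-- What is known after the triples in `l` have been read. -/
structure Triples (l : List (List σ × List σ × Comparison)) (P : Finset (List σ))
    (nd : List σ → ℕ) (s : State) : Prop where
  trie : IsTrie P nd s
  mem : ∀ v, v ∈ P ↔ v = [] ∨ ∃ x ∈ l, v <+: x.1 ∨ v <+: x.2.1
  left : ∀ j (h : j < l.length), s.mem 7 j = nd l[j].1
  right : ∀ j (h : j < l.length), s.mem 8 j = nd l[j].2.1
  label : ∀ j (h : j < l.length), s.mem 9 j = l[j].2.2.code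
  count : s.reg 9 = l.length

theorem readTriple_spec {l : List (List σ × List σ × Comparison)} {P : Finset (List σ)}
    {nd : List σ → ℕ} {s : State} (h : Triples l P nd s) (x : List σ × List σ × Comparison)
    (hin : InputAt (s.mem 0) (s.reg 5) (x.2.2.code :: (wordCode x.1 ++ wordCode x.2.1))) :
    Runs readTriple s ((x.1.length + x.2.1.length) * (readLetter.bound + 2) + 60) fun s' =>
      (∃ P' nd', Triples (l ++ [x]) P' nd' s') ∧
        s'.reg 5 = s.reg 5 + (x.1.length + x.2.1.length + 3) := by
  obtain ⟨hin0, hin⟩ := hin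
  obtain ⟨hin1, hin2⟩ := InputAt.append.1 hin
  obtain ⟨s1, t1, e1, l1, rfl⟩ := Runs.straight
    (p := .seq (.put 9 (.reg 9) (.get 0 (.reg 5))) (.set 5 (.add (.reg 5) (.lit 1)))) (s := s)
    (Post := fun s' => s' = (s.setMem 9 (s.reg 9) x.2.2.code).setReg 5 (s.reg 5 + 1)) rfl
    (by simp [Program.apply, Expr.eval, hin0])
  have m0 : ((s.setMem 9 (s.reg 9) x.2.2.code).setReg 5 (s.reg 5 + 1)).mem 0 = s.mem 0 :=
    e1.mem_eq (by decide)
  set s1 := (s.setMem 9 (s.reg 9) x.2.2.code).setReg 5 (s.reg 5 + 1) with hs1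
  have r5 : s1.reg 5 = s.reg 5 + 1 := by simp [hs1]
  have hT1 : IsTrie P nd s1 := h.trie.congr (by simp [hs1]) (by simp [hs1])
    (by funext j; simp [hs1]) (by funext j; simp [hs1])
  obtain ⟨s2, t2, e2, l2, P2, nd2, a1, a2, a3, a4, a5⟩ := readWord_spec 7 (Or.inl rfl) x.1 hT1
    (by rw [m0, r5]; exact hin1)
  have m0' : s2.mem 0 = s1.mem 0 := e2.mem_eq (by decide)
  have r9 : s2.reg 9 = s1.reg 9 := e2.reg_eq (by decide)
  obtain ⟨s3, t3, e3, l3, P3, nd3, b1, b2, b3, b4, b5⟩ := readWord_spec 8 (Or.inr rfl) x.2.1 a1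
    (by
      rw [m0', m0, a4, r5]
      convert hin2 using 1
      simp [wordCode]
      omega)
  have r9' : s3.reg 9 = s2.reg 9 := e3.reg_eq (by decide)
  have r9'' : s1.reg 9 = l.length := by simp [hs1, h.count]
  have m7 : s3.mem 7 = s2.mem 7 := e3.mem_eq (by decide)
  have m8 : s2.mem 8 = s1.mem 8 := e2.mem_eq (by decide)
  have m9 : s3.mem 9 = s2.mem 9 := e3.mem_eq (by decide)
  have m9' : s2.mem 9 = s1.mem 9 := e2.mem_eq (by decide)
  refine ⟨_, _, .seq e1 (.seq e2 (.seq e3 .set)), ?_, ⟨P3, nd3, ?_⟩, ?_⟩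
  · simp only [Expr.cost, add_mul]
    simp only [Program.bound, Expr.cost] at l1
    omega
  · have hP : ∀ y ∈ l, y.1 ∈ P ∧ y.2.1 ∈ P := fun y hy =>
      ⟨(h.mem _).2 (Or.inr ⟨y, hy, Or.inl List.prefix_rfl⟩),
        (h.mem _).2 (Or.inr ⟨y, hy, Or.inr List.prefix_rfl⟩)⟩
    have hnd : ∀ v ∈ P, nd3 v = nd v := fun v hv => by
      rw [b3 v ((a2 v).2 (Or.inl hv)), a3 v hv]
    refine ⟨b1.congr (by simp) (by simp) (by simp) (by simp), ?_, ?_, ?_, ?_, ?_⟩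
    · intro v
      rw [b2, a2, h.mem]
      simp only [List.mem_append, List.mem_singleton]
      constructor
      · rintro (((k | ⟨y, hy, k⟩) | k) | k)
        · exact Or.inl k
        · exact Or.inr ⟨y, Or.inl hy, k⟩
        · exact Or.inr ⟨x, Or.inr rfl, Or.inl k⟩
        · exact Or.inr ⟨x, Or.inr rfl, Or.inr k⟩
      · rintro (k | ⟨y, hy | rfl, k⟩)
        · exact Or.inl (Or.inl (Or.inl k))
        · exact Or.inl (Or.inl (Or.inr ⟨y, hy, k⟩))
        · rcases k with k | k
          · exact Or.inl (Or.inr k)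
          · exact Or.inr k
    · intro j hj
      simp only [State.setReg_mem, m7, a5, r9'']
      by_cases e : j = l.length
      · subst e
        simpa using (b3 x.1 ((a2 _).2 (Or.inr List.prefix_rfl))).symm
      · have hj' : j < l.length := by simp at hj; omega
        rw [if_neg e, List.getElem_append_left hj', hnd _ (hP _ (List.getElem_mem hj')).1,
          ← h.left j hj']
        simp [hs1]
    · intro j hj
      simp only [State.setReg_mem, b5, r9, r9'']
      by_cases e : j = l.length
      · subst e
        simp
      · have hj' : j < l.length := by simp at hj; omega
        rw [if_neg e, List.getElem_append_left hj', hnd _ (hP _ (List.getElem_mem hj')).2,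
          ← h.right j hj', m8]
        simp [hs1]
    · intro j hj
      simp only [State.setReg_mem, m9, m9', hs1, State.setMem_mem, if_true, h.count]
      by_cases e : j = l.length
      · subst e
        simp
      · have hj' : j < l.length := by simp at hj; omega
        rw [if_neg e, List.getElem_append_left hj', ← h.label j hj']
    · simp [Expr.eval, r9', r9, r9'']
  · simp only [State.setReg_reg]
    simp [b4, a4, r5]
    omega

/-- The total length of the words in a list of triples. -/
def listLength (l : List (List σ × List σ × Comparison)) : ℕ :=
  (l.map fun x => x.1.length + x.2.1.length).sum

theorem readTriples_spec (l' : List (List σ × List σ × Comparison)) :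
    ∀ {l : List (List σ × List σ × Comparison)} {P : Finset (List σ)} {nd : List σ → ℕ} {s : State},
    Triples l P nd s → s.reg 4 = l.length + l'.length →
    InputAt (s.mem 0) (s.reg 5)
      (l'.flatMap fun x => x.2.2.code :: (wordCode x.1 ++ wordCode x.2.1)) →
    Runs (.loop (.sub (.reg 4) (.reg 9)) readTriple) s
      (listLength l' * (readLetter.bound + 2) + l'.length * 64 + 4) fun s' =>
        ∃ P' nd', Triples (l ++ l') P' nd' s' := by
  induction l' with
  | nil =>
    intro l P nd s h h4 hin
    refine ⟨s, _, .loop_false ?_, by simp [Expr.cost], P, nd, by simpa using h⟩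
    simp [Expr.eval, h4, h.count]
  | cons x l' ih =>
    intro l P nd s h h4 hin
    rw [List.flatMap_cons, InputAt.append] at hin
    obtain ⟨s1, t1, e1, l1, ⟨P1, nd1, a1⟩, a2⟩ := readTriple_spec h x hin.1
    have m0 : s1.mem 0 = s.mem 0 := e1.mem_eq (by decide)
    have r4 : s1.reg 4 = s.reg 4 := e1.reg_eq (by decide)
    obtain ⟨s2, t2, e2, l2, P2, nd2, b1⟩ := ih a1 (by rw [r4, h4]; simp; omega) (by
      rw [m0, a2]
      convert hin.2 using 1
      simp [wordCode]
      omega)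
    refine ⟨s2, _, .loop_true ?_ e1 e2, ?_, P2, nd2, by simpa using b1⟩
    · simp only [Expr.eval, h4, h.count, List.length_cons]
      omega
    · simp only [Expr.cost, listLength, List.map_cons, List.sum_cons, List.length_cons, add_mul] at *
      omega

/-- The contents of the memory after the sample has been read. -/
structure Parsed (S : Sample σ) (l : List (List σ × List σ × Comparison)) (nd : List σ → ℕ)
    (s : State) : Prop where
  trie : IsTrie S.prefixFinset nd s
  left : ∀ j (h : j < l.length), s.mem 7 j = nd l[j].1
  right : ∀ j (h : j < l.length), s.mem 8 j = nd l[j].2.1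
  label : ∀ j (h : j < l.length), s.mem 9 j = l[j].2.2.code
  count : s.reg 4 = l.length

theorem Parsed.congr {S : Sample σ} {l : List (List σ × List σ × Comparison)} {nd : List σ → ℕ}
    {s s' : State} (h : Parsed S l nd s) {R M : List ℕ} (hr : ∀ x, x ∉ R → s'.reg x = s.reg x)
    (hm : ∀ a, a ∉ M → s'.mem a = s.mem a)
    (hR : 3 ∉ R ∧ 4 ∉ R ∧ 6 ∉ R := by decide)
    (hM : 5 ∉ M ∧ 6 ∉ M ∧ 7 ∉ M ∧ 8 ∉ M ∧ 9 ∉ M := by decide) : Parsed S l nd s' := by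
  obtain ⟨r3, r4, r6⟩ := hR
  obtain ⟨m5, m6, m7, m8, m9⟩ := hM
  exact ⟨h.trie.congr (hr 3 r3) (hr 6 r6) (hm 5 m5) (hm 6 m6), by rw [hm 7 m7]; exact h.left,
    by rw [hm 8 m8]; exact h.right, by rw [hm 9 m9]; exact h.label, by rw [hr 4 r4]; exact h.count⟩

theorem readSample_spec (S : Sample σ) (hS : S.Nonempty)
    (l : List (List σ × List σ × Comparison)) (hl : l.toFinset = S) :
    Runs readSample (State.init (sampleCode l))
      (listLength l * (readLetter.bound + 2) + l.length * 64 + 20) fun s' =>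
        ∃ nd, Parsed S l nd s' := by
  set s0 := State.init (sampleCode l) with hs0
  have hm0 : ∀ i, s0.mem 0 i = (sampleCode l).getD i 0 := by simp [hs0, State.init]
  have hmz : ∀ a i, a ≠ 0 → s0.mem a i = 0 := by
    intro a i ha
    simp [hs0, State.init, ha]
  have hr : ∀ x, s0.reg x = 0 := fun x => rfl
  obtain ⟨s1, t1, e1, l1, rfl⟩ := Runs.straight (s := s0)
    (p := .seq (.set 3 (.get 0 (.lit 0))) <| .seq (.set 4 (.get 0 (.lit 1))) <|
      .seq (.set 5 (.lit 2)) (.set 6 (.lit 1)))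
    (Post := fun s' => s' = (((s0.setReg 3 (Fintype.card σ)).setReg 4 l.length).setReg 5 2).setReg
      6 1) rfl (by simp [Program.apply, Expr.eval, hm0, sampleCode])
  set s1 := (((s0.setReg 3 (Fintype.card σ)).setReg 4 l.length).setReg 5 2).setReg 6 1 with hs1
  have hmem : s1.mem = s0.mem := by simp [hs1]
  -- Before the first triple, the trie consists of its root alone.
  have hT : Triples (σ := σ) [] {[]} (fun _ => 0) s1 := by
    refine ⟨⟨by simp, by simp, rfl, by simp, by simp, by simp [hs1], by simp [hs1], ?_, ?_, ?_, ?_⟩,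
      by simp, by simp, by simp, by simp, by simp [hs1, hr]⟩
    · intro i hi
      obtain rfl : i = 0 := by simpa using hi
      simp [hmem, hmz]
    · simp
    · simp [hmem, hmz]
    · simp [hmem, hmz]
  obtain ⟨s2, t2, e2, l2, P, nd, h⟩ := readTriples_spec l hT (by simp [hs1]) (by
    have := inputAt_getD (l.flatMap fun x => x.2.2.code :: (wordCode x.1 ++ wordCode x.2.1))
      [Fintype.card σ, l.length]
    rw [hmem]
    have e : s0.mem 0 = fun i => (sampleCode l).getD i 0 := funext hm0
    rw [e]
    simpa [hs1, sampleCode] using this)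
  have r4 : s2.reg 4 = s1.reg 4 := e2.reg_eq (by decide)
  rw [List.nil_append] at h
  -- The root is in the trie from the start; it is a prefix of the sample because the sample is
  -- nonempty.
  have hP : P = S.prefixFinset := by
    ext v
    rw [h.mem, Sample.mem_prefixFinset]
    subst hl
    constructor
    · rintro (rfl | ⟨x, hx, k | k⟩)
      · exact Sample.nil_mem_prefixes hS
      · exact ⟨x.1, Sample.mem_words_left (w' := x.2.1) (b := x.2.2) (by simpa using hx), k⟩
      · exact ⟨x.2.1, Sample.mem_words_right (w := x.1) (b := x.2.2) (by simpa using hx), k⟩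
    · rintro ⟨w, hw, hv⟩
      right
      simp only [Sample.words, Finset.mem_union, Finset.mem_image, List.mem_toFinset] at hw
      rcases hw with ⟨x, hx, rfl⟩ | ⟨x, hx, rfl⟩
      · exact ⟨x, hx, Or.inl hv⟩
      · exact ⟨x, hx, Or.inr hv⟩
  subst hP
  refine ⟨s2, _, .seq e1 e2, ?_, nd, h.trie, h.left, h.right, h.label, ?_⟩
  · simp only [Program.bound, Expr.cost] at l1
    omega
  · rw [r4]
    simp [hs1]

end Learner

/-! ### Sorting the prefixes

A breadth-first search lists the nodes of the trie in the order `<_L`: array `10` maps the position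
of a prefix to its node, array `11` to the position of its parent, and array `12` to its last
letter. Register `11` holds the position whose children are being listed, and register `12`
the number of prefixes in the list. -/

namespace Learner

open RAM Sample

variable {σ : Type*} [Fintype σ] [LinearOrder σ] {S : Sample σ} {nd : List σ → ℕ}

def sortLetter : Program :=
  .seq (.set 15 (.get 5 (.add (.reg 14) (.reg 13)))) <|
  .seq (.cond (.reg 15)
    (.seq (.put 10 (.reg 12) (.reg 15)) <| .seq (.put 11 (.reg 12) (.reg 11)) <|
      .seq (.put 12 (.reg 12) (.reg 13)) (.set 12 (.add (.reg 12) (.lit 1)))) .skip) <|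
  .set 13 (.add (.reg 13) (.lit 1))

def sortNode : Program :=
  .seq (.seq (.set 14 (.get 6 (.get 10 (.reg 11)))) (.set 13 (.lit 0))) <|
  .seq (.loop (.sub (.reg 3) (.reg 13)) sortLetter) <|
  .set 11 (.add (.reg 11) (.lit 1))

def sortNodes : Program :=
  .seq (.seq (.put 10 (.lit 0) (.lit 0)) <| .seq (.set 11 (.lit 0)) (.set 12 (.lit 1))) <|
  .loop (.sub (.reg 12) (.reg 11)) sortNode

/-- The prefixes that are in the list when the letters below `n` have been tried for the prefix at
the position `h`. -/
def listed (S : Sample σ) (h n : ℕ) : Set S.prefixes :=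
  {u | u.1 = [] ∨ ∃ (y : S.prefixes) (b : σ), u.1 = y.1 ++ [b] ∧
    (pos y < h ∨ pos y = h ∧ letterCode b < n)}

/-- The list contains the prefixes in `E`. -/
structure Listed (E : Set S.prefixes) (nd : List σ → ℕ) (s : State) : Prop where
  node : ∀ u ∈ E, s.mem 10 (pos u) = nd u.1
  parent : ∀ u ∈ E, ∀ (x : S.prefixes) (a : σ), u.1 = x.1 ++ [a] →
    s.mem 11 (pos u) = pos x ∧ s.mem 12 (pos u) = letterCode a

theorem Listed.congr {E : Set S.prefixes} {s s' : State} (h : Listed E nd s) {M : List ℕ}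
    (hm : ∀ a, a ∉ M → s'.mem a = s.mem a)
    (hM : 10 ∉ M ∧ 11 ∉ M ∧ 12 ∉ M := by decide) : Listed E nd s' := by
  obtain ⟨m10, m11, m12⟩ := hM
  exact ⟨by rw [hm 10 m10]; exact h.node, by rw [hm 11 m11, hm 12 m12]; exact h.parent⟩

/-- The position of the child that is listed next. -/
theorem listed_eq {x u : S.prefixes} {a : σ} (hu : u.1 = x.1 ++ [a]) :
    listed S (pos x) (letterCode a) = {v | WordLT v.1 u.1} := by
  ext v
  simp only [listed, Set.mem_ofPred_eq]
  constructor
  · rintro (k | ⟨y, b, e, k | ⟨k, kb⟩⟩)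
    · rw [k, hu]; exact WordLT.nil_snoc _ _
    · rw [e, hu]; exact (pos_lt_pos_iff.1 k).snoc_snoc _ _
    · rw [e, hu, pos_injective k]; exact WordLT.snoc_letter (letterCode_lt_iff.1 kb) _
  · intro k
    rcases List.eq_nil_or_concat v.1 with e | ⟨y, b, e⟩
    · exact Or.inl e
    · rw [List.concat_eq_append] at e
      have hy : y ∈ S.prefixes := prefixes_of_append (e ▸ v.2)
      rw [e, hu] at k
      refine Or.inr ⟨⟨y, hy⟩, b, e, ?_⟩
      rcases k.of_snoc_snoc with k | ⟨k, kb⟩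
      · exact Or.inl (pos_lt_pos_iff.2 k)
      · exact Or.inr ⟨congrArg pos (Subtype.ext k), letterCode_lt_iff.2 kb⟩

theorem listed_succ_of_mem {x u : S.prefixes} {a : σ} (hu : u.1 = x.1 ++ [a]) :
    listed S (pos x) (letterCode a + 1) = insert u (listed S (pos x) (letterCode a)) := by
  ext v
  simp only [listed, Set.mem_ofPred_eq, Set.mem_insert_iff]
  constructor
  · rintro (k | ⟨y, b, e, k | ⟨k, kb⟩⟩)
    · exact Or.inr (Or.inl k)
    · exact Or.inr (Or.inr ⟨y, b, e, Or.inl k⟩)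
    · rcases Nat.lt_succ_iff_lt_or_eq.1 kb with kb | kb
      · exact Or.inr (Or.inr ⟨y, b, e, Or.inr ⟨k, kb⟩⟩)
      · rw [letterCode_injective kb, pos_injective k, ← hu] at e
        exact Or.inl (Subtype.ext e)
  · rintro (rfl | k | ⟨y, b, e, k | ⟨k, kb⟩⟩)
    · exact Or.inr ⟨x, a, hu, Or.inr ⟨rfl, by omega⟩⟩
    · exact Or.inl k
    · exact Or.inr ⟨y, b, e, Or.inl k⟩
    · exact Or.inr ⟨y, b, e, Or.inr ⟨k, by omega⟩⟩

theorem listed_succ_of_notMem {x : S.prefixes} {a : σ} (hu : x.1 ++ [a] ∉ S.prefixes) :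
    listed S (pos x) (letterCode a + 1) = listed S (pos x) (letterCode a) := by
  ext v
  simp only [listed, Set.mem_ofPred_eq]
  constructor
  · rintro (k | ⟨y, b, e, k | ⟨k, kb⟩⟩)
    · exact Or.inl k
    · exact Or.inr ⟨y, b, e, Or.inl k⟩
    · rcases Nat.lt_succ_iff_lt_or_eq.1 kb with kb | kb
      · exact Or.inr ⟨y, b, e, Or.inr ⟨k, kb⟩⟩
      · rw [letterCode_injective kb, pos_injective k] at e
        exact absurd (e ▸ v.2) hu
  · rintro (k | ⟨y, b, e, k | ⟨k, kb⟩⟩)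
    · exact Or.inl k
    · exact Or.inr ⟨y, b, e, Or.inl k⟩
    · exact Or.inr ⟨y, b, e, Or.inr ⟨k, by omega⟩⟩

theorem listed_card (h : ℕ) : listed S h (Fintype.card σ) = listed S (h + 1) 0 := by
  ext v
  simp only [listed, Set.mem_ofPred_eq]
  constructor
  · rintro (k | ⟨y, b, e, k | ⟨k, kb⟩⟩)
    · exact Or.inl k
    · exact Or.inr ⟨y, b, e, Or.inl (by omega)⟩
    · exact Or.inr ⟨y, b, e, Or.inl (by omega)⟩
  · rintro (k | ⟨y, b, e, k | ⟨k, kb⟩⟩)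
    · exact Or.inl k
    · rcases Nat.lt_succ_iff_lt_or_eq.1 k with k | k
      · exact Or.inr ⟨y, b, e, Or.inl k⟩
      · exact Or.inr ⟨y, b, e, Or.inr ⟨k, letterCode_lt_card b⟩⟩
    · omega

/-- The parent of a nonempty prefix precedes it, so every prefix is in the list by the time its own
children are due. -/
theorem mem_listed_of_pos_le {h : ℕ} {v : S.prefixes} (hv : pos v ≤ h) : v ∈ listed S h 0 := by
  rcases List.eq_nil_or_concat v.1 with e | ⟨y, b, e⟩
  · exact Or.inl e
  · rw [List.concat_eq_append] at e
    have hy : y ∈ S.prefixes := prefixes_of_append (e ▸ v.2)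
    refine Or.inr ⟨⟨y, hy⟩, b, e, Or.inl (lt_of_lt_of_le (pos_lt_pos ?_) hv)⟩
    rw [e]
    exact WordLT.self_snoc _ _

theorem listed_end : listed S (Nat.card S.prefixes) 0 = Set.univ :=
  Set.eq_univ_of_forall fun v => mem_listed_of_pos_le (pos_lt_card v).le

/-- The queue does not run empty before all prefixes have been expanded, so the loop makes exactly
as many rounds as there are prefixes. -/
theorem lt_ncard_listed {h : ℕ} (hh : h < Nat.card S.prefixes) : h < (listed S h 0).ncard := by
  obtain ⟨x, rfl⟩ := exists_pos_eq hh
  refine Set.ncard_lt_ncard ⟨fun v hv => mem_listed_of_pos_le (pos_lt_pos hv).le, fun hsub => ?_⟩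
    (Set.toFinite _)
  exact WordLT.irrefl _ (hsub (mem_listed_of_pos_le le_rfl))

theorem sortLetter_spec {s : State} (hp : IsTrie S.prefixFinset nd s) {x : S.prefixes} {a : σ}
    (h11 : s.reg 11 = pos x) (h13 : s.reg 13 = letterCode a)
    (h14 : s.reg 14 = nd x.1 * Fintype.card σ)
    (h12 : s.reg 12 = (listed S (pos x) (letterCode a)).ncard)
    (hl : Listed (listed S (pos x) (letterCode a)) nd s) :
    Listed (listed S (pos x) (letterCode a + 1)) nd (sortLetter.apply s) ∧
      (sortLetter.apply s).reg 12 = (listed S (pos x) (letterCode a + 1)).ncard ∧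
      (sortLetter.apply s).reg 13 = letterCode a + 1 := by
  have hx : x.1 ∈ S.prefixFinset := mem_prefixFinset.2 x.2
  by_cases hu : x.1 ++ [a] ∈ S.prefixes
  · have hch := hp.child x.1 hx a (mem_prefixFinset.2 hu)
    have hne := hp.nd_ne_zero (mem_prefixFinset.2 hu)
    have hE := listed_eq (x := x) (u := ⟨_, hu⟩) rfl
    -- The prefixes listed so far are exactly those below the child, so the length of the list is
    -- the position of the child.
    have hpos : s.reg 12 = pos (S := S) ⟨_, hu⟩ := by rw [h12, hE]; rfl
    have hnot : (⟨_, hu⟩ : S.prefixes) ∉ listed S (pos x) (letterCode a) := by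
      rw [hE]
      exact WordLT.irrefl _
    have hlow : ∀ v ∈ listed S (pos x) (letterCode a), pos v ≠ pos (S := S) ⟨_, hu⟩ :=
      fun v hv e => hnot (pos_injective e ▸ hv)
    have e : sortLetter.apply s = (((((s.setReg 15 (nd (x.1 ++ [a]))).setMem 10
        (pos (S := S) ⟨_, hu⟩) (nd (x.1 ++ [a]))).setMem 11 (pos (S := S) ⟨_, hu⟩) (pos x)).setMem
        12 (pos (S := S) ⟨_, hu⟩) (letterCode a)).setReg 12 (pos (S := S) ⟨_, hu⟩ + 1)).setReg 13
        (letterCode a + 1) := by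
      simp [sortLetter, Program.apply, Expr.eval, h14, h13, hch, hne, hpos, h11]
    rw [e, listed_succ_of_mem rfl (u := ⟨_, hu⟩)]
    refine ⟨⟨?_, ?_⟩, ?_, by simp⟩
    · rintro v (rfl | hv)
      · simp
      · simp [hlow v hv, hl.node v hv]
    · rintro v (rfl | hv) y b hyb
      · obtain ⟨rfl, rfl⟩ := snoc_inj hyb
        simp
      · simpa [hlow v hv] using hl.parent v hv y b hyb
    · rw [Set.ncard_insert_of_notMem hnot (Set.toFinite _), ← h12, hpos]
      simp
  · have hch := hp.no_child x.1 hx a fun k => hu (mem_prefixFinset.1 k)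
    have e : sortLetter.apply s = (s.setReg 15 0).setReg 13 (letterCode a + 1) := by
      simp [sortLetter, Program.apply, Expr.eval, h14, h13, hch]
    rw [e, listed_succ_of_notMem hu]
    exact ⟨⟨by simpa using hl.node, by simpa using hl.parent⟩, by simpa using h12, by simp⟩

theorem sortNode_spec {s : State} (hp : IsTrie S.prefixFinset nd s) {x : S.prefixes}
    (h11 : s.reg 11 = pos x) (h12 : s.reg 12 = (listed S (pos x) 0).ncard)
    (hl : Listed (listed S (pos x) 0) nd s) :
    Runs sortNode s ((Fintype.card σ + 1) * 60) fun s' =>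
      Listed (listed S (pos x + 1) 0) nd s' ∧ s'.reg 11 = pos x + 1 ∧
        s'.reg 12 = (listed S (pos x + 1) 0).ncard := by
  have hx : x.1 ∈ S.prefixFinset := mem_prefixFinset.2 x.2
  have hq : s.mem 10 (pos x) = nd x.1 := hl.node x (mem_listed_of_pos_le le_rfl)
  have hrow := hp.row _ (hp.lt _ hx)
  let Inv : ℕ → State → Prop := fun n s' => IsTrie S.prefixFinset nd s' ∧ s'.reg 11 = pos x ∧
    s'.reg 12 = (listed S (pos x) n).ncard ∧ Listed (listed S (pos x) n) nd s' ∧ s'.reg 13 = n ∧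
    s'.reg 14 = nd x.1 * Fintype.card σ
  refine Runs.mono (c := 10 + ((Fintype.card σ + 1) * (sortLetter.bound + 4) + 4)) ?_ ?_
    (fun _ h => h)
  · refine Runs.seq ((Runs.straight rfl ?_).mono (by decide)
      (Post := fun s' => s' = (s.setReg 14 (nd x.1 * Fintype.card σ)).setReg 13 0) ?_)
    · simp [Program.apply, Expr.eval, h11, hq, hrow]
    · rintro s' rfl
      refine Runs.seq ((Runs.for (c := sortLetter.bound) (Inv := Inv) (Fintype.card σ) ?_ ?_ ?_).mono (by rfl) ?_)
      · exact ⟨hp.congr (by simp) (by simp) (by simp) (by simp), by simpa using h11,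
          by simpa using h12, ⟨by simpa using hl.node, by simpa using hl.parent⟩, by simp, by simp⟩
      · rintro i s' hi ⟨k1, -, -, -, k5, -⟩
        simp only [Expr.eval, k1.alphabet, k5]
        omega
      · rintro i s' hi ⟨k1, k2, k3, k4, k5, k6⟩
        obtain ⟨a, rfl⟩ := exists_letterCode_eq hi
        obtain ⟨q1, q2, q3⟩ := sortLetter_spec k1 k2 k5 k6 k3 k4
        refine (Runs.straight (Post := fun s'' => s'' = sortLetter.apply s') rfl rfl).frame.mono
          le_rfl ?_
        rintro _ ⟨rfl, f1, f2⟩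
        exact ⟨k1.congr (f1 3 (by decide)) (f1 6 (by decide)) (f2 5 (by decide)) (f2 6 (by decide)),
          (f1 11 (by decide)).trans k2, q2, q1, q3, (f1 14 (by decide)).trans k6⟩
      · rintro s' ⟨k1, k2, k3, k4, k5, k6⟩
        rw [listed_card] at k3 k4
        refine Runs.straight (p := .set 11 (.add (.reg 11) (.lit 1))) rfl ?_
        simp only [Program.apply, Expr.eval, k2]
        exact ⟨⟨by simpa using k4.node, by simpa using k4.parent⟩, by simp, by simpa using k3⟩
  · have : sortLetter.bound ≤ 40 := by decide
    nlinarith [Nat.mul_le_mul_left (Fintype.card σ + 1) this]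

theorem sortNodes_spec (hS : S.Nonempty) {s : State} (hp : IsTrie S.prefixFinset nd s) :
    Runs sortNodes s ((Nat.card S.prefixes + 1) * (Fintype.card σ + 1) * 80)
      (Listed (Set.univ : Set S.prefixes) nd) := by
  have hnil := nil_mem_prefixes hS
  have h00 : listed S 0 0 = {⟨[], hnil⟩} := by
    ext v
    simp [listed, Subtype.ext_iff]
  let Inv : ℕ → State → Prop := fun h s' => IsTrie S.prefixFinset nd s' ∧ s'.reg 11 = h ∧
    s'.reg 12 = (listed S h 0).ncard ∧ Listed (listed S h 0) nd s'
  refine Runs.mono (c := 7 + ((Nat.card S.prefixes + 1) * ((Fintype.card σ + 1) * 60 + 4))) ?_ ?_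
    (fun _ h => h)
  · refine Runs.seq ((Runs.straight rfl ?_).mono (by decide)
      (Post := fun s' => s' = ((s.setMem 10 0 0).setReg 11 0).setReg 12 1) ?_)
    · simp [Program.apply, Expr.eval]
    · rintro s' rfl
      refine (Runs.for (c := (Fintype.card σ + 1) * 60) (Inv := Inv) (Nat.card S.prefixes)
        ?_ ?_ ?_).mono (by rfl) ?_
      · refine ⟨hp.congr (by simp) (by simp) (by funext j; simp) (by funext j; simp), by simp, ?_, ?_⟩
        · rw [h00]; simp
        · rw [h00]
          refine ⟨?_, ?_⟩
          · rintro v rfl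
            simp [pos_nil, hp.nd_nil]
          · rintro v rfl x a e
            simp at e
      · rintro i s' hi ⟨-, k2, k3, -⟩
        simp only [Expr.eval, k2, k3]
        constructor
        · intro k
          have := Set.ncard_le_ncard (Set.subset_univ (listed S i 0)) (Set.toFinite _)
          rw [Set.ncard_univ] at this
          omega
        · intro k
          have := lt_ncard_listed k
          omega
      · rintro i s' hi ⟨k1, k2, k3, k4⟩
        obtain ⟨x, rfl⟩ := exists_pos_eq hi
        refine (sortNode_spec k1 k2 k3 k4).frame.mono le_rfl ?_
        rintro s'' ⟨⟨q1, q2, q3⟩, f1, f2⟩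
        exact ⟨k1.congr (f1 3 (by decide)) (f1 6 (by decide)) (f2 5 (by decide)) (f2 6 (by decide)),
          q2, q3, q1⟩
      · rintro s' ⟨-, -, -, k4⟩
        rwa [listed_end] at k4
  · nlinarith [Nat.zero_le (Nat.card S.prefixes), Nat.zero_le (Fintype.card σ),
      Nat.zero_le (Nat.card S.prefixes * Fintype.card σ)]

end Learner

/-! ### The ranks of the prefix tree automaton

Array `13` marks the nodes of the words, array `14` contains a preliminary number of the component
of each word, array `15` maps the preliminary to the final numbers (shifted by one), and array `16`
contains the final numbers for the nodes (shifted by one, `0` is "undefined"). -/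

set_option linter.unusedSectionVars false

namespace Learner

open RAM Sample

variable {σ : Type*} [Fintype σ] [LinearOrder σ] {S : Sample σ} {nd : List σ → ℕ}
  {l : List (List σ × List σ × Comparison)}

/-- The value of this expression is `0` if and only if the values of `e` and `f` are equal. -/
def neq (e f : Expr) : Expr := .add (.sub e f) (.sub f e)

theorem neq_eval {e f : Expr} {s : State} : (neq e f).eval s = 0 ↔ e.eval s = f.eval s := by
  simp only [neq, Expr.eval]
  omega

def initComponents : Program :=
  .seq (.set 16 (.lit 0)) <|
  .loop (.sub (.reg 6) (.reg 16)) <|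
    .seq (.put 14 (.reg 16) (.reg 16)) (.set 16 (.add (.reg 16) (.lit 1)))

def relabelNode : Program :=
  .seq (.cond (neq (.get 14 (.reg 16)) (.reg 18)) .skip (.put 14 (.reg 16) (.reg 17))) <|
  .set 16 (.add (.reg 16) (.lit 1))

/-- The component of the right word is relabelled by a scan of all nodes. Linear cost per triple is
affordable; the two labels are saved in registers because the scan overwrites them in the array. -/
def joinComponents : Program :=
  .seq (.seq (.set 17 (.get 14 (.get 7 (.reg 24)))) <|
    .seq (.set 18 (.get 14 (.get 8 (.reg 24)))) (.set 16 (.lit 0))) <|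
  .loop (.sub (.reg 6) (.reg 16)) relabelNode

def componentsStep : Program :=
  .seq (.seq (.put 13 (.get 7 (.reg 24)) (.lit 1)) (.put 13 (.get 8 (.reg 24)) (.lit 1))) <|
  .seq (.cond (.get 9 (.reg 24)) .skip joinComponents) <|
  .set 24 (.add (.reg 24) (.lit 1))

def components : Program :=
  .seq initComponents <|
  .seq (.set 24 (.lit 0)) <|
  .loop (.sub (.reg 4) (.reg 24)) componentsStep

def numberNode : Program :=
  .seq (.cond (.get 13 (.reg 16))
    (.seq (.set 17 (.get 14 (.reg 16))) <|
      .seq (.cond (.get 15 (.reg 17)) .skip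
        (.seq (.set 1 (.add (.reg 1) (.lit 1))) (.put 15 (.reg 17) (.reg 1)))) <|
      .put 16 (.reg 16) (.get 15 (.reg 17))) .skip) <|
  .set 16 (.add (.reg 16) (.lit 1))

def numberRanks : Program :=
  .seq (.seq (.set 1 (.lit 0)) (.set 16 (.lit 0))) <|
  .loop (.sub (.reg 6) (.reg 16)) numberNode

theorem initComponents_spec (s : State) :
    Runs initComponents s ((s.reg 6 + 1) * 20) fun s' => ∀ i < s.reg 6, s'.mem 14 i = i := by
  let Inv : ℕ → State → Prop := fun n s' => s'.reg 6 = s.reg 6 ∧ s'.reg 16 = n ∧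
    ∀ i < n, s'.mem 14 i = i
  refine Runs.mono (c := 2 + (s.reg 6 + 1) * (7 + 4)) ?_ (by omega) (fun _ h => h)
  refine Runs.seq ((Runs.straight rfl ?_).mono (by decide)
    (Post := fun s' => s' = s.setReg 16 0) ?_)
  · simp [Program.apply, Expr.eval]
  · rintro s' rfl
    refine (Runs.for (c := 7) (Inv := Inv) (s.reg 6) ?_ ?_ ?_).mono (by rfl) ?_
    · exact ⟨by simp, by simp, by simp⟩
    · rintro i s' hi ⟨k1, k2, -⟩
      simp only [Expr.eval, k1, k2]
      omega
    · rintro i s' hi ⟨k1, k2, k3⟩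
      refine (Runs.straight rfl ?_).mono (by decide) (fun _ h => h)
      simp only [Program.apply, Expr.eval, k2]
      refine ⟨by simpa using k1, by simp [k2], fun j hj => ?_⟩
      by_cases e : j = i
      · simp [e]
      · simp [e, k3 j (by omega)]
    · rintro s' ⟨-, -, k3⟩
      exact k3

theorem joinComponents_spec (s : State) :
    Runs joinComponents s ((s.reg 6 + 1) * 40) fun s' => ∀ i < s.reg 6, s'.mem 14 i =
      if s.mem 14 i = s.mem 14 (s.mem 8 (s.reg 24)) then s.mem 14 (s.mem 7 (s.reg 24))
      else s.mem 14 i := by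
  set c := s.mem 14 (s.mem 7 (s.reg 24)) with hc
  set d := s.mem 14 (s.mem 8 (s.reg 24)) with hd
  let Inv : ℕ → State → Prop := fun n s' => s'.reg 6 = s.reg 6 ∧ s'.reg 16 = n ∧ s'.reg 17 = c ∧
    s'.reg 18 = d ∧ ∀ i, s'.mem 14 i = if i < n ∧ s.mem 14 i = d then c else s.mem 14 i
  refine Runs.mono (c := 10 + (s.reg 6 + 1) * (relabelNode.bound + 4)) ?_ ?_ (fun _ h => h)
  swap
  · have : relabelNode.bound ≤ 25 := by decide
    nlinarith [Nat.mul_le_mul_left (s.reg 6 + 1) this]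
  refine Runs.seq ((Runs.straight rfl ?_).mono (by decide)
    (Post := fun s' => s' = ((s.setReg 17 c).setReg 18 d).setReg 16 0) ?_)
  · simp [Program.apply, Expr.eval, hc, hd]
  · rintro s' rfl
    refine (Runs.for (c := relabelNode.bound) (Inv := Inv) (s.reg 6) ?_ ?_ ?_).mono (by rfl) ?_
    · exact ⟨by simp, by simp, by simp, by simp, by simp⟩
    · rintro i s' hi ⟨k1, k2, -⟩
      simp only [Expr.eval, k1, k2]
      omega
    · rintro i s' hi ⟨k1, k2, k3, k4, k5⟩
      refine Runs.straight rfl ?_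
      have hi' : s'.mem 14 i = s.mem 14 i := by simp [k5]
      simp only [relabelNode, Program.apply, neq_eval]
      simp only [Expr.eval, k2, k3, k4, hi']
      by_cases e : s.mem 14 i = d
      · simp only [e, if_true]
        refine ⟨by simpa using k1, by simp [k2], by simpa using k3, by simpa using k4, fun j => ?_⟩
        by_cases ej : j = i
        · simp [ej, e]
        · have : j < i + 1 ↔ j < i := by omega
          simp [ej, k5, this]
      · simp only [e, if_false]
        refine ⟨by simpa using k1, by simp [k2], by simpa using k3, by simpa using k4, fun j => ?_⟩
        by_cases ej : j = i
        · simp [ej, e, k5]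
        · have : j < i + 1 ↔ j < i := by omega
          simp [k5, this]
    · rintro s' ⟨-, -, -, -, k5⟩ i hi
      simp [k5, hi]

/-- What is known about the components after the first `n` triples. -/
structure Components (S : Sample σ) (l : List (List σ × List σ × Comparison)) (nd : List σ → ℕ)
    (n : ℕ) (s : State) : Prop where
  sound : ∀ w w' : S.words, s.mem 14 (nd w.1) = s.mem 14 (nd w'.1) → S.comp w = S.comp w'
  complete : ∀ j (h : j < l.length), j < n → l[j].2.2 = .indifferent →
    s.mem 14 (nd l[j].1) = s.mem 14 (nd l[j].2.1)
  mark : ∀ u ∈ S.prefixFinset, s.mem 13 (nd u) ≠ 0 ↔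
    ∃ j, ∃ h : j < l.length, j < n ∧ (u = l[j].1 ∨ u = l[j].2.1)

theorem componentsStep_spec (hl : l.toFinset = S) {s : State} {n : ℕ} (hp : Parsed S l nd s)
    (hn : n < l.length) (h24 : s.reg 24 = n) (hc : Components S l nd n s) :
    Runs componentsStep s ((S.prefixFinset.card + 1) * 40 + 20) fun s' =>
      s'.reg 24 = n + 1 ∧ Components S l nd (n + 1) s' := by
  have hw := getElem_mem_words hl hn
  have hlt : ∀ w : S.words, nd w.1 < S.prefixFinset.card := fun w =>
    hp.trie.lt _ (words_mem_prefixFinset w.2)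
  have hwl := hp.trie.inj _ (words_mem_prefixFinset hw.1)
  have hwr := hp.trie.inj _ (words_mem_prefixFinset hw.2)
  -- the marks
  let s1 := (s.setMem 13 (nd l[n].1) 1).setMem 13 (nd l[n].2.1) 1
  have hmark : ∀ u ∈ S.prefixFinset, s1.mem 13 (nd u) ≠ 0 ↔
      ∃ j, ∃ h : j < l.length, j < n + 1 ∧ (u = l[j].1 ∨ u = l[j].2.1) := by
    intro u hu
    simp only [s1, State.setMem_mem, if_true]
    by_cases e2 : nd u = nd l[n].2.1
    · rw [if_pos e2]
      simp only [ne_eq, one_ne_zero, not_false_eq_true, true_iff]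
      exact ⟨n, hn, by omega, Or.inr (hwr _ hu e2.symm).symm⟩
    by_cases e1 : nd u = nd l[n].1
    · rw [if_neg e2, if_pos e1]
      simp only [ne_eq, one_ne_zero, not_false_eq_true, true_iff]
      exact ⟨n, hn, by omega, Or.inl (hwl _ hu e1.symm).symm⟩
    rw [if_neg e2, if_neg e1, hc.mark u hu]
    constructor
    · rintro ⟨j, hj, h1, h2⟩
      exact ⟨j, hj, by omega, h2⟩
    · rintro ⟨j, hj, h1, h2⟩
      refine ⟨j, hj, ?_, h2⟩
      rcases Nat.lt_succ_iff_lt_or_eq.1 h1 with k | rfl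
      · exact k
      · rcases h2 with rfl | rfl
        · exact absurd rfl e1
        · exact absurd rfl e2
  have hm7 : s1.mem 7 = s.mem 7 := by funext j; simp [s1]
  have hm8 : s1.mem 8 = s.mem 8 := by funext j; simp [s1]
  have hm9 : s1.mem 9 = s.mem 9 := by funext j; simp [s1]
  have hm14 : s1.mem 14 = s.mem 14 := by funext j; simp [s1]
  have hr : s1.reg = s.reg := by simp [s1]
  refine Runs.mono (c := 10 + (((S.prefixFinset.card + 1) * 40 + 3) + 4)) ?_ (by omega)
    (fun _ h => h)
  refine Runs.seq ((Runs.straight rfl ?_).mono (by decide) (Post := fun s' => s' = s1) ?_)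
  · simp [Program.apply, Expr.eval, h24, hp.left n hn, hp.right n hn, s1]
  rintro _ rfl
  refine Runs.seq (Runs.mono (Post := fun s' => s'.reg 24 = n ∧ Components S l nd (n + 1) s')
    ?_ le_rfl ?_)
  · have hlab : s1.mem 9 n = l[n].2.2.code := by rw [hm9, hp.label n hn]
    by_cases hb : l[n].2.2 = .indifferent
    · have h0 : (Expr.get 9 (.reg 24)).eval s1 = 0 := by
        simp [Expr.eval, hr, h24, hlab, hb, Comparison.code]
      have hj := joinComponents_spec s1
      rw [hr, hp.trie.card, h24, hm7, hm8, hm14, hp.left n hn, hp.right n hn] at hj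
      refine (Runs.cond_false h0 hj.frame).mono (by simp only [Expr.cost]; omega) ?_
      rintro s' ⟨k1, k2, k3⟩
      -- Different words have different nodes and every node of a word is in the scanned range, so
      -- the effect on the words is a relabelling of one class.
      have key : ∀ w : S.words, s'.mem 14 (nd w.1) = if s.mem 14 (nd w.1) = s.mem 14 (nd l[n].2.1)
          then s.mem 14 (nd l[n].1) else s.mem 14 (nd w.1) := fun w => k1 _ (hlt w)
      have hcomp : S.comp ⟨_, hw.1⟩ = S.comp ⟨_, hw.2⟩ := by
        refine comp_eq_of_mem ?_
        rw [← hb]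
        exact (mem_iff_of_toFinset hl).2 (List.getElem_mem hn)
      refine ⟨by rw [k2 24 (by decide), hr, h24], ?_, ?_, ?_⟩
      · intro w w' e
        rw [key, key] at e
        by_cases e1 : s.mem 14 (nd w.1) = s.mem 14 (nd l[n].2.1) <;>
        by_cases e2 : s.mem 14 (nd w'.1) = s.mem 14 (nd l[n].2.1)
        · exact hc.sound _ _ (e1.trans e2.symm)
        · rw [if_pos e1, if_neg e2] at e
          rw [hc.sound w ⟨_, hw.2⟩ e1, ← hcomp, hc.sound ⟨_, hw.1⟩ w' e]
        · rw [if_neg e1, if_pos e2] at e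
          rw [hc.sound w' ⟨_, hw.2⟩ e2, ← hcomp, hc.sound w ⟨_, hw.1⟩ e]
        · rw [if_neg e1, if_neg e2] at e
          exact hc.sound _ _ e
      · intro j hj hjn hjb
        have hwj := getElem_mem_words hl hj
        rw [key ⟨_, hwj.1⟩, key ⟨_, hwj.2⟩]
        rcases Nat.lt_succ_iff_lt_or_eq.1 hjn with k | rfl
        · rw [hc.complete j hj k hjb]
        · simp
      · intro u hu
        rw [k3 13 (by decide)]
        exact hmark u hu
    · have h0 : (Expr.get 9 (.reg 24)).eval s1 ≠ 0 := by
        simp only [Expr.eval, hr, h24, hlab]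
        cases hx : l[n].2.2 <;> simp_all [Comparison.code]
      refine (Runs.cond_true h0 (Runs.straight (p := .skip) (Post := fun s' => s' = s1) rfl
        rfl)).mono (by simp only [Expr.cost, Program.bound]; omega) ?_
      rintro _ rfl
      refine ⟨by rw [hr, h24], ?_, ?_, hmark⟩
      · rw [hm14]
        exact hc.sound
      · intro j hj hjn hjb
        rw [hm14]
        rcases Nat.lt_succ_iff_lt_or_eq.1 hjn with k | rfl
        · exact hc.complete j hj k hjb
        · exact absurd hjb hb
  · rintro s' ⟨k1, k2⟩
    refine Runs.straight (p := .set 24 (.add (.reg 24) (.lit 1))) rfl ?_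
    exact ⟨by simp [Program.apply, Expr.eval, k1], ⟨k2.sound, k2.complete, k2.mark⟩⟩

theorem components_spec (hl : l.toFinset = S) {s : State} (hp : Parsed S l nd s)
    (h13 : ∀ i, s.mem 13 i = 0) :
    Runs components s ((l.length + 1) * (S.prefixFinset.card + 1) * 100)
      (Components S l nd l.length) := by
  let Inv : ℕ → State → Prop := fun n s' => Parsed S l nd s' ∧ s'.reg 24 = n ∧
    Components S l nd n s'
  refine Runs.mono (c := (S.prefixFinset.card + 1) * 20 +
    (2 + (l.length + 1) * (((S.prefixFinset.card + 1) * 40 + 20) + 4))) ?_ ?_ (fun _ h => h)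
  swap
  · nlinarith [Nat.zero_le (l.length * S.prefixFinset.card)]
  have hi := initComponents_spec s
  rw [hp.trie.card] at hi
  refine Runs.seq_frame hi ?_
  intro s1 k1 k2 k3
  refine Runs.seq ((Runs.straight rfl ?_).mono (by decide)
    (Post := fun s' => s' = s1.setReg 24 0) ?_)
  · simp [Program.apply, Expr.eval]
  rintro _ rfl
  refine (Runs.for (c := (S.prefixFinset.card + 1) * 40 + 20) (Inv := Inv) l.length
    ?_ ?_ ?_).mono (by rfl) ?_
  · have hp1 := hp.congr k2 k3
    refine ⟨hp1.congr (R := [24]) (M := []) ?_ (by simp), by simp, ?_, ?_, ?_⟩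
    · intro x hx
      have : x ≠ 24 := by simpa using hx
      simp [this]
    · intro w w' e
      have hw := words_mem_prefixFinset w.2
      have hw' := words_mem_prefixFinset w'.2
      simp only [State.setReg_mem] at e
      rw [k1 _ (hp.trie.lt _ hw), k1 _ (hp.trie.lt _ hw')] at e
      rw [Subtype.ext (hp.trie.inj _ hw _ hw' e)]
    · intro j _ hj
      omega
    · intro u hu
      simp [k3 13 (by decide), h13]
  · rintro i s' hi ⟨q1, q2, -⟩
    simp only [Expr.eval, q1.count, q2]
    omega
  · rintro i s' hi ⟨q1, q2, q3⟩
    refine (componentsStep_spec hl q1 hi q2 q3).frame.mono le_rfl ?_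
    rintro s'' ⟨⟨r1, r2⟩, f1, f2⟩
    exact ⟨q1.congr f1 f2, r1, r2⟩
  · rintro s' ⟨-, -, q3⟩
    exact q3

/-- The contents of the memory after the ranks have been numbered. -/
structure Ranked (S : Sample σ) (nd : List σ → ℕ) {r : ℕ} (f : S.Ranks ≃ Fin r) (s : State) :
    Prop where
  count : s.reg 1 = r
  word : ∀ w : S.words, s.mem 16 (nd w.1) = f (S.comp w) + 1
  not_word : ∀ u ∈ S.prefixFinset, u ∉ S.words → s.mem 16 (nd u) = 0

theorem IsTrie.exists_nd {P : Finset (List σ)} {s : State} (h : IsTrie P nd s) {i : ℕ}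
    (hi : i < P.card) : ∃ u ∈ P, nd u = i := by
  have := Finset.surj_on_of_inj_on_of_card_le (s := P) (t := Finset.range P.card)
    (fun u _ => nd u) (fun u hu => Finset.mem_range.2 (h.lt u hu))
    (fun u v hu hv e => h.inj u hu v hv e) (by simp) i (Finset.mem_range.2 hi)
  obtain ⟨u, hu, e⟩ := this
  exact ⟨u, hu, e.symm⟩

theorem Components.mark_iff (hl : l.toFinset = S) {s : State}
    (hc : Components S l nd l.length s) {u : List σ} (hu : u ∈ S.prefixFinset) :
    s.mem 13 (nd u) ≠ 0 ↔ u ∈ S.words := by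
  rw [hc.mark u hu]
  constructor
  · rintro ⟨j, hj, -, rfl | rfl⟩
    · exact (getElem_mem_words hl hj).1
    · exact (getElem_mem_words hl hj).2
  · intro h
    rw [← hl] at h
    simp only [Sample.words, Finset.mem_union, Finset.mem_image, List.mem_toFinset] at h
    rcases h with ⟨x, hx, rfl⟩ | ⟨x, hx, rfl⟩
    all_goals
      obtain ⟨j, hj, rfl⟩ := List.getElem_of_mem hx
    · exact ⟨j, hj, hj, Or.inl rfl⟩
    · exact ⟨j, hj, hj, Or.inr rfl⟩

/-- Once all triples have been read, the label is constant on indifferent pairs and therefore on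
components; the converse is soundness. -/
theorem Components.comp_eq_iff (hl : l.toFinset = S) {s : State}
    (hc : Components S l nd l.length s) (w w' : S.words) :
    s.mem 14 (nd w.1) = s.mem 14 (nd w'.1) ↔ S.comp w = S.comp w' := by
  refine ⟨hc.sound w w', fun h => eq_of_comp_eq (fun w => s.mem 14 (nd w.1)) ?_ h⟩
  intro w w' hm
  obtain ⟨j, hj, e⟩ := List.getElem_of_mem ((mem_iff_of_toFinset hl).1 hm)
  have := hc.complete j hj hj (by rw [e])
  rwa [e] at this

/-- The invariant of the numbering of the ranks, when the first `n` nodes have been dealt with and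
`m` is the array of the preliminary numbers. -/
structure Numbered (S : Sample σ) (nd : List σ → ℕ) (m : ℕ → ℕ) (n : ℕ) (s : State) : Prop where
  bound : ∀ z, s.mem 15 z ≤ s.reg 1
  inj : ∀ z z', s.mem 15 z ≠ 0 → s.mem 15 z = s.mem 15 z' → z = z'
  surj : ∀ b, b ≠ 0 → b ≤ s.reg 1 → ∃ w : S.words, s.mem 15 (m (nd w.1)) = b
  done : ∀ w : S.words, nd w.1 < n →
    s.mem 15 (m (nd w.1)) ≠ 0 ∧ s.mem 16 (nd w.1) = s.mem 15 (m (nd w.1))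
  not_word : ∀ u ∈ S.prefixFinset, u ∉ S.words → s.mem 16 (nd u) = 0

/-- A component receives the next number at the first of its words that is met; the entry `0` in
array `15` tells that it has none yet. -/
theorem numberNode_spec (hl : l.toFinset = S) {s0 s : State} {n : ℕ}
    (ht : IsTrie S.prefixFinset nd s0) (hc : Components S l nd l.length s0)
    (hn : n < S.prefixFinset.card) (m13 : s.mem 13 = s0.mem 13) (m14 : s.mem 14 = s0.mem 14)
    (h16 : s.reg 16 = n) (hi : Numbered S nd (s0.mem 14) n s) :
    Numbered S nd (s0.mem 14) (n + 1) (numberNode.apply s) ∧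
      (numberNode.apply s).reg 16 = n + 1 := by
  obtain ⟨u, hu, rfl⟩ := ht.exists_nd hn
  have hmark := hc.mark_iff hl hu
  have hinj := ht.inj u hu
  by_cases hw : u ∈ S.words
  · have h13 : s.mem 13 (nd u) ≠ 0 := by rw [m13]; exact hmark.2 hw
    by_cases h15 : s.mem 15 (s0.mem 14 (nd u)) = 0
    · have e : numberNode.apply s = ((((s.setReg 17 (s0.mem 14 (nd u))).setReg 1
          (s.reg 1 + 1)).setMem 15 (s0.mem 14 (nd u)) (s.reg 1 + 1)).setMem 16 (nd u)
          (s.reg 1 + 1)).setReg 16 (nd u + 1) := by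
        simp [numberNode, Program.apply, Expr.eval, h16, h13, h15, m14]
      rw [e]
      refine ⟨⟨?_, ?_, ?_, ?_, ?_⟩, by simp⟩
      · intro z
        have := hi.bound z
        by_cases ez : z = s0.mem 14 (nd u)
        · simp [ez]
        · simp [ez]; omega
      · intro z z'
        have b := hi.bound z
        have b' := hi.bound z'
        by_cases ez : z = s0.mem 14 (nd u) <;> by_cases ez' : z' = s0.mem 14 (nd u)
        · intros; rw [ez, ez']
        · simp [ez, ez']; omega
        · simp [ez, ez']; omega
        · simpa [ez, ez'] using hi.inj z z'
      · intro b hb hb'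
        simp only [State.setReg_reg, State.setMem_reg] at hb'
        simp only [State.setReg_mem, State.setMem_mem]
        by_cases eb : b = s.reg 1 + 1
        · exact ⟨⟨u, hw⟩, by simp [eb]⟩
        · obtain ⟨w, hw'⟩ := hi.surj b hb (by simp at hb'; omega)
          refine ⟨w, ?_⟩
          have : s0.mem 14 (nd w.1) ≠ s0.mem 14 (nd u) := by
            intro e
            rw [e, h15] at hw'
            omega
          simp [this, hw']
      · intro w hwn
        by_cases ew : nd w.1 = nd u
        · simp [ew]
        · obtain ⟨d1, d2⟩ := hi.done w (by omega)
          have : s0.mem 14 (nd w.1) ≠ s0.mem 14 (nd u) := by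
            intro e
            rw [e] at d1
            exact d1 h15
          simp [ew, this, d1, d2]
      · intro v hv hvw
        have : nd v ≠ nd u := by
          intro e
          exact hvw (hinj v hv e.symm ▸ hw)
        simp [this, hi.not_word v hv hvw]
    · have e : numberNode.apply s = ((s.setReg 17 (s0.mem 14 (nd u))).setMem 16 (nd u)
          (s.mem 15 (s0.mem 14 (nd u)))).setReg 16 (nd u + 1) := by
        simp [numberNode, Program.apply, Expr.eval, h16, h13, h15, m14]
      rw [e]
      refine ⟨⟨by simpa using hi.bound, by simpa using hi.inj, by simpa using hi.surj, ?_, ?_⟩,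
        by simp⟩
      · intro w hwn
        by_cases ew : nd w.1 = nd u
        · simp [ew, h15]
        · obtain ⟨d1, d2⟩ := hi.done w (by omega)
          simp [ew, d1, d2]
      · intro v hv hvw
        have : nd v ≠ nd u := by
          intro e
          exact hvw (hinj v hv e.symm ▸ hw)
        simp [this, hi.not_word v hv hvw]
  · have h13 : s.mem 13 (nd u) = 0 := by
      rw [m13]
      by_contra h
      exact hw (hmark.1 h)
    have e : numberNode.apply s = s.setReg 16 (nd u + 1) := by
      simp [numberNode, Program.apply, Expr.eval, h16, h13]
    rw [e]
    refine ⟨⟨by simpa using hi.bound, by simpa using hi.inj, by simpa using hi.surj, ?_,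
      by simpa using hi.not_word⟩, by simp⟩
    intro w hwn
    have : nd w.1 ≠ nd u := by
      intro e
      exact hw (hinj _ (words_mem_prefixFinset w.2) e.symm ▸ w.2)
    simpa using hi.done w (by omega)

theorem numberRanks_spec (hl : l.toFinset = S) {s : State} (hp : Parsed S l nd s)
    (hc : Components S l nd l.length s) (h15 : ∀ i, s.mem 15 i = 0) (h16 : ∀ i, s.mem 16 i = 0) :
    Runs numberRanks s ((S.prefixFinset.card + 1) * 50) fun s' =>
      ∃ (r : ℕ) (f : S.Ranks ≃ Fin r), Ranked S nd f s' := by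
  let Inv : ℕ → State → Prop := fun n s' => s'.mem 13 = s.mem 13 ∧ s'.mem 14 = s.mem 14 ∧
    s'.reg 6 = S.prefixFinset.card ∧ s'.reg 16 = n ∧ Numbered S nd (s.mem 14) n s'
  refine Runs.mono (c := 4 + (S.prefixFinset.card + 1) * (numberNode.bound + 4)) ?_ ?_
    (fun _ h => h)
  swap
  · have : numberNode.bound ≤ 35 := by decide
    nlinarith [Nat.mul_le_mul_left (S.prefixFinset.card + 1) this]
  refine Runs.seq ((Runs.straight rfl ?_).mono (by decide)
    (Post := fun s' => s' = (s.setReg 1 0).setReg 16 0) ?_)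
  · simp [Program.apply, Expr.eval]
  rintro _ rfl
  refine (Runs.for (c := numberNode.bound) (Inv := Inv) S.prefixFinset.card
    ?_ ?_ ?_).mono (by rfl) ?_
  · refine ⟨by simp, by simp, by simp [hp.trie.card], by simp, ?_, ?_, ?_, ?_, ?_⟩
    · simp [h15]
    · simp [h15]
    · intro b hb hb'
      simp at hb'
      omega
    · intro w hw
      omega
    · simp [h16]
  · rintro i s' hi ⟨-, -, q3, q4, -⟩
    simp only [Expr.eval, q3, q4]
    omega
  · rintro i s' hi ⟨q1, q2, q3, q4, q5⟩
    obtain ⟨k1, k2⟩ := numberNode_spec hl hp.trie hc hi q1 q2 q4 q5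
    refine (Runs.straight (Post := fun s'' => s'' = numberNode.apply s') rfl rfl).frame.mono
      le_rfl ?_
    rintro _ ⟨rfl, f1, f2⟩
    exact ⟨(f2 13 (by decide)).trans q1, (f2 14 (by decide)).trans q2,
      (f1 6 (by decide)).trans q3, k2, k1⟩
  · rintro s' ⟨-, -, -, -, q⟩
    have hdone : ∀ w : S.words, s'.mem 15 (s.mem 14 (nd w.1)) ≠ 0 ∧
        s'.mem 16 (nd w.1) = s'.mem 15 (s.mem 14 (nd w.1)) := fun w =>
      q.done w (hp.trie.lt _ (words_mem_prefixFinset w.2))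
    -- The entries of array `15` start at `1`, and the ranks are to be numbered from `0`.
    let F : S.words → ℕ := fun w => s'.mem 15 (s.mem 14 (nd w.1)) - 1
    have hF : ∀ w w', F w = F w' ↔ S.comp w = S.comp w' := by
      intro w w'
      rw [← hc.comp_eq_iff hl]
      constructor
      · intro e
        refine q.inj _ _ (hdone w).1 ?_
        have h1 := (hdone w).1
        have h2 := (hdone w').1
        simp only [F] at e
        omega
      · intro e
        simp only [F, e]
    have hlt : ∀ w, F w < s'.reg 1 := by
      intro w
      have h1 := (hdone w).1
      have h2 := q.bound (s.mem 14 (nd w.1))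
      simp only [F]
      omega
    let f : S.Ranks → Fin (s'.reg 1) := fun c => ⟨F (Quot.out c), hlt _⟩
    have hf : ∀ w, (f (S.comp w) : ℕ) = F w := fun w =>
      (hF _ _).2 (Quot.out_eq (S.comp w))
    have hbij : Function.Bijective f := by
      constructor
      · intro c c' e
        have := (hF _ _).1 (congrArg Fin.val e)
        rw [← Quot.out_eq c, ← Quot.out_eq c']
        exact this
      · intro b
        obtain ⟨w, hw⟩ := q.surj (b + 1) (by omega) b.2
        refine ⟨S.comp w, Fin.ext ?_⟩
        rw [hf]
        simp only [F, hw]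
        omega
    refine ⟨_, Equiv.ofBijective f hbij, rfl, fun w => ?_, q.not_word⟩
    rw [(hdone w).2, Equiv.ofBijective_apply, hf]
    have := (hdone w).1
    simp only [F]
    omega

end Learner

/-! ### The order of the ranks

Array `3` is the table of a reflexive and transitive relation on the ranks, into which the strict
preferences of the sample are inserted one by one. Array `17` contains the beginnings of its
rows. -/

set_option linter.unusedSectionVars false

namespace Learner

open RAM Sample

variable {σ : Type*} [Fintype σ] [LinearOrder σ] {S : Sample σ} {nd : List σ → ℕ}
  {l : List (List σ × List σ × Comparison)}

def initOrder : Program :=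
  .seq (.set 16 (.lit 0)) <|
  .loop (.sub (.reg 1) (.reg 16)) <|
    .seq (.put 17 (.add (.reg 16) (.lit 1)) (.add (.get 17 (.reg 16)) (.reg 1))) <|
    .seq (.put 3 (.add (.get 17 (.reg 16)) (.reg 16)) (.lit 1)) <|
    .set 16 (.add (.reg 16) (.lit 1))

def insertCell : Program :=
  .seq (.cond (.get 3 (.add (.get 17 (.reg 18)) (.reg 23)))
    (.put 3 (.add (.get 17 (.reg 16)) (.reg 23)) (.lit 1)) .skip) <|
  .set 23 (.add (.reg 23) (.lit 1))

def insertRow : Program :=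
  .seq (.cond (.get 3 (.add (.get 17 (.reg 16)) (.reg 17)))
    (.seq (.set 23 (.lit 0)) (.loop (.sub (.reg 1) (.reg 23)) insertCell)) .skip) <|
  .set 16 (.add (.reg 16) (.lit 1))

/-- If a relation `G` is reflexive and transitive, its closure after adding an edge from `c` to `d`
relates `x` to `y` if `G x y`, or `G x c` and `G d y`. One pass over the table is enough. -/
def insertEdge : Program :=
  .seq (.seq (.set 17 (.sub (.get 16 (.get 7 (.reg 24))) (.lit 1))) <|
    .seq (.set 18 (.sub (.get 16 (.get 8 (.reg 24))) (.lit 1))) (.set 16 (.lit 0))) <|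
  .loop (.sub (.reg 1) (.reg 16)) insertRow

def orderStep : Program :=
  .seq (.cond (neq (.get 9 (.reg 24)) (.lit 1)) .skip insertEdge) <|
  .set 24 (.add (.reg 24) (.lit 1))

def orderRanks : Program :=
  .seq initOrder <|
  .seq (.set 24 (.lit 0)) <|
  .loop (.sub (.reg 4) (.reg 24)) orderStep

open Classical in
/-- Array `3` is the table of the relation `G` on `0, …, r - 1`. -/
structure OrderTable (r : ℕ) (G : ℕ → ℕ → Prop) (s : State) : Prop where
  count : s.reg 1 = r
  row : ∀ i < r, s.mem 17 i = i * r
  entry : ∀ x < r, ∀ y < r, s.mem 3 (x * r + y) = if G x y then 1 else 0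

theorem OrderTable.ne_zero_iff {r : ℕ} {G : ℕ → ℕ → Prop} {s : State} (h : OrderTable r G s)
    {x y : ℕ} (hx : x < r) (hy : y < r) : s.mem 3 (x * r + y) ≠ 0 ↔ G x y := by
  rw [h.entry x hx y hy]
  split_ifs with k <;> simp [k]

theorem OrderTable.congr {r : ℕ} {G G' : ℕ → ℕ → Prop} {s : State} (h : OrderTable r G s)
    (hG : ∀ x < r, ∀ y < r, G x y ↔ G' x y) : OrderTable r G' s := by
  classical
  refine ⟨h.count, h.row, fun x hx y hy => ?_⟩
  rw [h.entry x hx y hy, if_congr (hG x hx y hy) rfl rfl]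

theorem initOrder_spec {s : State} (h3 : ∀ i, s.mem 3 i = 0) (h17 : ∀ i, s.mem 17 i = 0) :
    Runs initOrder s ((s.reg 1 + 1) * 30) (OrderTable (s.reg 1) (· = ·)) := by
  set r := s.reg 1 with hr
  let Inv : ℕ → State → Prop := fun n s' => s'.reg 1 = r ∧ s'.reg 16 = n ∧
    (∀ i ≤ n, s'.mem 17 i = i * r) ∧
    ∀ x < r, ∀ y < r, s'.mem 3 (x * r + y) = if x = y ∧ x < n then 1 else 0
  refine Runs.mono (c := 2 + (r + 1) * (20 + 4)) ?_ (by omega) (fun _ h => h)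
  refine Runs.seq ((Runs.straight rfl ?_).mono (by decide)
    (Post := fun s' => s' = s.setReg 16 0) ?_)
  · simp [Program.apply, Expr.eval]
  rintro _ rfl
  refine (Runs.for (c := 20) (Inv := Inv) r ?_ ?_ ?_).mono (by rfl) ?_
  · exact ⟨by simp [hr], by simp, by simp [h17], by simp [h3]⟩
  · rintro i s' hi ⟨k1, k2, -⟩
    simp only [Expr.eval, k1, k2]
    omega
  · rintro i s' hi ⟨k1, k2, k3, k4⟩
    have hrow := k3 i le_rfl
    refine (Runs.straight rfl ?_).mono (by decide) (fun _ h => h)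
    have e : Program.apply (.seq (.put 17 (.add (.reg 16) (.lit 1)) (.add (.get 17 (.reg 16))
        (.reg 1))) <| .seq (.put 3 (.add (.get 17 (.reg 16)) (.reg 16)) (.lit 1)) <|
        .set 16 (.add (.reg 16) (.lit 1))) s' =
        ((s'.setMem 17 (i + 1) ((i + 1) * r)).setMem 3 (i * r + i) 1).setReg 16 (i + 1) := by
      simp [Program.apply, Expr.eval, k1, k2, hrow, add_mul]
    rw [e]
    refine ⟨by simpa using k1, by simp, fun j hj => ?_, fun x hx y hy => ?_⟩
    · by_cases ej : j = i + 1
      · simp [ej]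
      · simp [ej, k3 j (by omega)]
    · by_cases exy : x * r + y = i * r + i
      · obtain ⟨rfl, rfl⟩ := tableIndex_inj hy hi exy
        simp
      · have : (x = y ∧ x < i + 1) ↔ (x = y ∧ x < i) := by
          constructor
          · rintro ⟨rfl, h⟩
            refine ⟨rfl, ?_⟩
            rcases Nat.lt_succ_iff_lt_or_eq.1 h with k | rfl
            · exact k
            · exact absurd rfl exy
          · rintro ⟨rfl, h⟩
            exact ⟨rfl, by omega⟩
        simp only [State.setReg_mem, State.setMem_mem, if_true, if_neg exy]
        rw [if_neg (by decide), k4 x hx y hy, if_congr this.symm rfl rfl]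
  · rintro s' ⟨k1, k2, k3, k4⟩
    refine ⟨k1, fun i hi => k3 i hi.le, fun x hx y hy => ?_⟩
    rw [k4 x hx y hy]
    simp [hx]

/-- The relation `G` with an edge from `c` to `d` inserted, when the rows below `i` and the first
`n` entries of the row `i` have been updated. -/
def insertRel (G : ℕ → ℕ → Prop) (c d i n x y : ℕ) : Prop :=
  G x y ∨ ((x < i ∨ x = i ∧ y < n) ∧ G x c ∧ G d y)

theorem insertCell_spec {r c d i n : ℕ} {G : ℕ → ℕ → Prop} {s : State} (hd : d < r)
    (hi : i < r) (hn : n < r) (hic : G i c) (h : OrderTable r (insertRel G c d i n) s)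
    (h16 : s.reg 16 = i) (h18 : s.reg 18 = d) (h23 : s.reg 23 = n) :
    OrderTable r (insertRel G c d i (n + 1)) (insertCell.apply s) ∧
      (insertCell.apply s).reg 23 = n + 1 := by
  classical
  -- The row `d` is read while the table is being overwritten. This is harmless: an entry is added
  -- to the row `d` only in columns where that row has an entry anyway.
  have hdn : insertRel G c d i n d n ↔ G d n := by
    unfold insertRel
    tauto
  have key : ∀ x y, (x ≠ i ∨ y ≠ n ∨ ¬ G d n) →
      (insertRel G c d i n x y ↔ insertRel G c d i (n + 1) x y) := by
    intro x y hxy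
    unfold insertRel
    constructor
    · rintro (k | ⟨k | ⟨k, k'⟩, k2⟩)
      · exact Or.inl k
      · exact Or.inr ⟨Or.inl k, k2⟩
      · exact Or.inr ⟨Or.inr ⟨k, by omega⟩, k2⟩
    · rintro (k | ⟨k | ⟨k, k'⟩, k2⟩)
      · exact Or.inl k
      · exact Or.inr ⟨Or.inl k, k2⟩
      · refine Or.inr ⟨Or.inr ⟨k, ?_⟩, k2⟩
        rcases Nat.lt_succ_iff_lt_or_eq.1 k' with q | rfl
        · exact q
        · rcases hxy with q | q | q
          · exact absurd k q
          · exact absurd rfl q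
          · exact absurd k2.2 q
  have hz := (h.ne_zero_iff hd hn).trans hdn
  by_cases hG : G d n
  · have e : insertCell.apply s = (s.setMem 3 (i * r + n) 1).setReg 23 (n + 1) := by
      have := hz.2 hG
      simp [insertCell, Program.apply, Expr.eval, h18, h23, h16, h.row d hd, h.row i hi, this]
    rw [e]
    refine ⟨⟨by simpa using h.count, by simpa using h.row, fun x hx y hy => ?_⟩, by simp⟩
    by_cases exy : x * r + y = i * r + n
    · obtain ⟨rfl, rfl⟩ := tableIndex_inj hy hn exy
      have : insertRel G c d x (y + 1) x y := Or.inr ⟨Or.inr ⟨rfl, by omega⟩, hic, hG⟩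
      simp [this]
    · have hk := key x y (by
        by_contra! hcon
        exact exy (by rw [hcon.1, hcon.2.1]))
      simp [exy, h.entry x hx y hy, hk]
  · have h0 : s.mem 3 (d * r + n) = 0 := by
      by_contra h0
      exact hG (hz.1 h0)
    have e : insertCell.apply s = s.setReg 23 (n + 1) := by
      simp [insertCell, Program.apply, Expr.eval, h18, h23, h.row d hd, h0]
    rw [e]
    have hk := fun x y => key x y (Or.inr (Or.inr hG))
    refine ⟨⟨by simpa using h.count, by simpa using h.row, fun x hx y hy => ?_⟩, by simp⟩
    simp [h.entry x hx y hy, hk]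

theorem insertRow_spec {r c d i : ℕ} {G : ℕ → ℕ → Prop} {s : State} (hc : c < r) (hd : d < r)
    (hi : i < r) (h : OrderTable r (insertRel G c d i 0) s)
    (h16 : s.reg 16 = i) (h17 : s.reg 17 = c) (h18 : s.reg 18 = d) :
    Runs insertRow s ((r + 1) * 40) fun s' =>
      OrderTable r (insertRel G c d (i + 1) 0) s' ∧ s'.reg 16 = i + 1 := by
  refine Runs.mono (c := (6 + (3 + (r + 1) * (20 + 4))) + 4) ?_ (by omega) (fun _ h => h)
  refine Runs.seq (Runs.mono (c := 6 + (3 + (r + 1) * (20 + 4)))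
    (Post := fun s' => OrderTable r (insertRel G c d (i + 1) 0) s' ∧ s'.reg 16 = i) ?_ le_rfl ?_)
  · have hic : insertRel G c d i 0 i c ↔ G i c := by
      unfold insertRel
      simp
    have hz := (h.ne_zero_iff hi hc).trans hic
    by_cases hG : G i c
    · refine (Runs.cond_true (c := 2 + (r + 1) * (20 + 4)) ?_ ?_).mono
        (by simp only [Expr.cost]; omega) (fun _ h => h)
      · simpa [Expr.eval, h16, h17, h.row i hi] using hz.2 hG
      · refine Runs.seq ((Runs.straight rfl ?_).mono (by decide)
          (Post := fun s' => s' = s.setReg 23 0) ?_)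
        · simp [Program.apply, Expr.eval]
        rintro _ rfl
        let Inv : ℕ → State → Prop := fun n s' => OrderTable r (insertRel G c d i n) s' ∧
          s'.reg 16 = i ∧ s'.reg 18 = d ∧ s'.reg 23 = n
        refine (Runs.for (c := 20) (Inv := Inv) r ?_ ?_ ?_).mono (by rfl) ?_
        · exact ⟨⟨by simpa using h.count, by simpa using h.row, by simpa using h.entry⟩,
            by simpa using h16, by simpa using h18, by simp⟩
        · rintro n s' hn ⟨k1, -, -, k4⟩
          simp only [Expr.eval, k1.count, k4]
          omega
        · rintro n s' hn ⟨k1, k2, k3, k4⟩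
          obtain ⟨q1, q2⟩ := insertCell_spec hd hi hn hG k1 k2 k3 k4
          refine (Runs.straight (Post := fun s'' => s'' = insertCell.apply s') rfl
            rfl).frame.mono (by decide) ?_
          rintro _ ⟨rfl, f1, -⟩
          exact ⟨q1, (f1 16 (by decide)).trans k2, (f1 18 (by decide)).trans k3, q2⟩
        · rintro s' ⟨k1, k2, -, -⟩
          refine ⟨k1.congr fun x hx y hy => ?_, k2⟩
          unfold insertRel
          constructor
          · rintro (k | ⟨k, k2⟩)
            · exact Or.inl k
            · exact Or.inr ⟨Or.inl (by omega), k2⟩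
          · rintro (k | ⟨k, k2⟩)
            · exact Or.inl k
            · exact Or.inr ⟨by omega, k2⟩
    · have h0 : s.mem 3 (i * r + c) = 0 := by
        by_contra h0
        exact hG (hz.1 h0)
      refine (Runs.cond_false (c := 1) ?_ (Runs.straight (p := .skip)
        (Post := fun s' => s' = s) rfl rfl)).mono (by simp only [Expr.cost]; omega) ?_
      · simpa [Expr.eval, h16, h17, h.row i hi] using h0
      · rintro _ rfl
        refine ⟨h.congr fun x hx y hy => ?_, h16⟩
        unfold insertRel
        constructor
        · rintro (k | ⟨k, k2⟩)
          · exact Or.inl k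
          · exact Or.inr ⟨Or.inl (by omega), k2⟩
        · rintro (k | ⟨k, k2⟩)
          · exact Or.inl k
          · rcases (show x < i ∨ x = i by omega) with q | rfl
            · exact Or.inr ⟨Or.inl q, k2⟩
            · exact absurd k2.1 hG
  · rintro s' ⟨k1, k2⟩
    refine Runs.straight (p := .set 16 (.add (.reg 16) (.lit 1))) rfl ?_
    exact ⟨⟨k1.count, k1.row, k1.entry⟩, by simp [Program.apply, Expr.eval, k2]⟩

theorem insertEdge_spec {r c d : ℕ} {G : ℕ → ℕ → Prop} {s : State} (hc : c < r) (hd : d < r)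
    (h : OrderTable r G s) (h7 : s.mem 16 (s.mem 7 (s.reg 24)) = c + 1)
    (h8 : s.mem 16 (s.mem 8 (s.reg 24)) = d + 1) :
    Runs insertEdge s ((r + 1) * ((r + 1) * 40 + 4) + 20)
      (OrderTable r fun x y => G x y ∨ G x c ∧ G d y) := by
  refine Runs.mono (c := 20 + (r + 1) * ((r + 1) * 40 + 4)) ?_ (by omega) (fun _ h => h)
  refine Runs.seq ((Runs.straight rfl ?_).mono (by decide)
    (Post := fun s' => s' = ((s.setReg 17 c).setReg 18 d).setReg 16 0) ?_)
  · simp [Program.apply, Expr.eval, h7, h8]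
  rintro _ rfl
  let Inv : ℕ → State → Prop := fun n s' => OrderTable r (insertRel G c d n 0) s' ∧
    s'.reg 16 = n ∧ s'.reg 17 = c ∧ s'.reg 18 = d
  refine (Runs.for (c := (r + 1) * 40) (Inv := Inv) r ?_ ?_ ?_).mono (by rfl) ?_
  · refine ⟨OrderTable.congr (G := G) ⟨by simpa using h.count, by simpa using h.row,
      by simpa using h.entry⟩ ?_, by simp, by simp, by simp⟩
    intro x _ y _
    simp [insertRel]
  · rintro n s' hn ⟨k1, k2, -⟩
    simp only [Expr.eval, k1.count, k2]
    omega
  · rintro n s' hn ⟨k1, k2, k3, k4⟩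
    refine (insertRow_spec hc hd hn k1 k2 k3 k4).frame.mono le_rfl ?_
    rintro s'' ⟨⟨q1, q2⟩, f1, -⟩
    exact ⟨q1, q2, (f1 17 (by decide)).trans k3, (f1 18 (by decide)).trans k4⟩
  · rintro s' ⟨k1, -⟩
    refine k1.congr fun x hx y hy => ?_
    simp [insertRel, hx]

/-- The relation in array `3` after the first `n` triples. -/
structure OrderUpTo (S : Sample σ) (l : List (List σ × List σ × Comparison)) {r : ℕ}
    (f : S.Ranks ≃ Fin r) (n : ℕ) (G : ℕ → ℕ → Prop) : Prop where
  sound : ∀ o o' : S.Ranks, G (f o) (f o') → Relation.ReflTransGen S.rankRel o o'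
  refl : ∀ x, G x x
  trans : ∀ x y z, G x y → G y z → G x z
  complete : ∀ j (h : j < l.length), j < n → l[j].2.2 = .strict →
    ∀ (h1 : l[j].1 ∈ S.words) (h2 : l[j].2.1 ∈ S.words),
      G (f (S.comp ⟨_, h1⟩)) (f (S.comp ⟨_, h2⟩))

theorem orderStep_spec (hl : l.toFinset = S) {s : State} {n r : ℕ} {f : S.Ranks ≃ Fin r}
    {G : ℕ → ℕ → Prop} (hp : Parsed S l nd s) (hk : Ranked S nd f s)
    (hn : n < l.length) (h24 : s.reg 24 = n) (ht : OrderTable r G s) (hG : OrderUpTo S l f n G) :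
    Runs orderStep s ((r + 1) * ((r + 1) * 40 + 4) + 40) fun s' =>
      s'.reg 24 = n + 1 ∧ ∃ G', OrderTable r G' s' ∧ OrderUpTo S l f (n + 1) G' := by
  have hw := getElem_mem_words hl hn
  refine Runs.mono (c := (15 + ((r + 1) * ((r + 1) * 40 + 4) + 20)) + 4) ?_ (by omega)
    (fun _ h => h)
  refine Runs.seq (Runs.mono (c := 15 + ((r + 1) * ((r + 1) * 40 + 4) + 20))
    (Post := fun s' => s'.reg 24 = n ∧ ∃ G', OrderTable r G' s' ∧ OrderUpTo S l f (n + 1) G')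
    ?_ le_rfl ?_)
  · have hlab : s.mem 9 n = l[n].2.2.code := hp.label n hn
    by_cases hb : l[n].2.2 = .strict
    · have h0 : (neq (.get 9 (.reg 24)) (.lit 1)).eval s = 0 := by
        rw [neq_eval]
        simp [Expr.eval, h24, hlab, hb, Comparison.code]
      have hs := insertEdge_spec (f (S.comp ⟨_, hw.1⟩)).2 (f (S.comp ⟨_, hw.2⟩)).2 ht
        (by rw [h24, hp.left n hn, hk.word ⟨_, hw.1⟩]) (by rw [h24, hp.right n hn, hk.word ⟨_, hw.2⟩])
      refine (Runs.cond_false h0 hs.frame).mono (by simp only [Expr.cost, neq]; omega) ?_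
      rintro s' ⟨k1, k2, -⟩
      refine ⟨(k2 24 (by decide)).trans h24, _, k1, ?_, ?_, ?_, ?_⟩
      · rintro o o' (k | ⟨k, k'⟩)
        · exact hG.sound o o' k
        · refine (hG.sound _ _ k).trans (.head ?_ (hG.sound _ _ k'))
          refine ⟨⟨_, hw.1⟩, ⟨_, hw.2⟩, rfl, rfl, ?_⟩
          rw [← hb]
          exact (mem_iff_of_toFinset hl).2 (List.getElem_mem hn)
      · intro x
        exact Or.inl (hG.refl x)
      · rintro x y z (k | ⟨k1, k2⟩) (q | ⟨q1, q2⟩)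
        · exact Or.inl (hG.trans _ _ _ k q)
        · exact Or.inr ⟨hG.trans _ _ _ k q1, q2⟩
        · exact Or.inr ⟨k1, hG.trans _ _ _ k2 q⟩
        · exact Or.inr ⟨k1, q2⟩
      · intro j hj hjn hjb h1 h2
        rcases Nat.lt_succ_iff_lt_or_eq.1 hjn with k | rfl
        · exact Or.inl (hG.complete j hj k hjb h1 h2)
        · exact Or.inr ⟨hG.refl _, hG.refl _⟩
    · have h0 : (neq (.get 9 (.reg 24)) (.lit 1)).eval s ≠ 0 := by
        rw [ne_eq, neq_eval]
        simp only [Expr.eval, h24, hlab]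
        cases hx : l[n].2.2 <;> simp_all [Comparison.code]
      refine (Runs.cond_true h0 (Runs.straight (p := .skip) (Post := fun s' => s' = s) rfl
        rfl)).mono (by simp only [Expr.cost, Program.bound, neq]; omega) ?_
      rintro _ rfl
      refine ⟨h24, G, ht, hG.sound, hG.refl, hG.trans, ?_⟩
      intro j hj hjn hjb
      rcases Nat.lt_succ_iff_lt_or_eq.1 hjn with k | rfl
      · exact hG.complete j hj k hjb
      · exact absurd hjb hb
  · rintro s' ⟨k1, G', k2, k3⟩
    refine Runs.straight (p := .set 24 (.add (.reg 24) (.lit 1))) rfl ?_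
    exact ⟨by simp [Program.apply, Expr.eval, k1], G', ⟨k2.count, k2.row, k2.entry⟩, k3⟩

theorem Ranked.congr {r : ℕ} {f : S.Ranks ≃ Fin r} {s s' : State} (h : Ranked S nd f s)
    (h1 : s'.reg 1 = s.reg 1) (h16 : s'.mem 16 = s.mem 16) : Ranked S nd f s' :=
  ⟨h1.trans h.count, by rw [h16]; exact h.word, by rw [h16]; exact h.not_word⟩

/-- The final contents of array `3`. -/
def Ordered (S : Sample σ) {r : ℕ} (f : S.Ranks ≃ Fin r) (s : State) : Prop :=
  ∀ o o' : S.Ranks, (Relation.ReflTransGen S.rankRel o o' → s.mem 3 ((f o : ℕ) * r + f o') = 1) ∧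
    (¬ Relation.ReflTransGen S.rankRel o o' → s.mem 3 ((f o : ℕ) * r + f o') = 0)

theorem orderRanks_spec (hl : l.toFinset = S) {s : State} {r : ℕ} {f : S.Ranks ≃ Fin r}
    (hp : Parsed S l nd s) (hk : Ranked S nd f s) (h3 : ∀ i, s.mem 3 i = 0)
    (h17 : ∀ i, s.mem 17 i = 0) :
    Runs orderRanks s ((l.length + 1) * ((r + 1) * (r + 1)) * 150) (Ordered S f) := by
  let Inv : ℕ → State → Prop := fun n s' => Parsed S l nd s' ∧ Ranked S nd f s' ∧
    s'.reg 24 = n ∧ ∃ G, OrderTable r G s' ∧ OrderUpTo S l f n G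
  refine Runs.mono (c := (r + 1) * 30 +
    (2 + (l.length + 1) * (((r + 1) * ((r + 1) * 40 + 4) + 40) + 4))) ?_ ?_ (fun _ h => h)
  swap
  · have h1 : 1 ≤ (r + 1) * (r + 1) := Nat.one_le_iff_ne_zero.2 (by positivity)
    have h2 : r + 1 ≤ (r + 1) * (r + 1) := Nat.le_mul_self _
    have h3 : (r + 1) * ((r + 1) * 40 + 4) + 40 + 4 ≤ (r + 1) * (r + 1) * 88 := by nlinarith
    have h4 := Nat.mul_le_mul_left (l.length + 1) h3
    have h5 : (r + 1) * (r + 1) ≤ (l.length + 1) * ((r + 1) * (r + 1)) :=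
      Nat.le_mul_of_pos_left _ (by omega)
    nlinarith
  have hi := initOrder_spec h3 h17
  rw [hk.count] at hi
  refine Runs.seq_frame hi ?_
  intro s1 k1 k2 k3
  refine Runs.seq ((Runs.straight rfl ?_).mono (by decide)
    (Post := fun s' => s' = s1.setReg 24 0) ?_)
  · simp [Program.apply, Expr.eval]
  rintro _ rfl
  refine (Runs.for (c := (r + 1) * ((r + 1) * 40 + 4) + 40) (Inv := Inv) l.length
    ?_ ?_ ?_).mono (by rfl) ?_
  · have hp1 := hp.congr k2 k3
    refine ⟨hp1.congr (R := [24]) (M := []) ?_ (by simp),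
      hk.congr (by simpa using k2 1 (by decide)) (by simpa using k3 16 (by decide)), by simp,
      (· = ·), ⟨by simpa using k1.count, by simpa using k1.row, by simpa using k1.entry⟩,
      ?_, fun _ => rfl, fun _ _ _ => Eq.trans, ?_⟩
    · intro x hx
      have : x ≠ 24 := by simpa using hx
      simp [this]
    · intro o o' e
      rw [f.injective (Fin.ext e)]
    · intro j _ hj
      omega
  · rintro i s' hi ⟨q1, -, q2, -⟩
    simp only [Expr.eval, q1.count, q2]
    omega
  · rintro i s' hi ⟨q1, q2, q3, G, q4, q5⟩
    refine (orderStep_spec hl q1 q2 hi q3 q4 q5).frame.mono le_rfl ?_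
    rintro s'' ⟨⟨r1, r2⟩, f1, f2⟩
    exact ⟨q1.congr f1 f2, q2.congr (f1 1 (by decide)) (f2 16 (by decide)), r1, r2⟩
  · rintro s' ⟨-, -, -, G, q4, q5⟩
    -- The relation in the table is reflexive, transitive and contains all edges, so it contains the
    -- closure; soundness is the other inclusion.
    have key : ∀ o o' : S.Ranks, Relation.ReflTransGen S.rankRel o o' → G (f o) (f o') := by
      intro o o' h
      induction h with
      | refl => exact q5.refl _
      | tail _ hr ih =>
        refine q5.trans _ _ _ ih ?_
        obtain ⟨w, w', rfl, rfl, hm⟩ := hr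
        obtain ⟨j, hj, e⟩ := List.getElem_of_mem ((mem_iff_of_toFinset hl).1 hm)
        have := q5.complete j hj hj (by rw [e])
        simp only [e] at this
        exact this w.2 w'.2
    intro o o'
    rw [q4.entry _ (f o).2 _ (f o').2]
    constructor
    · intro h
      rw [if_pos (key o o' h)]
    · intro h
      rw [if_neg fun k => h (q5.sound o o' k)]

end Learner

/-! ### The machine computes a run

Register `20` holds the position of the last prefix whose target (in array `18`) is used, register
`19` the number of entries of the transition table, register `22` the position of the current
prefix, and register `21` is set to `1` if two ranks clash. The numbers of the blocks are stored in
array `4`, the transitions in array `1`, the ranks in array `2`, and the number of blocks in register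
`0`. The transition into the initial state, which stands for a prefix without a parent, is a
dummy that is stored behind the transition table. -/

set_option linter.unusedSectionVars false

namespace Learner

open RAM Sample

variable {σ : Type*} [Fintype σ] [LinearOrder σ] {S : Sample σ} {nd : List σ → ℕ}
  {l : List (List σ × List σ × Comparison)}

/-- One cell more than the table has is cleared, namely that of the dummy transition into the
initial state. -/
def clearTransitions : Program :=
  .seq (.set 16 (.lit 0)) <|
  .loop (.sub (.add (.reg 19) (.lit 1)) (.reg 16)) <|
    .seq (.put 1 (.reg 16) (.lit 0)) (.set 16 (.add (.reg 16) (.lit 1)))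

def clearRanks : Program :=
  .seq (.set 16 (.lit 0)) <|
  .loop (.sub (.reg 6) (.reg 16)) <|
    .seq (.put 2 (.reg 16) (.lit 0)) (.set 16 (.add (.reg 16) (.lit 1)))

def findEdge : Program :=
  .seq (.cond (.reg 22)
    (.set 10 (.add (.get 6 (.get 4 (.get 11 (.reg 22)))) (.get 12 (.reg 22))))
    (.set 10 (.reg 19))) <|
  .set 15 (.get 1 (.reg 10))

/-- With truncated subtraction, `n - (n - t)` is the minimum of `t` and `n`: a target beyond the
existing blocks becomes a new block. -/
def openBlock : Program :=
  .seq (.cond (.sub (.reg 22) (.reg 20)) (.set 23 (.reg 0))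
    (.set 23 (.sub (.reg 0) (.sub (.reg 0) (.get 18 (.reg 22)))))) <|
  .seq (.cond (neq (.reg 23) (.reg 0)) .skip (.set 0 (.add (.reg 0) (.lit 1)))) <|
  .seq (.set 15 (.add (.reg 23) (.lit 1))) <|
  .put 1 (.reg 10) (.reg 15)

def placePrefix : Program :=
  .seq findEdge <|
  .seq (.cond (.reg 15) .skip openBlock) <|
  .put 4 (.reg 22) (.sub (.reg 15) (.lit 1))

def checkRank : Program :=
  .seq (.cond (.get 16 (.get 10 (.reg 22)))
    (.cond (.get 2 (.sub (.reg 15) (.lit 1)))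
      (.cond (neq (.get 2 (.sub (.reg 15) (.lit 1))) (.get 16 (.get 10 (.reg 22))))
        (.set 21 (.lit 1)) .skip)
      (.put 2 (.sub (.reg 15) (.lit 1)) (.get 16 (.get 10 (.reg 22))))) .skip) <|
  .set 22 (.add (.reg 22) (.lit 1))

def computeRun : Program :=
  .seq clearTransitions <|
  .seq clearRanks <|
  .seq (.seq (.set 0 (.lit 0)) <| .seq (.set 21 (.lit 0)) (.set 22 (.lit 0))) <|
  .loop (.sub (.reg 6) (.reg 22)) (.seq placePrefix checkRank)

theorem clearTransitions_spec (s : State) :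
    Runs clearTransitions s ((s.reg 19 + 2) * 20) fun s' => ∀ i ≤ s.reg 19, s'.mem 1 i = 0 := by
  let Inv : ℕ → State → Prop := fun n s' => s'.reg 19 = s.reg 19 ∧ s'.reg 16 = n ∧
    ∀ i < n, s'.mem 1 i = 0
  refine Runs.mono (c := 2 + (s.reg 19 + 1 + 1) * (7 + 6)) ?_ (by omega) (fun _ h => h)
  refine Runs.seq ((Runs.straight rfl ?_).mono (by decide)
    (Post := fun s' => s' = s.setReg 16 0) ?_)
  · simp [Program.apply, Expr.eval]
  rintro _ rfl
  refine (Runs.for (c := 7) (Inv := Inv) (s.reg 19 + 1) ?_ ?_ ?_).mono (by rfl) ?_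
  · exact ⟨by simp, by simp, by simp⟩
  · rintro i s' hi ⟨k1, k2, -⟩
    simp only [Expr.eval, k1, k2]
    omega
  · rintro i s' hi ⟨k1, k2, k3⟩
    refine (Runs.straight rfl ?_).mono (by decide) (fun _ h => h)
    simp only [Program.apply, Expr.eval, k2]
    refine ⟨by simpa using k1, by simp [k2], fun j hj => ?_⟩
    by_cases e : j = i
    · simp [e]
    · simp [e, k3 j (by omega)]
  · rintro s' ⟨-, -, k3⟩ i hi
    exact k3 i (by omega)

theorem clearRanks_spec (s : State) :
    Runs clearRanks s ((s.reg 6 + 1) * 20) fun s' => ∀ i < s.reg 6, s'.mem 2 i = 0 := by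
  let Inv : ℕ → State → Prop := fun n s' => s'.reg 6 = s.reg 6 ∧ s'.reg 16 = n ∧
    ∀ i < n, s'.mem 2 i = 0
  refine Runs.mono (c := 2 + (s.reg 6 + 1) * (7 + 4)) ?_ (by omega) (fun _ h => h)
  refine Runs.seq ((Runs.straight rfl ?_).mono (by decide)
    (Post := fun s' => s' = s.setReg 16 0) ?_)
  · simp [Program.apply, Expr.eval]
  rintro _ rfl
  refine (Runs.for (c := 7) (Inv := Inv) (s.reg 6) ?_ ?_ ?_).mono (by rfl) ?_
  · exact ⟨by simp, by simp, by simp⟩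
  · rintro i s' hi ⟨k1, k2, -⟩
    simp only [Expr.eval, k1, k2]
    omega
  · rintro i s' hi ⟨k1, k2, k3⟩
    refine (Runs.straight rfl ?_).mono (by decide) (fun _ h => h)
    simp only [Program.apply, Expr.eval, k2]
    refine ⟨by simpa using k1, by simp [k2], fun j hj => ?_⟩
    by_cases e : j = i
    · simp [e]
    · simp [e, k3 j (by omega)]
  · rintro s' ⟨-, -, k3⟩
    exact k3

/-- The block numbers in array `4`. -/
noncomputable def blockOf (s : State) (u : S.prefixes) : ℕ := s.mem 4 (pos u)

/-- What is known when the prefixes at the positions below `v` have been put into blocks. -/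
structure Placed (S : Sample σ) (g : S.prefixes → ℕ → ℕ) (v : ℕ) (s : State) : Prop where
  run : ∀ u : S.prefixes, pos u < v → RunAt g (blockOf s) u
  lt : ∀ u : S.prefixes, pos u < v → blockOf s u < s.reg 0
  surj : ∀ b < s.reg 0, ∃ u : S.prefixes, pos u < v ∧ blockOf s u = b
  le : s.reg 0 ≤ v
  trans : ∀ (u x : S.prefixes) (a : σ), pos u < v → u.1 = x.1 ++ [a] →
    s.mem 1 (blockOf s x * Fintype.card σ + letterCode a) = blockOf s u + 1
  exists_trans : ∀ (b : ℕ) (a : σ), b < Nat.card S.prefixes →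
    s.mem 1 (b * Fintype.card σ + letterCode a) ≠ 0 →
    ∃ u x : S.prefixes, pos u < v ∧ u.1 = x.1 ++ [a] ∧ blockOf s x = b
  dummy : v = 0 → s.mem 1 (Nat.card S.prefixes * Fintype.card σ) = 0

/-- The current prefix goes into the block that an earlier transition leads to. -/
theorem Placed.old {g : S.prefixes → ℕ → ℕ} {s s' : State} {u u' x x' : S.prefixes} {a : σ}
    (h : Placed S g (pos u) s) (hu : u.1 = x.1 ++ [a]) (hu' : u'.1 = x'.1 ++ [a])
    (hlt : pos u' < pos u) (hx : blockOf s x' = blockOf s x) (h0 : s'.reg 0 = s.reg 0)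
    (h1 : s'.mem 1 = s.mem 1) (h4 : ∀ w : S.prefixes, w ≠ u → blockOf s' w = blockOf s w)
    (h4u : blockOf s' u = blockOf s u') : Placed S g (pos u + 1) s' := by
  have hlow : ∀ w : S.prefixes, pos w < pos u → blockOf s w = blockOf s' w := fun w hw =>
    (h4 w (by rintro rfl; omega)).symm
  have hxu := pos_lt_of_snoc hu
  have hxu' := pos_lt_of_snoc hu'
  have split : ∀ w : S.prefixes, pos w < pos u + 1 → pos w < pos u ∨ w = u := fun w hw =>
    (Nat.lt_succ_iff_lt_or_eq.1 hw).imp_right fun e => pos_injective e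
  refine ⟨fun w hw => ?_, fun w hw => ?_, fun b hb => ?_, ?_, fun w y b hw hy => ?_,
    fun b c hb hne => ?_, by omega⟩
  · rcases split w hw with k | rfl
    · exact (h.run w k).congr_of_pos fun z hz => hlow z (by omega)
    · refine Or.inl ⟨u', pos_lt_pos_iff.1 hlt, ⟨x', x, a, hu', hu, ?_⟩, ?_⟩
      · rw [← hlow x' (by omega), ← hlow x hxu, hx]
      · rw [h4u, hlow u' hlt]
  · rw [h0]
    rcases split w hw with k | rfl
    · rw [← hlow w k]; exact h.lt w k
    · rw [h4u]; exact h.lt u' hlt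
  · obtain ⟨w, hw, e⟩ := h.surj b (h0 ▸ hb)
    exact ⟨w, by omega, by rw [← hlow w hw, e]⟩
  · rw [h0]
    exact h.le.trans (by omega)
  · rw [h1]
    rcases split w hw with k | rfl
    · rw [← hlow y ((pos_lt_of_snoc hy).trans k), ← hlow w k]
      exact h.trans w y b k hy
    · obtain ⟨rfl, rfl⟩ := snoc_inj (hu.symm.trans hy)
      rw [← hlow x hxu, h4u, ← hx]
      exact h.trans u' x' a hlt hu'
  · rw [h1] at hne
    obtain ⟨w, y, hw, hy, e⟩ := h.exists_trans b c hb hne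
    exact ⟨w, y, by omega, hy, by rw [← hlow y ((pos_lt_of_snoc hy).trans hw), e]⟩

/-- The block of the current prefix is prescribed by its target. -/
theorem Placed.fresh {g : S.prefixes → ℕ → ℕ} {s s' : State} {u : S.prefixes} {ix : ℕ}
    (h : Placed S g (pos u) s) (hg : g u (s.reg 0) ≤ s.reg 0)
    (hix : (u.1 = [] ∧ ix = Nat.card S.prefixes * Fintype.card σ) ∨
      ∃ (x : S.prefixes) (a : σ), u.1 = x.1 ++ [a] ∧
        ix = blockOf s x * Fintype.card σ + letterCode a)
    (hz : s.mem 1 ix = 0)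
    (h0 : s'.reg 0 = if g u (s.reg 0) = s.reg 0 then s.reg 0 + 1 else s.reg 0)
    (h1 : ∀ j, s'.mem 1 j = if j = ix then g u (s.reg 0) + 1 else s.mem 1 j)
    (h4 : ∀ w : S.prefixes, w ≠ u → blockOf s' w = blockOf s w)
    (h4u : blockOf s' u = g u (s.reg 0)) : Placed S g (pos u + 1) s' := by
  have hlow : ∀ w : S.prefixes, pos w < pos u → blockOf s w = blockOf s' w := fun w hw =>
    (h4 w (by rintro rfl; omega)).symm
  have split : ∀ w : S.prefixes, pos w < pos u + 1 → pos w < pos u ∨ w = u := fun w hw =>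
    (Nat.lt_succ_iff_lt_or_eq.1 hw).imp_right fun e => pos_injective e
  have hmono : s.reg 0 ≤ s'.reg 0 := by rw [h0]; split_ifs <;> omega
  have hN := pos_lt_card u
  have hblock : ∀ w : S.prefixes, pos w < pos u → blockOf s w < Nat.card S.prefixes :=
    fun w hw => lt_of_lt_of_le (h.lt w hw) (h.le.trans hN.le)
  -- Earlier prefixes have filled the cells of their transitions with nonzero entries, so the empty
  -- cell `ix` belongs to none of them. This is what makes `u` fresh.
  have hne : ∀ (w y : S.prefixes) (b : σ), pos w < pos u → w.1 = y.1 ++ [b] →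
      blockOf s y * Fintype.card σ + letterCode b ≠ ix := by
    intro w y b hw hy e
    have := h.trans w y b hw hy
    rw [e, hz] at this
    omega
  refine ⟨fun w hw => ?_, fun w hw => ?_, fun b hb => ?_, ?_, fun w y b hw hy => ?_,
    fun b c hb hb' => ?_, by omega⟩
  · rcases split w hw with k | rfl
    · exact (h.run w k).congr_of_pos fun z hz => hlow z (by omega)
    · refine Or.inr ⟨?_, s.reg 0, ⟨fun v hv => ?_, fun b hb => ?_⟩, h4u⟩
      · rintro v hv ⟨y, x, a, hy, hx, e⟩
        have hv' := pos_lt_pos hv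
        have hyv := pos_lt_of_snoc hy
        have hxw := pos_lt_of_snoc hx
        rw [← hlow y (by omega), ← hlow x hxw] at e
        rcases hix with ⟨hnil, -⟩ | ⟨x', a', hx', rfl⟩
        · rw [hnil] at hx
          simp at hx
        · obtain ⟨rfl, rfl⟩ := snoc_inj (hx.symm.trans hx')
          exact hne v y a hv' hy (by rw [e])
      · have hv' := pos_lt_pos hv
        rw [← hlow v hv']
        exact h.lt v hv'
      · obtain ⟨v, hv, e⟩ := h.surj b hb
        exact ⟨v, pos_lt_pos_iff.1 hv, by rw [← hlow v hv, e]⟩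
  · rcases split w hw with k | rfl
    · rw [← hlow w k]
      exact lt_of_lt_of_le (h.lt w k) hmono
    · rw [h4u, h0]
      split_ifs <;> omega
  · by_cases hb' : b < s.reg 0
    · obtain ⟨w, hw, e⟩ := h.surj b hb'
      exact ⟨w, by omega, by rw [← hlow w hw, e]⟩
    · refine ⟨u, by omega, ?_⟩
      rw [h4u]
      rw [h0] at hb
      split_ifs at hb with k
      · omega
      · omega
  · have := h.le
    rw [h0]
    split_ifs <;> omega
  · rw [h1]
    rcases split w hw with k | rfl
    · rw [← hlow y ((pos_lt_of_snoc hy).trans k), ← hlow w k, if_neg (hne w y b k hy)]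
      exact h.trans w y b k hy
    · rcases hix with ⟨hnil, -⟩ | ⟨x', a', hx', rfl⟩
      · rw [hnil] at hy
        simp at hy
      · obtain ⟨rfl, rfl⟩ := snoc_inj (hy.symm.trans hx')
        rw [← hlow y (pos_lt_of_snoc hy), if_pos rfl, h4u]
  · rw [h1] at hb'
    split_ifs at hb' with e
    -- The dummy cell lies behind the table and is not a transition of any block.
    · rcases hix with ⟨-, rfl⟩ | ⟨x', a', hx', rfl⟩
      · have := tableIndex_lt (letterCode_lt_card c) hb
        omega
      · obtain ⟨e1, e2⟩ := tableIndex_inj (letterCode_lt_card c) (letterCode_lt_card a') e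
        rw [letterCode_injective e2]
        exact ⟨u, x', by omega, hx', by rw [← hlow x' (pos_lt_of_snoc hx'), e1]⟩
    · obtain ⟨w, y, hw, hy, e⟩ := h.exists_trans b c hb hb'
      exact ⟨w, y, by omega, hy, by rw [← hlow y ((pos_lt_of_snoc hy).trans hw), e]⟩

/-- The tables that the computation of a run makes use of. -/
structure Ready (S : Sample σ) (nd : List σ → ℕ) (s : State) : Prop where
  trie : IsTrie S.prefixFinset nd s
  listed : Listed (Set.univ : Set S.prefixes) nd s
  entries : s.reg 19 = Nat.card S.prefixes * Fintype.card σ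

theorem Ready.congr {s s' : State} (h : Ready S nd s) {R M : List ℕ}
    (hr : ∀ x, x ∉ R → s'.reg x = s.reg x) (hm : ∀ a, a ∉ M → s'.mem a = s.mem a)
    (hR : 3 ∉ R ∧ 6 ∉ R ∧ 19 ∉ R := by decide)
    (hM : 5 ∉ M ∧ 6 ∉ M ∧ 10 ∉ M ∧ 11 ∉ M ∧ 12 ∉ M := by decide) : Ready S nd s' := by
  obtain ⟨r3, r6, r19⟩ := hR
  obtain ⟨m5, m6, m10⟩ := hM
  exact ⟨h.trie.congr (hr 3 r3) (hr 6 r6) (hm 5 m5) (hm 6 m6), h.listed.congr hm m10,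
    (hr 19 r19).trans h.entries⟩

/-- The target function that is given by the array `t`, for the positions up to `I`. -/
noncomputable def arrayTarget (S : Sample σ) (t : ℕ → ℕ) (I : ℕ) : S.prefixes → ℕ → ℕ :=
  target (fun u => t (pos u)) {u | pos u ≤ I}

theorem openBlock_spec {s : State} {u : S.prefixes} {I : ℕ} (h20 : s.reg 20 = I)
    (h22 : s.reg 22 = pos u) :
    (openBlock.apply s).reg 0 = (if arrayTarget S (s.mem 18) I u (s.reg 0) = s.reg 0
      then s.reg 0 + 1 else s.reg 0) ∧
    (openBlock.apply s).reg 15 = arrayTarget S (s.mem 18) I u (s.reg 0) + 1 ∧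
    (∀ j, (openBlock.apply s).mem 1 j = if j = s.reg 10
      then arrayTarget S (s.mem 18) I u (s.reg 0) + 1 else s.mem 1 j) ∧
    (openBlock.apply s).mem 4 = s.mem 4 ∧ (openBlock.apply s).reg 22 = s.reg 22 := by
  set y := arrayTarget S (s.mem 18) I u (s.reg 0) with hy
  have e1 : Program.apply (.cond (.sub (.reg 22) (.reg 20)) (.set 23 (.reg 0))
      (.set 23 (.sub (.reg 0) (.sub (.reg 0) (.get 18 (.reg 22)))))) s = s.setReg 23 y := by
    simp only [Program.apply, Expr.eval, h20, h22]
    by_cases hI : pos u ≤ I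
    · rw [if_pos (by omega), hy, arrayTarget, target, if_pos (by exact hI)]
      congr 1
      omega
    · rw [if_neg (by omega), hy, arrayTarget, target, if_neg (by exact hI)]
  have e : openBlock.apply s = Program.apply (.seq (.cond (neq (.reg 23) (.reg 0)) .skip
      (.set 0 (.add (.reg 0) (.lit 1)))) <| .seq (.set 15 (.add (.reg 23) (.lit 1))) <|
      .put 1 (.reg 10) (.reg 15)) (s.setReg 23 y) := by
    rw [← e1]
    rfl
  rw [e]
  by_cases hyc : y = s.reg 0
  · simp only [Program.apply, neq_eval]
    simp [Expr.eval, hyc]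
    funext j
    simp
  · simp only [Program.apply, neq_eval]
    simp [Expr.eval, hyc]
    funext j
    simp

theorem placePrefix_spec {s : State} {u : S.prefixes} {t : ℕ → ℕ} {I : ℕ} (hr : Ready S nd s)
    (h20 : s.reg 20 = I) (h22 : s.reg 22 = pos u) (h18 : s.mem 18 = t)
    (h : Placed S (arrayTarget S t I) (pos u) s) :
    Placed S (arrayTarget S t I) (pos u + 1) (placePrefix.apply s) ∧
      (∀ w : S.prefixes, pos w < pos u → blockOf (placePrefix.apply s) w = blockOf s w) ∧
      (placePrefix.apply s).reg 15 = blockOf (placePrefix.apply s) u + 1 := by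
  subst h18
  -- the transition into the current prefix
  obtain ⟨ix, hix, hfind⟩ : ∃ ix, ((u.1 = [] ∧ ix = Nat.card S.prefixes * Fintype.card σ) ∨
      ∃ (x : S.prefixes) (a : σ), u.1 = x.1 ++ [a] ∧
        ix = blockOf s x * Fintype.card σ + letterCode a) ∧
      findEdge.apply s = (s.setReg 10 ix).setReg 15 (s.mem 1 ix) := by
    rcases List.eq_nil_or_concat u.1 with e | ⟨y, a, e⟩
    · refine ⟨_, Or.inl ⟨e, rfl⟩, ?_⟩
      have h0 : s.reg 22 = 0 := by rw [h22, pos_eq_zero_iff.2 e]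
      simp [findEdge, Program.apply, Expr.eval, h0, hr.entries]
    · rw [List.concat_eq_append] at e
      have hy : y ∈ S.prefixes := prefixes_of_append (e ▸ u.2)
      refine ⟨_, Or.inr ⟨⟨y, hy⟩, a, e, rfl⟩, ?_⟩
      have h0 : pos u ≠ 0 := by
        rw [ne_eq, pos_eq_zero_iff, e]
        simp
      obtain ⟨p1, p2⟩ := hr.listed.parent u trivial ⟨y, hy⟩ a e
      have hlt : pos (S := S) ⟨y, hy⟩ < pos u := pos_lt_of_snoc e
      -- The row beginnings of the trie serve for the transition table as well: both have rows of
      -- the same length, and block numbers stay below the number of nodes.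
      have hrow := hr.trie.row (blockOf s (⟨y, hy⟩ : S.prefixes)) (by
        rw [card_prefixFinset]
        exact lt_of_lt_of_le (h.lt _ hlt) (h.le.trans (pos_lt_card u).le))
      unfold blockOf at hrow ⊢
      simp [findEdge, Program.apply, Expr.eval, h22, h0, p1, p2, hrow]
  set s1 := (s.setReg 10 ix).setReg 15 (s.mem 1 ix) with hs1
  have e : placePrefix.apply s = Program.apply (.seq (.cond (.reg 15) .skip openBlock)
      (.put 4 (.reg 22) (.sub (.reg 15) (.lit 1)))) s1 := by
    rw [← hfind]
    rfl
  rw [e]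
  have hb : ∀ (s' : State) (z : ℕ) (w : S.prefixes), s'.mem 4 = s.mem 4 →
      blockOf (s'.setMem 4 (pos u) z) w = if w = u then z else blockOf s w := by
    intro s' z w h4
    simp only [blockOf, State.setMem_mem, if_true, h4]
    by_cases ew : w = u
    · simp [ew]
    · rw [if_neg fun k => ew (pos_injective k), if_neg ew]
  have hlow : ∀ w : S.prefixes, pos w < pos u → w ≠ u := by
    rintro w hw rfl
    exact lt_irrefl _ hw
  by_cases hz : s.mem 1 ix = 0
  · -- the transition is undefined
    obtain ⟨o1, o2, o3, o4, o5⟩ := openBlock_spec (s := s1) (u := u) (I := I) (by simp [hs1, h20])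
      (by simp [hs1, h22])
    have hm : s1.mem = s.mem := by simp [hs1]
    have h0 : s1.reg 0 = s.reg 0 := by simp [hs1]
    have h10 : s1.reg 10 = ix := by simp [hs1]
    have h22' : s1.reg 22 = pos u := by simp [hs1, h22]
    rw [hm, h0] at o1 o2 o3
    rw [hm] at o4
    rw [h10] at o3
    rw [h22'] at o5
    have e' : Program.apply (.seq (.cond (.reg 15) .skip openBlock)
        (.put 4 (.reg 22) (.sub (.reg 15) (.lit 1)))) s1 = (openBlock.apply s1).setMem 4 (pos u)
        (arrayTarget S (s.mem 18) I u (s.reg 0)) := by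
      have : s1.reg 15 = 0 := by simp [hs1, hz]
      simp [Program.apply, Expr.eval, this, o2, o5]
    rw [e']
    refine ⟨h.fresh (ix := ix) (target_le _ _ _ _) hix hz ?_ ?_ ?_ ?_, ?_, ?_⟩
    · simpa using o1
    · simpa using o3
    · intro w hw
      rw [hb _ _ _ o4, if_neg hw]
    · rw [hb _ _ _ o4, if_pos rfl]
    · intro w hw
      rw [hb _ _ _ o4, if_neg (hlow w hw)]
    · rw [hb _ _ _ o4, if_pos rfl]
      simpa using o2
  · -- there is a transition
    -- For `ε` the dummy cell is still empty, so a defined transition comes from a parent.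
    rcases hix with ⟨hnil, rfl⟩ | ⟨x, a, hx, rfl⟩
    · exact absurd (h.dummy (pos_eq_zero_iff.2 hnil)) hz
    have hxu := pos_lt_of_snoc hx
    obtain ⟨u', x', hu', hx', exx⟩ := h.exists_trans _ a
      (lt_of_lt_of_le (h.lt x hxu) (h.le.trans (pos_lt_card u).le)) hz
    have ht := h.trans u' x' a hu' hx'
    rw [exx] at ht
    have h15 : s1.reg 15 = blockOf s u' + 1 := by simp [hs1, ht]
    have e' : Program.apply (.seq (.cond (.reg 15) .skip openBlock)
        (.put 4 (.reg 22) (.sub (.reg 15) (.lit 1)))) s1 = s1.setMem 4 (pos u) (blockOf s u') := by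
      have h22' : s1.reg 22 = pos u := by simp [hs1, h22]
      simp [Program.apply, Expr.eval, h15, h22']
    rw [e']
    have h4 : s1.mem 4 = s.mem 4 := by simp [hs1]
    refine ⟨h.old hx hx' hu' exx (by simp [hs1]) ?_ ?_ ?_, ?_, ?_⟩
    · funext j
      simp [hs1]
    · intro w hw
      rw [hb _ _ _ h4, if_neg hw]
    · rw [hb _ _ _ h4, if_pos rfl]
    · intro w hw
      rw [hb _ _ _ h4, if_neg (hlow w hw)]
    · rw [hb _ _ _ h4, if_pos rfl]
      exact h15

/-- What is known about the ranks of the blocks when the prefixes at the positions below `v`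
have been dealt with, where `m` contains the ranks of the nodes. -/
structure Checked (S : Sample σ) (nd : List σ → ℕ) (m : ℕ → ℕ) (v : ℕ) (s : State) : Prop where
  rank : ∀ b < Nat.card S.prefixes, s.mem 2 b ≠ 0 →
    ∃ u : S.prefixes, pos u < v ∧ blockOf s u = b ∧ m (nd u.1) = s.mem 2 b
  good : s.reg 21 = 0 → ∀ u : S.prefixes, pos u < v → m (nd u.1) ≠ 0 →
    s.mem 2 (blockOf s u) = m (nd u.1)
  bad : s.reg 21 ≠ 0 → ∃ u u' : S.prefixes, pos u < v ∧ pos u' < v ∧ blockOf s u = blockOf s u' ∧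
    m (nd u.1) ≠ 0 ∧ m (nd u'.1) ≠ 0 ∧ m (nd u.1) ≠ m (nd u'.1)

theorem Checked.congr {m : ℕ → ℕ} {v : ℕ} {s s' : State} (h : Checked S nd m v s)
    (h2 : s'.mem 2 = s.mem 2) (h21 : s'.reg 21 = s.reg 21)
    (hb : ∀ w : S.prefixes, pos w < v → blockOf s' w = blockOf s w) : Checked S nd m v s' := by
  refine ⟨fun b hb' hne => ?_, fun h0 u hu hm => ?_, fun h0 => ?_⟩
  · rw [h2] at hne ⊢
    obtain ⟨u, hu, e1, e2⟩ := h.rank b hb' hne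
    exact ⟨u, hu, by rw [hb u hu, e1], e2⟩
  · rw [h2, hb u hu]
    exact h.good (h21 ▸ h0) u hu hm
  · obtain ⟨u, u', hu, hu', e, k⟩ := h.bad (h21 ▸ h0)
    exact ⟨u, u', hu, hu', by rw [hb u hu, hb u' hu', e], k⟩

/-- The first ranked prefix of a block determines the stored rank, and later ones are compared with
it; since equality is transitive, this detects every clash. -/
theorem checkRank_spec {s : State} {u : S.prefixes} {m : ℕ → ℕ} (hr : Ready S nd s)
    (h16 : s.mem 16 = m) (h22 : s.reg 22 = pos u) (h15 : s.reg 15 = blockOf s u + 1)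
    (hlt : blockOf s u < Nat.card S.prefixes) (h : Checked S nd m (pos u) s) :
    Checked S nd m (pos u + 1) (checkRank.apply s) ∧ (checkRank.apply s).reg 22 = pos u + 1 := by
  subst h16
  have hnode := hr.listed.node u trivial
  have split : ∀ w : S.prefixes, pos w < pos u + 1 → pos w < pos u ∨ w = u := fun w hw =>
    (Nat.lt_succ_iff_lt_or_eq.1 hw).imp_right fun e => pos_injective e
  by_cases h0 : s.mem 16 (nd u.1) = 0
  · have e : checkRank.apply s = s.setReg 22 (pos u + 1) := by
      simp [checkRank, Program.apply, Expr.eval, h22, hnode, h0]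
    rw [e]
    refine ⟨⟨fun b hb hne => ?_, fun k w hw hm => ?_, fun k => ?_⟩, by simp⟩
    · obtain ⟨w, hw, k⟩ := h.rank b hb hne
      exact ⟨w, by omega, k⟩
    · rcases split w hw with q | rfl
      · exact h.good (by simpa using k) w q hm
      · exact absurd h0 hm
    · obtain ⟨w, w', hw, hw', q⟩ := h.bad (by simpa using k)
      exact ⟨w, w', by omega, by omega, q⟩
  by_cases h2 : s.mem 2 (blockOf s u) = 0
  · have e : checkRank.apply s = (s.setMem 2 (blockOf s u) (s.mem 16 (nd u.1))).setReg 22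
        (pos u + 1) := by
      simp [checkRank, Program.apply, Expr.eval, h22, hnode, h0, h15, h2]
    rw [e]
    have hb : ∀ w : S.prefixes, blockOf ((s.setMem 2 (blockOf s u) (s.mem 16 (nd u.1))).setReg 22
        (pos u + 1)) w = blockOf s w := by
      intro w
      simp [blockOf]
    refine ⟨⟨fun b hb' hne => ?_, fun k w hw hm => ?_, fun k => ?_⟩, by simp⟩
    · by_cases eb : b = blockOf s u
      · exact ⟨u, by omega, by rw [hb, eb], by simp [eb]⟩
      · obtain ⟨w, hw, k1, k2⟩ := h.rank b hb' (by simpa [eb] using hne)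
        exact ⟨w, by omega, by rw [hb, k1], by simpa [eb] using k2⟩
    · rw [hb]
      rcases split w hw with q | rfl
      · have := h.good (by simpa using k) w q hm
        have hne : blockOf s w ≠ blockOf s u := by
          intro e
          rw [e, h2] at this
          exact hm this.symm
        simpa [hne] using this
      · simp
    · obtain ⟨w, w', hw, hw', q1, q2⟩ := h.bad (by simpa using k)
      exact ⟨w, w', by omega, by omega, by rw [hb, hb, q1], q2⟩
  by_cases h3 : s.mem 2 (blockOf s u) = s.mem 16 (nd u.1)
  · have e : checkRank.apply s = s.setReg 22 (pos u + 1) := by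
      simp only [checkRank, Program.apply, neq_eval]
      simp [Expr.eval, h22, hnode, h0, h15, h3]
    rw [e]
    refine ⟨⟨fun b hb hne => ?_, fun k w hw hm => ?_, fun k => ?_⟩, by simp⟩
    · obtain ⟨w, hw, k⟩ := h.rank b hb hne
      exact ⟨w, by omega, k⟩
    · rcases split w hw with q | rfl
      · exact h.good (by simpa using k) w q hm
      · exact h3
    · obtain ⟨w, w', hw, hw', q⟩ := h.bad (by simpa using k)
      exact ⟨w, w', by omega, by omega, q⟩
  · have e : checkRank.apply s = (s.setReg 21 1).setReg 22 (pos u + 1) := by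
      simp only [checkRank, Program.apply, neq_eval]
      simp [Expr.eval, h22, hnode, h0, h15, h2, h3]
    rw [e]
    refine ⟨⟨fun b hb hne => ?_, fun k w hw hm => ?_, fun k => ?_⟩, by simp⟩
    · obtain ⟨w, hw, k⟩ := h.rank b hb hne
      exact ⟨w, by omega, k⟩
    · simp at k
    -- The clash is witnessed by `u` and the earlier prefix from which the block has its rank.
    · obtain ⟨w, hw, k1, k2⟩ := h.rank _ hlt h2
      exact ⟨w, u, by omega, by omega, k1, by rw [k2]; exact h2, h0, by rw [k2]; exact h3⟩

/-- Clearing the transition table costs `O(N k)`; after that, each of the `N` prefixes takes a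
constant number of steps. -/
theorem computeRun_spec {s : State} {I : ℕ} (hr : Ready S nd s) (h20 : s.reg 20 = I) :
    Runs computeRun s ((Nat.card S.prefixes + 1) * (Fintype.card σ + 1) * 200) fun s' =>
      Placed S (arrayTarget S (s.mem 18) I) (Nat.card S.prefixes) s' ∧
        Checked S nd (s.mem 16) (Nat.card S.prefixes) s' := by
  let Inv : ℕ → State → Prop := fun v s' => Ready S nd s' ∧ s'.reg 20 = I ∧ s'.reg 22 = v ∧
    s'.mem 18 = s.mem 18 ∧ s'.mem 16 = s.mem 16 ∧ Placed S (arrayTarget S (s.mem 18) I) v s' ∧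
    Checked S nd (s.mem 16) v s'
  set N := Nat.card S.prefixes with hN
  set k := Fintype.card σ with hk
  refine Runs.mono (c := (N * k + 2) * 20 + ((N + 1) * 20 + (6 + (N + 1) * (130 + 4))))
    ?_ ?_ (fun _ h => h)
  swap
  · nlinarith [Nat.zero_le (N * k), Nat.zero_le N, Nat.zero_le k]
  have c1 := clearTransitions_spec s
  rw [hr.entries] at c1
  refine Runs.seq_frame c1 ?_
  intro s1 a1 a2 a3
  have c2 := clearRanks_spec s1
  rw [a2 6 (by decide), hr.trie.card, card_prefixFinset] at c2
  refine Runs.seq_frame c2 ?_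
  intro s2 b1 b2 b3
  refine Runs.seq ((Runs.straight rfl ?_).mono (by decide)
    (Post := fun s' => s' = ((s2.setReg 0 0).setReg 21 0).setReg 22 0) ?_)
  · simp [Program.apply, Expr.eval]
  rintro _ rfl
  refine (Runs.for (c := 130) (Inv := Inv) N ?_ ?_ ?_).mono (by rfl) ?_
  · have hr2 : Ready S nd s2 := (hr.congr a2 a3).congr b2 b3
    have hm1 : ∀ i ≤ N * k, s2.mem 1 i = 0 := by
      intro i hi
      rw [b3 1 (by decide)]
      exact a1 i hi
    refine ⟨hr2.congr (R := [0, 21, 22]) (M := []) ?_ (by simp), ?_, by simp, ?_, ?_,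
      ⟨by simp, by simp, by simp, by simp, by simp, ?_, fun _ => hm1 _ le_rfl⟩,
      ⟨?_, by simp, by simp⟩⟩
    · intro x hx
      simp only [List.mem_cons, List.not_mem_nil, or_false, not_or] at hx
      simp [hx.1, hx.2.1, hx.2.2]
    · simp [b2 20 (by decide), a2 20 (by decide), h20]
    · simp [b3 18 (by decide), a3 18 (by decide)]
    · simp [b3 16 (by decide), a3 16 (by decide)]
    · intro b a hb hne
      exact absurd (hm1 _ (tableIndex_lt (letterCode_lt_card a) hb).le) hne
    · intro b hb hne
      exact absurd (b1 b hb) hne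
  · rintro i s' hi ⟨q1, -, q3, -⟩
    simp only [Expr.eval, q1.trie.card, card_prefixFinset, q3]
    omega
  · rintro i s' hi ⟨q1, q2, q3, q4, q5, q6, q7⟩
    obtain ⟨u, rfl⟩ := exists_pos_eq hi
    obtain ⟨p1, p2, p3⟩ := placePrefix_spec q1 q2 q3 q4 q6
    refine Runs.mono (c := placePrefix.bound + checkRank.bound) ?_ (by decide) (fun _ h => h)
    refine Runs.seq_frame (Runs.straight (Post := fun s'' => s'' = placePrefix.apply s') rfl
      rfl) ?_
    rintro _ rfl f1 f2
    have hr1 := q1.congr f1 f2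
    have hlt := lt_of_lt_of_le (p1.lt u (by omega)) (p1.le.trans hi)
    obtain ⟨z1, z2⟩ := checkRank_spec hr1 ((f2 16 (by decide)).trans q5)
      ((f1 22 (by decide)).trans q3) p3 hlt
      (q7.congr (f2 2 (by decide)) (f1 21 (by decide)) p2)
    refine (Runs.straight (Post := fun s'' => s'' = checkRank.apply (placePrefix.apply s')) rfl
      rfl).frame.mono le_rfl ?_
    rintro _ ⟨rfl, g1, g2⟩
    refine ⟨hr1.congr g1 g2, ?_, z2, ?_, ?_, ?_, z1⟩
    · rw [g1 20 (by decide), f1 20 (by decide), q2]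
    · rw [g2 18 (by decide), f2 18 (by decide), q4]
    · rw [g2 16 (by decide), f2 16 (by decide), q5]
    · have hb : (blockOf (checkRank.apply (placePrefix.apply s')) : S.prefixes → ℕ) =
          blockOf (placePrefix.apply s') := by
        funext w
        simp only [blockOf, g2 4 (by decide)]
      have h0 := g1 0 (by decide)
      have h1 := g2 1 (by decide)
      exact ⟨hb ▸ p1.run, by rw [hb, h0]; exact p1.lt, by rw [hb, h0]; exact p1.surj,
        h0 ▸ p1.le, by rw [hb, h1]; exact p1.trans, by rw [hb, h1]; exact p1.exists_trans,
        by rw [h1]; exact p1.dummy⟩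
  · rintro s' ⟨-, -, -, -, -, q6, q7⟩
    exact ⟨q6, q7⟩

end Learner

/-! ### The learning program -/

set_option linter.unusedSectionVars false

namespace Learner

open RAM Sample

variable {σ : Type*} [Fintype σ] [LinearOrder σ] {S : Sample σ} {hS : S.Nonempty}
  {nd : List σ → ℕ} {l : List (List σ × List σ × Comparison)}

def nextTarget : Program :=
  .seq (.put 18 (.reg 20) (.add (.get 18 (.reg 20)) (.lit 1))) computeRun

/-- One round of the outer loop: the targets for the prefix at the position in register `20` are
tried in ascending order. -/
def learnPrefix : Program :=
  .seq (.put 18 (.reg 20) (.lit 0)) <|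
  .seq computeRun <|
  .seq (.loop (.reg 21) nextTarget) <|
  .set 20 (.add (.reg 20) (.lit 1))

/-- The size of the transition table is obtained without multiplication, as the beginning of the
last row of the trie plus the size of the alphabet. -/
def learnPrefixes : Program :=
  .seq (.seq (.set 19 (.add (.get 6 (.sub (.reg 6) (.lit 1))) (.reg 3))) (.set 20 (.lit 0))) <|
  .seq (.loop (.sub (.reg 6) (.reg 20)) learnPrefix) <|
  .set 2 (.get 4 (.lit 0))

/-- The implementation of `LearnPDFA`. -/
def learner : Program :=
  .seq readSample <| .seq sortNodes <| .seq components <| .seq numberRanks <|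
  .seq orderRanks learnPrefixes

/-- Array `16` is injective on ranks and nonzero exactly on words, so a clash of entries is a clash
of ranks. -/
theorem Checked.rankCons_iff {s0 s : State} {r : ℕ} {f : S.Ranks ≃ Fin r}
    (hk : Ranked S nd f s0) (h : Checked S nd (s0.mem 16) (Nat.card S.prefixes) s) :
    s.reg 21 = 0 ↔ (S.prefixTree hS).RankCons (Setoid.ker (blockOf s)) := by
  have hword : ∀ u : S.prefixes, s0.mem 16 (nd u.1) ≠ 0 → u.1 ∈ S.words := by
    intro u hu
    by_contra hw
    exact hu (hk.not_word _ (mem_prefixFinset.2 u.2) hw)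
  constructor
  · intro h0 x y o o' hxy hx hy
    obtain ⟨kx, rfl⟩ := rank_eq_some_iff.1 hx
    obtain ⟨ky, rfl⟩ := rank_eq_some_iff.1 hy
    have ex := hk.word ⟨_, kx⟩
    have ey := hk.word ⟨_, ky⟩
    have gx := h.good h0 x (pos_lt_card x) (by rw [ex]; omega)
    have gy := h.good h0 y (pos_lt_card y) (by rw [ey]; omega)
    have hxy' : blockOf s x = blockOf s y := hxy
    rw [hxy', gy, ey, ex] at gx
    have key : f (S.comp ⟨_, ky⟩) = f (S.comp ⟨_, kx⟩) := Fin.ext (Nat.succ_injective gx)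
    exact (f.injective key).symm
  · intro hc
    by_contra h0
    obtain ⟨u, u', -, -, e, h1, h2, h3⟩ := h.bad h0
    have hu := hword u h1
    have hu' := hword u' h2
    have := hc u u' _ _ e (rank_eq_some_iff.2 ⟨hu, rfl⟩) (rank_eq_some_iff.2 ⟨hu', rfl⟩)
    have ex := hk.word ⟨_, hu⟩
    have ey := hk.word ⟨_, hu'⟩
    refine h3 (ex.trans (Eq.trans ?_ ey.symm))
    unfold comp
    rw [this]

/-- The invariant of the outer loop: `c` is the run for the targets of the prefixes at positions
below `i`. -/
structure Learned (hS : S.Nonempty) (us : List S.prefixes) (c : S.prefixes → ℕ) (i : ℕ)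
    (s : State) : Prop where
  lt : ∀ u, c u < Nat.card S.prefixes
  run : ∀ u, RunAt (target (fun u => s.mem 18 (pos u)) {u : S.prefixes | pos u < i}) c u
  cons : (S.prefixTree hS).RankCons (Setoid.ker c)
  loop : S.LearnLoop hS (us.take i).tail ⊥ (Setoid.ker c)

/-- The run without targets puts every prefix into a block of its own, numbered by its position; the
outer loop starts from it. -/
theorem runAt_pos (t : S.prefixes → ℕ) (u : S.prefixes) : RunAt (target t ∅) pos u := by
  refine Or.inr ⟨?_, pos u, ⟨fun v hv => pos_lt_pos hv, fun b hb => ?_⟩, ?_⟩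
  · rintro v hv ⟨x, y, a, h1, h2, h3⟩
    rw [h1, h2, pos_injective h3] at hv
    exact WordLT.irrefl _ hv
  · obtain ⟨v, rfl⟩ := exists_pos_eq (hb.trans (pos_lt_card u))
    exact ⟨v, pos_lt_pos_iff.1 hb, rfl⟩
  · simp [target]

/-- What is known when the target `q` has been tried for the prefix `i`, where `s0` is the state in
which the round began. -/
structure Tried (hS : S.Nonempty) (nd : List σ → ℕ) {r : ℕ} (f : S.Ranks ≃ Fin r) (s0 : State)
    (i : S.prefixes) (q : ℕ) (s : State) : Prop where
  ready : Ready S nd s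
  ranked : Ranked S nd f s
  position : s.reg 20 = pos i
  current : s.mem 18 (pos i) = q
  below : ∀ u : S.prefixes, pos u < pos i → s.mem 18 (pos u) = s0.mem 18 (pos u)
  placed : Placed S (arrayTarget S (s.mem 18) (pos i)) (Nat.card S.prefixes) s
  checked : Checked S nd (s.mem 16) (Nat.card S.prefixes) s
  failed : ∀ q' < q, ∃ (t : S.prefixes → ℕ) (c : S.prefixes → ℕ),
    (∀ u : S.prefixes, WordLT u.1 i.1 → s0.mem 18 (pos u) = t u) ∧ t i = q' ∧
    (∀ u, RunAt (target t {u | ¬ WordLT i.1 u.1}) c u) ∧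
    ¬ (S.prefixTree hS).RankCons (Setoid.ker c)

theorem setOf_pos_lt (i : S.prefixes) :
    {u : S.prefixes | pos u < pos i} = {u : S.prefixes | WordLT u.1 i.1} := by
  ext u
  exact pos_lt_pos_iff

theorem setOf_pos_le (i : S.prefixes) :
    {u : S.prefixes | pos u ≤ pos i} = {u : S.prefixes | ¬ WordLT i.1 u.1} := by
  ext u
  change pos u ≤ pos i ↔ ¬ WordLT i.1 u.1
  rw [← pos_lt_pos_iff, not_lt]

theorem Tried.run {r : ℕ} {f : S.Ranks ≃ Fin r} {s0 s : State} {i : S.prefixes} {q : ℕ}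
    (h : Tried hS nd f s0 i q s) (u : S.prefixes) :
    RunAt (target (fun u => s.mem 18 (pos u)) {u | ¬ WordLT i.1 u.1}) (blockOf s) u := by
  rw [← setOf_pos_le]
  exact h.placed.run u (pos_lt_card u)

/-- A failed target `q` is less than `c i`: otherwise it would stand for a new block or not be used
at all, and the run would be `c`, which is consistent. This bounds the number of attempts. -/
theorem Tried.next {r : ℕ} {f : S.Ranks ≃ Fin r} {s0 s : State} {us : List S.prefixes}
    {c : S.prefixes → ℕ} {i : S.prefixes} {q : ℕ} (hc : Learned hS us c (pos i) s0)
    (h : Tried hS nd f s0 i q s) (hbad : s.reg 21 ≠ 0) :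
    q < Nat.card S.prefixes ∧ Runs nextTarget s
      ((Nat.card S.prefixes + 1) * (Fintype.card σ + 1) * 200 + 7) (Tried hS nd f s0 i (q + 1)) := by
  have hncons : ¬ (S.prefixTree hS).RankCons (Setoid.ker (blockOf s)) :=
    (h.checked.rankCons_iff h.ranked).not.1 hbad
  have hrun := hc.run
  rw [setOf_pos_lt] at hrun
  have hq : q < c i := by
    by_contra hq
    refine hncons ?_
    rw [← RunAt.eq_of_not_used hrun h.run
      (fun u hu => (h.below u (pos_lt_pos hu)).symm) fun _ => by rw [h.current]; omega]
    exact hc.cons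
  refine ⟨hq.trans (hc.lt i), ?_⟩
  refine Runs.mono (c := 7 + (Nat.card S.prefixes + 1) * (Fintype.card σ + 1) * 200) ?_ (by omega)
    (fun _ h => h)
  refine Runs.seq ((Runs.straight rfl ?_).mono (by decide)
    (Post := fun s' => s' = s.setMem 18 (pos i) (q + 1)) ?_)
  · simp [Program.apply, Expr.eval, h.position, h.current]
  rintro _ rfl
  have hready : Ready S nd (s.setMem 18 (pos i) (q + 1)) :=
    h.ready.congr (R := []) (M := [18]) (by simp) (by
      intro a ha
      have : a ≠ 18 := by simpa using ha
      funext j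
      simp [this])
  refine (computeRun_spec (I := pos i) hready (by simpa using h.position)).frame.mono le_rfl ?_
  rintro s' ⟨⟨k1, k2⟩, f1, f2⟩
  have m18 : s'.mem 18 = (s.setMem 18 (pos i) (q + 1)).mem 18 := f2 18 (by decide)
  have m16 : s'.mem 16 = (s.setMem 18 (pos i) (q + 1)).mem 16 := f2 16 (by decide)
  have m16' : s'.mem 16 = s.mem 16 := by
    rw [m16]
    funext j
    simp
  refine ⟨hready.congr f1 f2, h.ranked.congr (by rw [f1 1 (by decide)]; simp) m16', ?_, ?_, ?_,
    by rw [m18]; exact k1, by rw [m16]; exact k2, ?_⟩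
  · rw [f1 20 (by decide)]
    simpa using h.position
  · rw [m18]
    simp
  · intro u hu
    rw [m18, ← h.below u hu]
    simp [hu.ne]
  · intro q' hq'
    rcases Nat.lt_succ_iff_lt_or_eq.1 hq' with k | rfl
    · exact h.failed q' k
    · exact ⟨fun u => s.mem 18 (pos u), blockOf s,
        fun u hu => (h.below u (pos_lt_pos hu)).symm, h.current, h.run, hncons⟩

/-- The final contents of the memory, apart from the order of the ranks. -/
structure Final (S : Sample σ) (nd : List σ → ℕ) (s : State) : Prop where
  placed : ∃ g, Placed S g (Nat.card S.prefixes) s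
  checked : Checked S nd (s.mem 16) (Nat.card S.prefixes) s
  good : s.reg 21 = 0

theorem learnPrefix_spec {r : ℕ} {f : S.Ranks ≃ Fin r} {s : State} {us : List S.prefixes}
    {c : S.prefixes → ℕ} {i : S.prefixes} (hus : ∀ j (h : j < us.length), pos us[j] = j)
    (hlen : us.length = Nat.card S.prefixes) (hr : Ready S nd s) (hk : Ranked S nd f s)
    (h20 : s.reg 20 = pos i) (hc : Learned hS us c (pos i) s) :
    Runs learnPrefix s
      ((Nat.card S.prefixes + 2) * ((Nat.card S.prefixes + 1) * (Fintype.card σ + 1) * 200 + 20))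
      fun s' => Ready S nd s' ∧ Ranked S nd f s' ∧ s'.reg 20 = pos i + 1 ∧
        Learned hS us (blockOf s') (pos i + 1) s' ∧ Final S nd s' := by
  set N := Nat.card S.prefixes with hN
  set R := (N + 1) * (Fintype.card σ + 1) * 200 with hR
  refine Runs.mono (c := 4 + (R + ((N + 1) * ((R + 7) + 1 + 1) + 4))) ?_ (by nlinarith)
    (fun _ h => h)
  refine Runs.seq ((Runs.straight rfl ?_).mono (by decide)
    (Post := fun s' => s' = s.setMem 18 (pos i) 0) ?_)
  · simp [Program.apply, Expr.eval, h20]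
  rintro _ rfl
  have hready : Ready S nd (s.setMem 18 (pos i) 0) :=
    hr.congr (R := []) (M := [18]) (by simp) (by
      intro a ha
      have : a ≠ 18 := by simpa using ha
      funext j
      simp [this])
  refine Runs.seq_frame (computeRun_spec (I := pos i) hready (by simpa using h20)) ?_
  rintro s1 ⟨k1, k2⟩ f1 f2
  have m18 : s1.mem 18 = (s.setMem 18 (pos i) 0).mem 18 := f2 18 (by decide)
  have m16 : s1.mem 16 = (s.setMem 18 (pos i) 0).mem 16 := f2 16 (by decide)
  have m16' : s1.mem 16 = s.mem 16 := by
    rw [m16]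
    funext j
    simp
  have h0 : Tried hS nd f s i 0 s1 := by
    refine ⟨hready.congr f1 f2, hk.congr (by rw [f1 1 (by decide)]; simp) m16', ?_, ?_, ?_,
      by rw [m18]; exact k1, by rw [m16]; exact k2, by simp⟩
    · rw [f1 20 (by decide)]
      simpa using h20
    · rw [m18]
      simp
    · intro u hu
      rw [m18]
      simp [hu.ne]
  refine Runs.seq ((Runs.while (c := R + 7) (Inv := Tried hS nd f s i) N h0 ?_).mono le_rfl ?_)
  · intro q s' _ h' hbad
    exact h'.next hc hbad
  rintro s' ⟨hgood, q, -, h'⟩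
  have hgood : s'.reg 21 = 0 := hgood
  refine Runs.straight (p := .set 20 (.add (.reg 20) (.lit 1))) rfl ?_
  have hcons : (S.prefixTree hS).RankCons (Setoid.ker (blockOf s')) :=
    (h'.checked.rankCons_iff h'.ranked).1 hgood
  have e : Program.apply (.set 20 (.add (.reg 20) (.lit 1))) s' = s'.setReg 20 (pos i + 1) := by
    simp [Program.apply, Expr.eval, h'.position]
  rw [e]
  refine ⟨h'.ready.congr (R := [20]) (M := []) ?_ (by simp), h'.ranked.congr (by simp) (by simp),
    by simp, ?_, ⟨_, h'.placed.run, h'.placed.lt, h'.placed.surj, h'.placed.le,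
      h'.placed.trans, h'.placed.exists_trans, h'.placed.dummy⟩,
    h'.checked.congr rfl (by simp) fun _ _ => rfl, by simpa using hgood⟩
  · intro x hx
    have : x ≠ 20 := by simpa using hx
    simp [this]
  have hi : pos i < us.length := hlen ▸ pos_lt_card i
  have hui : us[pos i] = i := pos_injective (hus _ hi)
  refine ⟨fun u => lt_of_lt_of_le (h'.placed.lt u (pos_lt_card u)) h'.placed.le, fun u => ?_,
    hcons, ?_⟩
  · have := h'.placed.run u (pos_lt_card u)
    change RunAt (target (fun u => s'.mem 18 (pos u)) {u | pos u < pos i + 1}) (blockOf s') u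
    simpa only [arrayTarget, Nat.lt_succ_iff] using this
  · change S.LearnLoop hS (us.take (pos i + 1)).tail ⊥ (Setoid.ker (blockOf s'))
    rw [List.take_succ_eq_append_getElem hi, hui]
    -- The program also makes a round for `ε`, which the algorithm skips; the run of that round
    -- still has the partition into singletons.
    by_cases h0 : pos i = 0
    · rw [h0]
      have hnil := pos_eq_zero_iff.1 h0
      have hbot : Setoid.ker (blockOf s' : S.prefixes → ℕ) = ⊥ := by
        refine RunAt.ker_eq_bot hS ?_ h'.run
        intro u hu
        have hu' : ¬ WordLT i.1 u.1 := hu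
        rw [hnil] at hu'
        exact (List.shortlex_nil_or_eq_nil u.1).resolve_left hu'
      rw [hbot]
      exact .nil
    · rw [List.tail_append_of_ne_nil]
      · have hrun := hc.run
        rw [setOf_pos_lt] at hrun
        refine hc.loop.snoc (RunAt.learnStep hrun hc.cons h'.run hcons
          (fun u hu => (h'.below u (pos_lt_pos hu)).symm) ?_)
        rw [h'.current]
        exact h'.failed
      · intro hnil
        rw [List.take_eq_nil_iff] at hnil
        rcases hnil with k | k
        · exact h0 k
        · rw [k] at hi
          simp at hi

theorem learnPrefixes_spec {r : ℕ} {f : S.Ranks ≃ Fin r} {s : State} (hS : S.Nonempty)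
    (ht : IsTrie S.prefixFinset nd s) (hl : Listed (Set.univ : Set S.prefixes) nd s)
    (hk : Ranked S nd f s) :
    Runs learnPrefixes s
      ((Nat.card S.prefixes + 1) * ((Nat.card S.prefixes + 2) *
        ((Nat.card S.prefixes + 1) * (Fintype.card σ + 1) * 200 + 20) + 10) + 20)
      fun s' => S.LearnPDFA hS (Setoid.ker (blockOf s')) ∧ Final S nd s' ∧ Ranked S nd f s' ∧
        s'.reg 2 = s'.mem 4 0 := by
  obtain ⟨us, hpw, hall, hlen, hus⟩ := exists_sorted_prefixes (S := S)
  set N := Nat.card S.prefixes with hN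
  set T := (N + 2) * ((N + 1) * (Fintype.card σ + 1) * 200 + 20) with hT
  have hpos : 0 < N := (Nat.zero_le _).trans_lt (pos_lt_card ⟨[], nil_mem_prefixes hS⟩)
  have hrow := ht.row (N - 1) (by rw [card_prefixFinset]; omega)
  -- Before the first round, `c` is the numbering by positions, which is not stored anywhere; from
  -- then on it is the contents of array `4`.
  let Inv : ℕ → State → Prop := fun i s' => Ready S nd s' ∧ Ranked S nd f s' ∧ s'.reg 20 = i ∧
    ∃ c, Learned hS us c i s' ∧ (i ≠ 0 → c = blockOf s' ∧ Final S nd s')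
  refine Runs.mono (c := 10 + ((N + 1) * (T + 3 + 1) + 4)) ?_ (by nlinarith) (fun _ h => h)
  refine Runs.seq ((Runs.straight rfl ?_).mono (by decide)
    (Post := fun s' => s' = (s.setReg 19 (N * Fintype.card σ)).setReg 20 0) ?_)
  · have : (N - 1) * Fintype.card σ + Fintype.card σ = N * Fintype.card σ := by
      rw [← Nat.succ_mul, Nat.succ_eq_add_one, Nat.sub_add_cancel hpos]
    have hcard : s.reg 6 = N := by rw [ht.card, card_prefixFinset]
    simp [Program.apply, Expr.eval, hcard, hrow, ht.alphabet, this]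
  rintro _ rfl
  refine Runs.seq ((Runs.for (c := T) (Inv := Inv) N ?_ ?_ ?_).mono (by rfl) ?_)
  · refine ⟨⟨ht.congr (by simp) (by simp) rfl rfl, ⟨hl.node, hl.parent⟩, by simp [hN]⟩,
      hk.congr (by simp) rfl, by simp, pos, ⟨pos_lt_card, ?_, ?_, ?_⟩, by simp⟩
    · intro u
      have : {u : S.prefixes | pos u < 0} = ∅ := by
        ext v
        simp
      rw [this]
      exact runAt_pos _ u
    · have : Setoid.ker (pos (S := S)) = ⊥ := by
        ext x y
        exact ⟨fun h => pos_injective h, fun h => congrArg pos h⟩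
      rw [this]
      exact rankCons_bot
    · have : Setoid.ker (pos (S := S)) = ⊥ := by
        ext x y
        exact ⟨fun h => pos_injective h, fun h => congrArg pos h⟩
      rw [this]
      exact .nil
  · rintro i s' hi ⟨q1, -, q3, -⟩
    simp only [Expr.eval, q1.trie.card, card_prefixFinset, q3]
    omega
  · rintro i s' hi ⟨q1, q2, q3, c, q4, -⟩
    obtain ⟨u, rfl⟩ := exists_pos_eq hi
    refine (learnPrefix_spec hus hlen q1 q2 q3 q4).mono le_rfl ?_
    rintro s'' ⟨p1, p2, p3, p4, p5⟩
    exact ⟨p1, p2, p3, _, p4, fun _ => ⟨rfl, p5⟩⟩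
  · rintro s' ⟨q1, q2, q3, c, q4, q5⟩
    obtain ⟨rfl, q6⟩ := q5 hpos.ne'
    refine (Runs.straight (p := .set 2 (.get 4 (.lit 0))) rfl ?_).mono (by decide) fun _ h => h
    obtain ⟨g, hg⟩ := q6.placed
    refine ⟨⟨us, hpw, hall, ?_⟩, ⟨⟨g, hg.run, hg.lt, hg.surj, hg.le, hg.trans, hg.exists_trans,
      hg.dummy⟩, q6.checked.congr rfl rfl fun _ _ => rfl, q6.good⟩, q2.congr rfl rfl, ?_⟩
    · have := q4.loop
      rwa [List.take_of_length_le hlen.le] at this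
    · simp [Program.apply, Expr.eval]

/-- The final state contains the result of the algorithm. -/
theorem outputsLearned {r : ℕ} {f : S.Ranks ≃ Fin r} {s : State} (hF : Final S nd s)
    (hk : Ranked S nd f s) (ho : Ordered S f s) (h2 : s.reg 2 = s.mem 4 0) :
    OutputsLearned S hS (Setoid.ker (blockOf s)) s := by
  obtain ⟨g, hg⟩ := hF.placed
  have hcons : (S.prefixTree hS).RankCons (Setoid.ker (blockOf s)) :=
    (hF.checked.rankCons_iff hk).1 hF.good
  obtain rfl := hk.count
  let e : Quotient (Setoid.ker (blockOf s : S.prefixes → ℕ)) → Fin (s.reg 0) :=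
    Quotient.lift (fun u => ⟨blockOf s u, hg.lt u (pos_lt_card u)⟩) fun _ _ h => Fin.ext h
  have he : Function.Bijective e := by
    constructor
    · rintro ⟨x⟩ ⟨y⟩ h
      exact Quotient.sound (s := Setoid.ker (blockOf s)) (congrArg Fin.val h)
    · intro b
      obtain ⟨u, -, hu⟩ := hg.surj b b.2
      exact ⟨Quotient.mk _ u, Fin.ext hu⟩
  refine ⟨Equiv.ofBijective e he, f, ?_, ?_, ?_, ho, ?_⟩
  · rw [h2]
    change _ = s.mem 4 (pos _)
    rw [pos_eq_zero_iff.2]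
    rfl
  · rintro ⟨x⟩ a
    change (∀ B' ∈ _, s.mem 1 (blockOf s x * Fintype.card σ + letterCode a) = _) ∧
      (_ → s.mem 1 (blockOf s x * Fintype.card σ + letterCode a) = 0)
    constructor
    · rintro _ ⟨y, z, hy, rfl, hz⟩
      have hy' : blockOf s y = blockOf s x := Quotient.exact (s := Setoid.ker (blockOf s)) hy
      rw [← hy']
      exact hg.trans z y a (pos_lt_card z) hz
    · intro hempty
      by_contra hne
      obtain ⟨u, y, -, hu, ey⟩ := hg.exists_trans _ a
        (lt_of_lt_of_le (hg.lt x (pos_lt_card x)) hg.le) hne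
      have : Quotient.mk (Setoid.ker (blockOf s)) u ∈ ((S.prefixTree hS).quotient
          (Setoid.ker (blockOf s))).step (Quotient.mk _ x) a :=
        ⟨y, u, Quotient.sound (s := Setoid.ker (blockOf s)) ey, rfl, hu⟩
      change _ ∈ ((S.prefixTree hS).quotient (Setoid.ker (blockOf s))).step (Quotient.mk _ x) a
        at this
      rw [show ((S.prefixTree hS).quotient (Setoid.ker (blockOf s))).step (Quotient.mk _ x) a = ∅
        from hempty] at this
      exact this
  · rintro ⟨x⟩
    change (∀ o, _ = some o → s.mem 2 (blockOf s x) = (f o : ℕ) + 1) ∧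
      (_ = none → s.mem 2 (blockOf s x) = 0)
    constructor
    · intro o h
      obtain ⟨y, hxy, hy⟩ := hcons.rank_quotient.1 h
      obtain ⟨hw, rfl⟩ := rank_eq_some_iff.1 hy
      have ew := hk.word ⟨_, hw⟩
      have hxy' : blockOf s x = blockOf s y := hxy
      rw [hxy', hF.checked.good hF.good y (pos_lt_card y) (by rw [ew]; omega), ew]
      rfl
    · intro h
      by_contra hne
      obtain ⟨u, -, hu, hm⟩ := hF.checked.rank _
        (lt_of_lt_of_le (hg.lt x (pos_lt_card x)) hg.le) hne
      have hnone := hcons.rank_quotient_eq_none.1 h u hu.symm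
      by_cases hw : u.1 ∈ S.words
      · have := rank_eq_some_iff (hS := hS).2 ⟨hw, rfl⟩
        rw [hnone] at this
        simp at this
      · rw [hk.not_word _ (mem_prefixFinset.2 u.2) hw] at hm
        exact hne hm.symm
  · intro u
    rfl

end Learner

/-! ### Correctness and running time of the learning program -/

namespace Sample

variable {σ : Type*} [LinearOrder σ] {S : Sample σ}

theorem length_le_totalLength {w : List σ} (h : w ∈ S.words) : w.length ≤ S.totalLength :=
  Finset.single_le_sum (f := List.length) (fun _ _ => Nat.zero_le _) h

theorem card_words_le : S.words.card ≤ 2 * S.card := by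
  unfold words
  refine (Finset.card_union_le _ _).trans ?_
  have h1 := Finset.card_image_le (s := S) (f := fun x => x.1)
  have h2 := Finset.card_image_le (s := S) (f := fun x => x.2.1)
  omega

theorem card_ranks_le : Nat.card S.Ranks ≤ 2 * S.card := by
  refine le_trans ?_ (card_words_le (S := S))
  have := Nat.card_le_card_of_surjective (S.indifferenceGraph.connectedComponentMk)
    Quot.mk_surjective
  simpa using this

/-- A nonempty prefix of `w` is determined by its length, between `1` and the length of `w`; the
additional `1` accounts for `ε`. -/
theorem card_prefixes_le : Nat.card S.prefixes ≤ S.totalLength + 1 := by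
  rw [← card_prefixFinset]
  have hsub : S.prefixFinset ⊆ insert [] (S.words.biUnion fun w =>
      (Finset.range w.length).image fun i => w.take (i + 1)) := by
    intro u hu
    obtain ⟨w, hw, hp⟩ := mem_prefixFinset.1 hu
    rcases List.eq_nil_or_concat u with rfl | ⟨y, b, e⟩
    · simp
    · refine Finset.mem_insert_of_mem (Finset.mem_biUnion.2 ⟨w, hw, Finset.mem_image.2
        ⟨y.length, ?_, ?_⟩⟩)
      · have := hp.length_le
        rw [e] at this
        simpa using this
      · have := List.prefix_iff_eq_take.1 hp
        rw [this, e]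
        simp
  refine (Finset.card_le_card hsub).trans ((Finset.card_insert_le _ _).trans
    (Nat.succ_le_succ (Finset.card_biUnion_le.trans (Finset.sum_le_sum fun w _ => ?_))))
  exact Finset.card_image_le.trans (by simp)

/-- The nucleus contains the words of length one, which must be prefixes of words of the sample.
Without this, the factor `k + 1` would not be controlled when `m = 0`. -/
theorem IsCharacteristic.card_eq_zero [Fintype σ] {Q O : Type*} [PartialOrder O] {A : PDFA σ Q O}
    (h : S.IsCharacteristic A) (h0 : S.totalLength = 0) : Fintype.card σ = 0 := by
  by_contra hk
  obtain ⟨a⟩ := Fintype.card_pos_iff.1 (Nat.pos_of_ne_zero hk)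
  obtain ⟨w, hw, hp⟩ := h.nucleus_subset (Or.inl ⟨[], PDFA.nil_mem_shortestPrefixes, a, rfl⟩)
  have h1 := hp.length_le
  have h2 := length_le_totalLength hw
  simp at h1
  omega

theorem card_pos_of_totalLength [Fintype σ] (h : S.totalLength ≠ 0) : 0 < Fintype.card σ := by
  by_contra hk
  have : IsEmpty σ := Fintype.card_eq_zero_iff.1 (by omega)
  refine h (Finset.sum_eq_zero fun w _ => ?_)
  cases w with
  | nil => rfl
  | cons a _ => exact isEmptyElim a

end Sample

namespace Learner

open RAM Sample

theorem listLength_le {σ : Type*} [LinearOrder σ] {S : Sample σ}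
    {l : List (List σ × List σ × Comparison)} (hl : ∀ x ∈ l, x ∈ S) :
    listLength l ≤ l.length * (2 * S.totalLength) := by
  have := List.sum_le_card_nsmul (l.map fun x => x.1.length + x.2.1.length) (2 * S.totalLength) ?_
  · simpa [listLength] using this
  · intro n hn
    obtain ⟨x, hx, rfl⟩ := List.mem_map.1 hn
    have hx := hl x hx
    have h1 : x.1 ∈ S.words := Finset.mem_union_left _ (Finset.mem_image_of_mem _ hx)
    have h2 : x.2.1 ∈ S.words :=
      Finset.mem_union_right _ (Finset.mem_image_of_mem (fun x => x.2.1) hx)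
    have := length_le_totalLength h1
    have := length_le_totalLength h2
    omega

/-- A bound for the running time of `learner` on a sample with `n` triples, `N` prefixes, `r` ranks
and total length `L` of the listed words, over an alphabet with `k` letters. -/
def learnerTime (n N r L k : ℕ) : ℕ :=
  (L * (readLetter.bound + 2) + n * 64 + 20) + ((N + 1) * (k + 1) * 80 +
    ((n + 1) * (N + 1) * 100 + ((N + 1) * 50 + ((n + 1) * ((r + 1) * (r + 1)) * 150 +
    ((N + 1) * ((N + 2) * ((N + 1) * (k + 1) * 200 + 20) + 10) + 20)))))

theorem learner_spec {σ : Type*} [Fintype σ] [LinearOrder σ] {S : Sample σ}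
    {l : List (List σ × List σ × Comparison)} (hS : S.Nonempty) (hl : l.toFinset = S) :
    Runs learner (State.init (sampleCode l))
      (learnerTime l.length (Nat.card S.prefixes) (Nat.card S.Ranks) (listLength l)
        (Fintype.card σ))
      fun s => ∃ π, S.LearnPDFA hS π ∧ OutputsLearned S hS π s := by
  -- The phases rely on fresh arrays being zero; this is carried through the earlier phases, which
  -- do not write to these arrays.
  have hzero : ∀ a i, a ≠ 0 → (State.init (sampleCode l)).mem a i = 0 := by
    intro a i ha
    simp [State.init, ha]
  refine Runs.seq_frame (readSample_spec S hS l hl) ?_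
  rintro s1 ⟨nd, hp⟩ - m1
  refine Runs.seq_frame (sortNodes_spec hS hp.trie) ?_
  intro s2 hn r2 m2
  replace hp := hp.congr r2 m2
  rw [← card_prefixFinset]
  refine Runs.seq_frame (components_spec hl hp fun i => ?_) ?_
  · rw [m2 13 (by decide), m1 13 (by decide), hzero _ _ (by decide)]
  intro s3 hc r3 m3
  replace hp := hp.congr r3 m3
  replace hn := hn.congr m3
  refine Runs.seq_frame (numberRanks_spec hl hp hc (fun i => ?_) fun i => ?_) ?_
  · rw [m3 15 (by decide), m2 15 (by decide), m1 15 (by decide), hzero _ _ (by decide)]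
  · rw [m3 16 (by decide), m2 16 (by decide), m1 16 (by decide), hzero _ _ (by decide)]
  rintro s4 ⟨r, f, hk⟩ r4 m4
  replace hp := hp.congr r4 m4
  replace hn := hn.congr m4
  have hr : Nat.card S.Ranks = r := by rw [Nat.card_congr f, Nat.card_fin]
  rw [hr]
  refine Runs.seq_frame (orderRanks_spec hl hp hk (fun i => ?_) fun i => ?_) ?_
  · rw [m4 3 (by decide), m3 3 (by decide), m2 3 (by decide), m1 3 (by decide),
      hzero _ _ (by decide)]
  · rw [m4 17 (by decide), m3 17 (by decide), m2 17 (by decide), m1 17 (by decide),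
      hzero _ _ (by decide)]
  intro s5 ho r5 m5
  replace hp := hp.congr r5 m5
  replace hn := hn.congr m5
  replace hk := hk.congr (r5 1 (by decide)) (m5 16 (by decide))
  rw [card_prefixFinset]
  refine (learnPrefixes_spec hS hp.trie hn hk).frame.mono le_rfl ?_
  rintro s6 ⟨⟨h1, h2, h3, h4⟩, -, m6⟩
  refine ⟨_, h1, outputsLearned h2 h3 ?_ h4⟩
  unfold Ordered
  rw [m6 3 (by decide)]
  exact ho

theorem learnerTime_mono {n N N' r r' L L' k : ℕ} (hN : N ≤ N') (hr : r ≤ r') (hL : L ≤ L') :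
    learnerTime n N r L k ≤ learnerTime n N' r' L' k := by
  unfold learnerTime
  gcongr

/-- The time contains constants and factors `m + 1` and `k + 1`. They can be absorbed into `m` and
`k` if both are positive; if both are zero, everything is bounded by `n ^ 3`. -/
theorem learnerTime_le {n m k : ℕ} (hn : 1 ≤ n) (h : m = 0 ∧ k = 0 ∨ 1 ≤ m ∧ 1 ≤ k) :
    learnerTime n (m + 1) (2 * n) (n * (2 * m)) k ≤ 100000 * (m ^ 3 * k ^ 2 + n ^ 3) := by
  have hb : readLetter.bound ≤ 60 := by decide
  have n3 : n ≤ n ^ 3 := Nat.le_self_pow (by decide) n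
  have h2 : (n + 1) * ((2 * n + 1) * (2 * n + 1)) ≤ 18 * n ^ 3 := by
    calc (n + 1) * ((2 * n + 1) * (2 * n + 1))
        ≤ (n + n) * ((2 * n + n) * (2 * n + n)) := by gcongr
      _ = 18 * n ^ 3 := by ring
  have h1 : n * (2 * m) * (readLetter.bound + 2) ≤ n * (2 * m) * 62 := by gcongr; omega
  rcases h with ⟨rfl, rfl⟩ | ⟨hm, hk⟩
  · unfold learnerTime
    nlinarith
  · have hmk : m ^ 3 ≤ m ^ 3 * k ^ 2 := Nat.le_mul_of_pos_right _ (by positivity)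
    have hmk' : m ^ 3 * k ≤ m ^ 3 * k ^ 2 :=
      Nat.mul_le_mul_left _ (Nat.le_self_pow (by decide) k)
    -- The mixed terms come from reading the words and from finding the components; the larger of
    -- the two factors dominates.
    have mn : n * m ≤ m ^ 3 + n ^ 3 := by
      rcases le_total n m with e | e
      · calc n * m ≤ m * m := by gcongr
          _ = m ^ 2 := by ring
          _ ≤ m ^ 3 := Nat.pow_le_pow_right hm (by decide)
          _ ≤ _ := Nat.le_add_right _ _
      · calc n * m ≤ n * n := by gcongr
          _ = n ^ 2 := by ring
          _ ≤ n ^ 3 := Nat.pow_le_pow_right hn (by decide)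
          _ ≤ _ := Nat.le_add_left _ _
    have m3 : m ≤ m ^ 3 := Nat.le_self_pow (by decide) m
    have m3k : m * k ≤ m ^ 3 * k := Nat.mul_le_mul_right _ m3
    have nm : n * (2 * m) = 2 * (n * m) := by ring
    have ha : (m + 1 + 1) * (k + 1) ≤ 6 * (m ^ 3 * k) := by
      calc (m + 1 + 1) * (k + 1) ≤ (m + m + m) * (k + k) := by gcongr
        _ = 6 * (m * k) := by ring
        _ ≤ _ := by gcongr
    have hb' : (n + 1) * (m + 1 + 1) ≤ 6 * (n * m) := by
      calc (n + 1) * (m + 1 + 1) ≤ (n + n) * (m + m + m) := by gcongr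
        _ = 6 * (n * m) := by ring
    -- The main loop: prefixes times targets times the cost of a run.
    have hc : (m + 1 + 1) * ((m + 1 + 2) * ((m + 1 + 1) * (k + 1) * 200 + 20) + 10) ≤
        20000 * (m ^ 3 * k) := by
      calc (m + 1 + 1) * ((m + 1 + 2) * ((m + 1 + 1) * (k + 1) * 200 + 20) + 10)
          ≤ (m + m + m) * ((m + m + 2 * m) * ((m + m + m) * (k + k) * 200 + 20 * (m * k)) +
              10 * (m * m * k)) := by
            have : 1 ≤ m * k := Nat.mul_pos hm hk
            have : 1 ≤ m * m * k := Nat.mul_pos (Nat.mul_pos hm hm) hk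
            gcongr <;> omega
        _ = 14670 * (m ^ 3 * k) := by ring
        _ ≤ _ := by gcongr; decide
    unfold learnerTime
    omega

end Learner

theorem mainTheorem2 :
    -- on characteristic samples the algorithm returns an isomorphic copy of the canonical automaton
    (∀ (σ : Type*) [Fintype σ] [LinearOrder σ] (Q O : Type*) [PartialOrder O]
        (A : PDFA σ Q O) (S : Sample σ) (hS : S.Nonempty),
      A.IsCanonical → S.Consistent A → S.IsCharacteristic A →
      (∃ π, S.LearnPDFA hS π) ∧
      ∀ π, S.LearnPDFA hS π → ((S.prefixTree hS).quotient π).IsIsomorphic A) ∧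
    -- the algorithm is implemented by a program that obeys the time bound on characteristic samples
    (∃ (P : RAM.Program) (C : ℕ), ∀ (σ : Type*) [Fintype σ] [LinearOrder σ]
        (S : Sample σ) (hS : S.Nonempty) (l : List (List σ × List σ × Comparison)),
      l.Nodup → l.toFinset = S →
      ∃ (s : RAM.State) (t : ℕ), RAM.Exec P (RAM.State.init (sampleCode l)) s t ∧
        (∃ π, S.LearnPDFA hS π ∧ OutputsLearned S hS π s) ∧
        ∀ (Q O : Type*) [PartialOrder O] (A : PDFA σ Q O),
          A.IsCanonical → S.Consistent A → S.IsCharacteristic A →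
          t ≤ C * (S.totalLength ^ 3 * Fintype.card σ ^ 2 + S.card ^ 3)) := by
  refine ⟨?_, Learner.learner, 100000, ?_⟩
  · intro σ _ _ Q O _ A S hS _ hc hchar
    -- That the algorithm has a result at all is read off from the machine, which halts with one on
    -- any list of the triples.
    obtain ⟨s, t, -, -, π, hπ, -⟩ := Learner.learner_spec hS S.toList_toFinset
    refine ⟨⟨π, hπ⟩, fun π' hπ' => ?_⟩
    rw [hπ'.eq_evalSetoid hc hchar]
    exact Sample.isIsomorphic_evalSetoid hc hchar
  · intro σ _ _ S hS l hnd hl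
    obtain ⟨s, t, hs, ht, hout⟩ := Learner.learner_spec hS hl
    refine ⟨s, t, hs, hout, fun Q O _ A _ _ hchar => ht.trans ?_⟩
    have hlen : l.length = S.card := by rw [← hl, List.toFinset_card_of_nodup hnd]
    rw [hlen]
    refine (Learner.learnerTime_mono Sample.card_prefixes_le Sample.card_ranks_le
      (hlen ▸ Learner.listLength_le fun x hx => hl ▸ List.mem_toFinset.2 hx)).trans
      (Learner.learnerTime_le (Finset.card_pos.2 hS) ?_)
    -- Either `m` and `k` are both zero, or there is a letter in some word and both are positive.
    by_cases h0 : S.totalLength = 0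
    · exact Or.inl ⟨h0, hchar.card_eq_zero h0⟩
    · exact Or.inr ⟨Nat.pos_of_ne_zero h0, Sample.card_pos_of_totalLength h0⟩
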